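/- **Conventions.** All matrices are complex $n\times n$, $(A,B)=\operatorname{Tr}(A^\dagger B)$, $\|A\|_2^2=(A,A)$ and $\|A\|_1=\operatorname{Tr}\sqrt{A^\dagger A}$. A *state* is a positive semidefinite matrix $\rho$ with $\operatorname{Tr}\rho=1$; $\operatorname{sgn}\rho$ is obtained by applying the sign function to its eigenvalues. With $\pi$ the orthogonal projection onto $\ker\rho$, let $T$ be the real space of Hermitian $\sigma$ with $\pi\sigma\pi=0$, and let $\mathcal P_T$ be the Hilbert–Schmidt orthogonal projection of Hermitian matrices onto $T$, i.e. $\mathcal P_T\sigma=\sigma-\pi\sigma\pi$. A *tight frame* is a (measurable) family $(w_\alpha)_{\alpha\in S}$ of Hermitian matrices, indexed by a probability space $(S,\mu)$, with $\int (w_\alpha,\sigma)\,w_\alpha\,d\mu(\alpha)=\sigma/n^2$ for all Hermitian $\sigma$. For $m$ observables $w_1,\dots,w_m$ let $\mathcal R\sigma=\frac{n^2}{m}\sum_{i=1}^m (w_i,\sigma)w_i$, and consider the reconstruction procedure $$\min\{\|\sigma\|_1:\ \sigma \text{ Hermitian},\ \mathcal R\sigma=\mathcal R\rho\}.\qquad(*)$$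 The failure probability $p_f(\rho)$ is the probability that $\rho$ is not the unique solution of $(*)$ when $w_1,\dots,w_m$ are drawn independently from the frame according to $\mu$. A function $f:\mathbb N\to\mathbb R$ is *polylogarithmic* if $f(n)=O((\log n)^d)$ as $n\to\infty$ for some $d$. **Theorem (Non-Fourier-type efficient compressed sensing).** Let $\nu,K:\mathbb N\to\mathbb R$ be polylogarithmic. Then there is a polylogarithmic function $q$ such that the following holds for all $n$, $r$ and $m$ with $m\ge q(n)\,n\,r$, every tight frame $(w_\alpha)_{\alpha\in S}$ of $n\times n$ matrices with $\|w_\alpha\|_2^2\le K(n)$ for $\mu$-almost every $\alpha$ (for instance a normalized one, $\|w_\alpha\|_2=1$, with $K=1$), and every state $\rho$ of rank $r$. Let $C\subset S$ be the set of all $\alpha$ that violate at least one of the two conditions $$\|\mathcal P_T w_\alpha\|_2^2\le\frac{2\nu(n) r}{n},\qquad (w_\alpha,\operatorname{sgn}\rho)^2\le\frac{\nu(n) r}{n^2}.$$ If $\mu(C)\le (16\sqrt r\,n^2m)^{-1}$, then $p_f(\rho)<1/2$. In particular, if the bound on $\mu(C)$ holds for $m=\lceil q(n)\,n\,r\rceil=O(nr\,\mathrm{polylog}(n))$,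 efficient compressed sensing of $\rho$ is possible with that many observables. -/

import Mathlib

open MeasureTheory Matrix Asymptotics Filter
open scoped ComplexOrder

universe u

noncomputable section

namespace QCS

/-- Hilbert-Schmidt scalar product `(A, B) = Tr(A† B)`. It is real for Hermitian `A`, `B`, the only
matrices it is applied to; the real part makes it a real number by type. -/
def hsInner {n : ℕ} (A B : Matrix (Fin n) (Fin n) ℂ) : ℝ :=
  (Aᴴ * B).trace.re

/-- Squared Frobenius norm `‖A‖₂² = Tr(A† A)`. -/
def hsNormSq {n : ℕ} (A : Matrix (Fin n) (Fin n) ℂ) : ℝ :=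
  hsInner A A

/-- Trace norm `‖A‖₁ = Tr √(A† A)`. -/
def traceNorm {n : ℕ} (A : Matrix (Fin n) (Fin n) ℂ) : ℝ :=
  (cfc Real.sqrt (Aᴴ * A)).trace.re

/-- The sign function applied to the eigenvalues of a Hermitian matrix. -/
def sgn {n : ℕ} (A : Matrix (Fin n) (Fin n) ℂ) : Matrix (Fin n) (Fin n) ℂ :=
  cfc Real.sign A

/-- A quantum state: a positive semidefinite matrix of trace one. -/
def IsState {n : ℕ} (ρ : Matrix (Fin n) (Fin n) ℂ) : Prop :=
  ρ.PosSemidef ∧ ρ.trace = 1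

/-- The matrix of the orthogonal projection onto the kernel of `ρ`. -/
def kerProj {n : ℕ} (ρ : Matrix (Fin n) (Fin n) ℂ) : Matrix (Fin n) (Fin n) ℂ :=
  (Matrix.toEuclideanCLM (n := Fin n) (𝕜 := ℂ)).symm
    (LinearMap.ker (Matrix.toEuclideanCLM (n := Fin n) (𝕜 := ℂ) ρ).toLinearMap).starProjection

/-- The real space `T` of Hermitian matrices `σ` with `π σ π = 0`, where `π` is the orthogonal
projection onto the kernel of `ρ`. -/
def tangentSpace {n : ℕ} (ρ : Matrix (Fin n) (Fin n) ℂ) :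
    Submodule ℝ (Matrix (Fin n) (Fin n) ℂ) where
  carrier := {σ | σ.IsHermitian ∧ kerProj ρ * σ * kerProj ρ = 0}
  add_mem' := by
    rintro a b ⟨ha, ha'⟩ ⟨hb, hb'⟩
    exact ⟨ha.add hb, by rw [mul_add, add_mul, ha', hb', add_zero]⟩
  zero_mem' := ⟨Matrix.isHermitian_zero, by simp⟩
  smul_mem' := by
    rintro c a ⟨ha, ha'⟩
    refine ⟨?_, by rw [mul_smul_comm, smul_mul_assoc, ha', smul_zero]⟩
    show (c • a)ᴴ = c • a
    rw [Matrix.conjTranspose_smul, ha.eq, star_trivial]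

/-- The projection `P_T` of Hermitian matrices onto `T`. That it is the orthogonal projection for
the Hilbert-Schmidt scalar product is the content of the lemmas below. -/
def projT {n : ℕ} (ρ σ : Matrix (Fin n) (Fin n) ℂ) : Matrix (Fin n) (Fin n) ℂ :=
  σ - kerProj ρ * σ * kerProj ρ

theorem kerProj_isHermitian {n : ℕ} (ρ : Matrix (Fin n) (Fin n) ℂ) : (kerProj ρ).IsHermitian := by
  show star (kerProj ρ) = kerProj ρ
  unfold kerProj
  apply EquivLike.injective (Matrix.toEuclideanCLM (n := Fin n) (𝕜 := ℂ))
  rw [map_star, StarAlgEquiv.apply_symm_apply, (isSelfAdjoint_starProjection _).star_eq]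

theorem kerProj_mul_self {n : ℕ} (ρ : Matrix (Fin n) (Fin n) ℂ) :
    kerProj ρ * kerProj ρ = kerProj ρ := by
  unfold kerProj
  rw [← map_mul, (Submodule.isIdempotentElem_starProjection _).eq]

theorem projT_mem {n : ℕ} (ρ : Matrix (Fin n) (Fin n) ℂ) {σ : Matrix (Fin n) (Fin n) ℂ}
    (hσ : σ.IsHermitian) : projT ρ σ ∈ tangentSpace ρ := by
  have hp := kerProj_isHermitian ρ
  have h2 := kerProj_mul_self ρ
  refine ⟨hσ.sub ?_, ?_⟩
  · show (kerProj ρ * σ * kerProj ρ)ᴴ = _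
    rw [conjTranspose_mul, conjTranspose_mul, hp.eq, hσ.eq, mul_assoc]
  · have : kerProj ρ * (kerProj ρ * σ * kerProj ρ) * kerProj ρ =
        (kerProj ρ * kerProj ρ) * σ * (kerProj ρ * kerProj ρ) := by simp only [mul_assoc]
    rw [projT, mul_sub, sub_mul, this, h2, sub_self]

theorem hsInner_sub_projT {n : ℕ} (ρ σ : Matrix (Fin n) (Fin n) ℂ)
    {τ : Matrix (Fin n) (Fin n) ℂ} (hτ : τ ∈ tangentSpace ρ) :
    hsInner τ (σ - projT ρ σ) = 0 := by
  obtain ⟨h1, h2⟩ := hτ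
  have : (τᴴ * (σ - projT ρ σ)).trace = (kerProj ρ * τ * kerProj ρ * σ).trace := by
    rw [projT, sub_sub_cancel, h1.eq, ← mul_assoc, Matrix.trace_mul_comm]
    simp only [mul_assoc]
  rw [hsInner, this, h2]
  simp

/-- A tight frame of observables: Hermitian matrices `w α`, with `α` distributed according to `μ`,
such that `∫ (w α, σ) w α dμ(α) = σ / n²` for every Hermitian `σ` (an integral of matrices, read
entry by entry). No normalization of the individual `w α` is required. -/
structure IsTightFrame {n : ℕ} {S : Type*} [MeasurableSpace S] (μ : Measure S)
    (w : S → Matrix (Fin n) (Fin n) ℂ) : Prop where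
  measurable : ∀ i j, Measurable fun α => w α i j
  hermitian : ∀ α, (w α).IsHermitian
  integrable : ∀ σ : Matrix (Fin n) (Fin n) ℂ, σ.IsHermitian → ∀ i j,
    Integrable (fun α => (hsInner (w α) σ • w α) i j) μ
  integral_eq : ∀ σ : Matrix (Fin n) (Fin n) ℂ, σ.IsHermitian → ∀ i j,
    ∫ α, (hsInner (w α) σ • w α) i j ∂μ = σ i j / (n : ℂ) ^ 2

/-- The sampling operator `R σ = (n² / m) ∑ᵢ (wᵢ, σ) wᵢ` of the observables `w₁, …, w_m`. -/
def samplingOp {n m : ℕ} (w : Fin m → Matrix (Fin n) (Fin n) ℂ) (σ : Matrix (Fin n) (Fin n) ℂ) :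
    Matrix (Fin n) (Fin n) ℂ :=
  ((n : ℝ) ^ 2 / m) • ∑ i, hsInner (w i) σ • w i

/-- The feasible set of the reconstruction: Hermitian `σ` with `R σ = R ρ`. -/
def feasible {n m : ℕ} (w : Fin m → Matrix (Fin n) (Fin n) ℂ) (ρ : Matrix (Fin n) (Fin n) ℂ) :
    Set (Matrix (Fin n) (Fin n) ℂ) :=
  {σ | σ.IsHermitian ∧ samplingOp w σ = samplingOp w ρ}

/-- The solutions of the reconstruction procedure: minimize `‖σ‖₁` subject to `R σ = R ρ`. -/
def solutions {n m : ℕ} (w : Fin m → Matrix (Fin n) (Fin n) ℂ) (ρ : Matrix (Fin n) (Fin n) ℂ) :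
    Set (Matrix (Fin n) (Fin n) ℂ) :=
  {σ | σ ∈ feasible w ρ ∧ ∀ τ ∈ feasible w ρ, traceNorm σ ≤ traceNorm τ}

/-- The failure probability `p_f(ρ)`: the probability, for `m` observables drawn independently from
`μ`, that `ρ` is not the one and only solution of the reconstruction procedure. -/
def failureProb {n : ℕ} {S : Type*} [MeasurableSpace S] (μ : Measure S)
    (w : S → Matrix (Fin n) (Fin n) ℂ) (ρ : Matrix (Fin n) (Fin n) ℂ) (m : ℕ) : ENNReal :=
  (Measure.pi fun _ : Fin m => μ) {s | solutions (fun i => w (s i)) ρ ≠ {ρ}}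

/-- The set `C` of frame elements that violate at least one of the two incoherence conditions, for
a state `ρ` of rank `r`. -/
def badSet {n : ℕ} {S : Type*} (w : S → Matrix (Fin n) (Fin n) ℂ)
    (ρ : Matrix (Fin n) (Fin n) ℂ) (r : ℕ) (ν : ℝ) : Set S :=
  {α | ¬ (hsNormSq (projT ρ (w α)) ≤ 2 * ν * r / n ∧
    hsInner (w α) (sgn ρ) ^ 2 ≤ ν * r / (n : ℝ) ^ 2)}

/-- `f(n) = O(polylog(n))`. -/
def IsPolylog (f : ℕ → ℝ) : Prop :=
  ∃ d : ℕ, f =O[atTop] fun n : ℕ => Real.log n ^ d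

end QCS

end

/-!
Recovery is certified by convex duality and the certificate is built by golfing.

**Duality.** Let `π` project onto `ker ρ`, let `P = P_T`, and let `Δ` be a Hermitian perturbation
that is orthogonal to all sampled observables. If `Y` is a combination of the sampled observables
with `P Y` close to `sgn ρ` and `‖π Y π‖ ≤ 1/2`, then pairing `ρ + Δ` with the contraction
`sgn ρ + π Y π + (π Δ π) / (2 ‖π Δ π‖₂)` shows `‖ρ + Δ‖₁ ≥ 1 + ‖π Δ π‖₂ / 2 - ‖X‖₂ ‖P Δ‖₂`, where
`X = sgn ρ - P Y`. This excludes `Δ ≠ 0` once `‖P Δ‖₂` is at most polynomially larger than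
`‖π Δ π‖₂` and `X` is correspondingly small (`eq_zero_of_traceNorm_add_le`).

**Golfing.** The samples are split into `l = O(L)` batches of size `k`, where `L` bounds `ν`, `K` and
`log n`. With `R` the sampling operator of a batch, a step replaces the remainder `X` by `X - P R X`
and adds `R X` to the certificate. The observables in `C`, or of too large norm, are replaced by
zero. This makes the incoherence conditions hold everywhere at the price of a small error `ε` in the
frame identity (`IsTightFrame.isSamplingFrame_truncFrame`).

* A second moment computation shows that a step contracts every vector in the range of `P` in mean
  square. Golfing from all vectors of an orthonormal basis then yields the polynomial comparison of
  `‖P Δ‖₂` with `‖Δ - P Δ‖₂` (`IsSamplingFrame.measure_not_norm_proj_sq_le`); no operator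
  concentration inequality on matrix space is needed.
* For the certificate started at `sgn ρ`, the invariant `IsIncoherent` at scale `s` says that the
  remainder has norm at most `s √r` and that all but a fraction `δ` of the observables have overlap
  at most `s β` with it. The overlaps cannot be controlled for all frame elements at once, since the
  frame may be infinite. For a fixed observable Bernstein's inequality applies, and Fubini's theorem
  with Markov's inequality turns this into the bound `δ` on the exceptional fraction
  (`IsSamplingFrame.measureReal_overlap_step_le`). Truncating the coefficients at `s β` makes the
  exceptional fraction harmless in all estimates.
* The increment `R X` has operator norm at most `s / 4` on `ker ρ` by concentration of sums of
  independent Hermitian matrices (`integral_norm_sum_hermitian_sub_le`). That estimate follows from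
  symmetrization and the noncommutative Khintchine inequality, whose trace moments are bounded by
  integration by parts in the signs (`sum_trace_signSum_pow_step`).

Halving `s` in each step makes the certificate bounded by a geometric series, and `18 L` steps absorb
every factor polynomial in `n`. All failure events together have probability at most `1/4`.
-/

namespace QCS

/-! ### Noncommutative Khintchine inequality in mean operator norm -/

section MatrixKhintchine

open scoped Matrix.Norms.L2Operator MatrixOrder

variable {n : ℕ}

/-- For even `s`, the sum of all `|x|^q |y|^(s-q)` is at most its value at the two ends. -/
lemma sum_pow_mul_pow_le (x y : ℝ) (s : ℕ) (hs : Even s) :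
    ∑ q ∈ Finset.range (s + 1), x ^ q * y ^ (s - q) ≤ (s + 1) / 2 * (x ^ s + y ^ s) := by
  have key : ∀ q ∈ Finset.range (s + 1),
      x ^ q * y ^ (s - q) + x ^ (s - q) * y ^ q ≤ x ^ s + y ^ s := by
    intro q hq
    have hq' : q ≤ s := Nat.lt_succ_iff.mp (Finset.mem_range.mp hq)
    have h1 : x ^ q * y ^ (s - q) + x ^ (s - q) * y ^ q
        ≤ |x| ^ q * |y| ^ (s - q) + |x| ^ (s - q) * |y| ^ q := by
      gcongr ?_ + ?_ <;>
      · refine (le_abs_self _).trans (le_of_eq ?_)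
        rw [abs_mul, abs_pow, abs_pow]
    have h2 : |x| ^ q * |y| ^ (s - q) + |x| ^ (s - q) * |y| ^ q ≤ |x| ^ s + |y| ^ s := by
      have e1 : |x| ^ s = |x| ^ q * |x| ^ (s - q) := by rw [← pow_add, Nat.add_sub_cancel' hq']
      have e2 : |y| ^ s = |y| ^ q * |y| ^ (s - q) := by rw [← pow_add, Nat.add_sub_cancel' hq']
      rw [e1, e2]
      rcases le_total |x| |y| with h | h
      · have a1 := pow_le_pow_left₀ (abs_nonneg x) h q
        have a2 := pow_le_pow_left₀ (abs_nonneg x) h (s - q)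
        nlinarith
      · have a1 := pow_le_pow_left₀ (abs_nonneg y) h q
        have a2 := pow_le_pow_left₀ (abs_nonneg y) h (s - q)
        nlinarith
    rw [hs.pow_abs, hs.pow_abs] at h2
    exact h1.trans h2
  have hrefl : ∑ q ∈ Finset.range (s + 1), x ^ (s - q) * y ^ q
      = ∑ q ∈ Finset.range (s + 1), x ^ q * y ^ (s - q) := by
    rw [← Finset.sum_range_reflect]
    refine Finset.sum_congr rfl fun q hq => ?_
    have hq' : q ≤ s := Nat.lt_succ_iff.mp (Finset.mem_range.mp hq)
    have : s + 1 - 1 - q = s - q := by omega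
    rw [this, Nat.sub_sub_self hq']
  have := Finset.sum_le_sum key
  rw [Finset.sum_add_distrib, hrefl, Finset.sum_const, Finset.card_range, nsmul_eq_mul] at this
  push_cast at this
  linarith

/-- In eigenbases of `H` and `K`, the trace of `A f(H) A g(K)` is a sum of squared moduli of the
matrix entries of `A`, weighted by values of `f` and `g` at the eigenvalues. -/
lemma trace_mul_pow_mul_pow {A H K : Matrix (Fin n) (Fin n) ℂ} (hA : A.IsHermitian)
    (hH : H.IsHermitian) (hK : K.IsHermitian) (q r : ℕ) :
    (A * H ^ q * A * K ^ r).trace.re =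
      ∑ i, ∑ j, Complex.normSq
        ((hH.eigenvectorUnitary.1ᴴ * A * hK.eigenvectorUnitary.1 : Matrix (Fin n) (Fin n) ℂ) i j)
        * (hH.eigenvalues i ^ q * hK.eigenvalues j ^ r) := by
  set U : Matrix (Fin n) (Fin n) ℂ := hH.eigenvectorUnitary.1 with hU
  set W : Matrix (Fin n) (Fin n) ℂ := hK.eigenvectorUnitary.1 with hW
  set D : Matrix (Fin n) (Fin n) ℂ := diagonal (RCLike.ofReal ∘ hH.eigenvalues) with hD
  set F : Matrix (Fin n) (Fin n) ℂ := diagonal (RCLike.ofReal ∘ hK.eigenvalues) with hF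
  have eH : H = U * D * Uᴴ := by
    have := hH.spectral_theorem
    rwa [Unitary.conjStarAlgAut_apply] at this
  have eK : K = W * F * Wᴴ := by
    have := hK.spectral_theorem
    rwa [Unitary.conjStarAlgAut_apply] at this
  have uU : Uᴴ * U = 1 := Unitary.coe_star_mul_self hH.eigenvectorUnitary
  have uW : Wᴴ * W = 1 := Unitary.coe_star_mul_self hK.eigenvectorUnitary
  have pw : ∀ (U D : Matrix (Fin n) (Fin n) ℂ), Uᴴ * U = 1 → U * Uᴴ = 1 →
      ∀ q : ℕ, (U * D * Uᴴ) ^ q = U * D ^ q * Uᴴ := by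
    intro U D h h' q
    induction q with
    | zero => simp [h']
    | succ q ih =>
      rw [pow_succ, ih, pow_succ]
      calc U * D ^ q * Uᴴ * (U * D * Uᴴ) = U * D ^ q * (Uᴴ * U) * D * Uᴴ := by
            simp only [mul_assoc]
        _ = _ := by rw [h]; simp only [mul_assoc, one_mul]
  have hHq : H ^ q = U * D ^ q * Uᴴ := by
    conv_lhs => rw [eH]
    exact pw _ _ uU (mul_eq_one_comm.mp uU) q
  have hKr : K ^ r = W * F ^ r * Wᴴ := by
    conv_lhs => rw [eK]
    exact pw _ _ uW (mul_eq_one_comm.mp uW) r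
  set B := Uᴴ * A * W with hB
  have hBs : Bᴴ = Wᴴ * A * U := by
    rw [hB, conjTranspose_mul, conjTranspose_mul, conjTranspose_conjTranspose, hA.eq, mul_assoc]
  have : (A * H ^ q * A * K ^ r).trace = (Bᴴ * D ^ q * B * F ^ r).trace := by
    rw [hHq, hKr, hBs, hB]
    calc (A * (U * D ^ q * Uᴴ) * A * (W * F ^ r * Wᴴ)).trace
        = ((A * U * D ^ q * Uᴴ * A * W * F ^ r) * Wᴴ).trace := by simp only [mul_assoc]
      _ = (Wᴴ * (A * U * D ^ q * Uᴴ * A * W * F ^ r)).trace := Matrix.trace_mul_comm _ _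
      _ = _ := by simp only [mul_assoc]
  rw [this, hD, hF, diagonal_pow, diagonal_pow, Matrix.trace]
  simp only [diag_apply, mul_diagonal, Pi.pow_apply, Function.comp_apply]
  rw [Complex.re_sum]
  rw [Finset.sum_comm]
  refine Finset.sum_congr rfl fun j _ => ?_
  rw [Matrix.mul_apply, Finset.sum_mul, Complex.re_sum]
  refine Finset.sum_congr rfl fun i _ => ?_
  rw [mul_diagonal, conjTranspose_apply]
  simp only [Pi.pow_apply, Function.comp_apply]
  have h1 : star (B i j) * (RCLike.ofReal (hH.eigenvalues i) : ℂ) ^ q * B i j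
      * (RCLike.ofReal (hK.eigenvalues j) : ℂ) ^ r
      = ((Complex.normSq (B i j) * (hH.eigenvalues i ^ q * hK.eigenvalues j ^ r) : ℝ) : ℂ) := by
    push_cast
    rw [← Complex.mul_conj]
    simp only [Complex.star_def, RCLike.ofReal_alg, Complex.real_smul, mul_one]
    ring
  rw [h1, Complex.ofReal_re]

/-- The trace form of the mean value inequality for `x ↦ x ^ (s + 1)`: the noncommutative difference
quotient is at most the mean of the derivatives at the two ends. -/
lemma sum_trace_mul_pow_mul_pow_le {A H K : Matrix (Fin n) (Fin n) ℂ} (hA : A.IsHermitian)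
    (hH : H.IsHermitian) (hK : K.IsHermitian) (s : ℕ) (hs : Even s) :
    ∑ q ∈ Finset.range (s + 1), (A * H ^ q * A * K ^ (s - q)).trace.re ≤
      (s + 1) / 2 * ((A * A * H ^ s).trace.re + (A * A * K ^ s).trace.re) := by
  have e1 : (A * A * H ^ s).trace.re = (A * H ^ s * A * K ^ 0).trace.re := by
    rw [pow_zero, mul_one, Matrix.trace_mul_comm (A * H ^ s), mul_assoc]
  have e2 : (A * A * K ^ s).trace.re = (A * H ^ 0 * A * K ^ s).trace.re := by
    rw [pow_zero, mul_one]
  rw [e1, e2]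
  simp only [trace_mul_pow_mul_pow hA hH hK]
  simp only [pow_zero, mul_one, one_mul]
  rw [Finset.sum_comm, ← Finset.sum_add_distrib, Finset.mul_sum]
  refine Finset.sum_le_sum fun i _ => ?_
  rw [Finset.sum_comm, ← Finset.sum_add_distrib, Finset.mul_sum]
  refine Finset.sum_le_sum fun j _ => ?_
  rw [← Finset.mul_sum, ← mul_add, mul_left_comm]
  exact mul_le_mul_of_nonneg_left (sum_pow_mul_pow_le _ _ s hs) (Complex.normSq_nonneg _)

lemma trace_mul_re_nonneg {A B : Matrix (Fin n) (Fin n) ℂ} (hA : A.PosSemidef)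
    (hB : B.PosSemidef) : 0 ≤ (A * B).trace.re := by
  obtain ⟨C, rfl⟩ := CStarAlgebra.nonneg_iff_eq_star_mul_self.mp hB.nonneg
  rw [star_eq_conjTranspose]
  rw [← mul_assoc, Matrix.trace_mul_comm, ← mul_assoc]
  exact (RCLike.nonneg_iff.mp (hA.mul_mul_conjTranspose_same C).trace_nonneg).1

/-- Hölder's inequality for positive semidefinite matrices. -/
lemma trace_mul_le_norm_mul_trace {A B : Matrix (Fin n) (Fin n) ℂ} (hA : A.PosSemidef)
    (hB : B.PosSemidef) : (A * B).trace.re ≤ ‖A‖ * B.trace.re := by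
  have h : (algebraMap ℝ (Matrix (Fin n) (Fin n) ℂ) ‖A‖ - A).PosSemidef :=
    Matrix.le_iff.mp (IsSelfAdjoint.le_algebraMap_norm_self (a := A) hA.1)
  have := trace_mul_re_nonneg h hB
  rw [sub_mul, Matrix.trace_sub, Complex.sub_re, Algebra.algebraMap_eq_smul_one, smul_mul_assoc,
    one_mul, Matrix.trace_smul, Complex.real_smul, Complex.re_ofReal_mul] at this
  linarith

lemma norm_le_trace {A : Matrix (Fin n) (Fin n) ℂ} (hA : A.PosSemidef) : ‖A‖ ≤ A.trace.re := by
  have h0 : 0 ≤ A.trace.re := (RCLike.nonneg_iff.mp hA.trace_nonneg).1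
  rw [CStarAlgebra.norm_le_iff_le_algebraMap A h0 hA.nonneg]
  refine le_algebraMap_of_spectrum_le (fun x hx => ?_) hA.1
  rw [hA.1.spectrum_real_eq_range_eigenvalues] at hx
  obtain ⟨i, rfl⟩ := hx
  have : A.trace.re = ∑ i, hA.1.eigenvalues i := by
    rw [hA.1.trace_eq_sum_eigenvalues, Complex.re_sum]
    rfl
  rw [this]
  exact Finset.single_le_sum (fun i _ => hA.eigenvalues_nonneg i) (Finset.mem_univ i)

/-- The real sign `±1` attached to a Boolean. -/
def boolSign (b : Bool) : ℝ := if b then 1 else -1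

@[simp] lemma boolSign_mul_self (b : Bool) : boolSign b * boolSign b = 1 := by
  cases b <;> simp [boolSign]

@[simp] lemma boolSign_not (b : Bool) : boolSign (!b) = -boolSign b := by
  cases b <;> simp [boolSign]

@[simp] lemma abs_boolSign (b : Bool) : |boolSign b| = 1 := by
  cases b <;> simp [boolSign]

/-- The sum `∑ⱼ εⱼ aⱼ` for a pattern of signs `ε`. -/
def signSum {E : Type*} [AddCommGroup E] [Module ℝ E] {k : ℕ} (a : Fin k → E)
    (ε : Fin k → Bool) : E :=
  ∑ j, boolSign (ε j) • a j

/-- Changing the sign at one index. -/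
def flipAt {k : ℕ} (j : Fin k) : (Fin k → Bool) ≃ (Fin k → Bool) where
  toFun ε := Function.update ε j (!ε j)
  invFun ε := Function.update ε j (!ε j)
  left_inv ε := by simp
  right_inv ε := by simp

lemma signSum_sub_flipAt {E : Type*} [AddCommGroup E] [Module ℝ E] {k : ℕ} (a : Fin k → E)
    (ε : Fin k → Bool) (j : Fin k) :
    signSum a ε - signSum a (flipAt j ε) = (2 * boolSign (ε j)) • a j := by
  rw [signSum, signSum, ← Finset.sum_sub_distrib, Finset.sum_eq_single j]
  · simp only [flipAt, Equiv.coe_fn_mk, Function.update_self, boolSign_not]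
    rw [← sub_smul]
    congr 1
    ring
  · intro i _ hi
    simp [flipAt, Function.update_of_ne hi]
  · simp

lemma signSum_isHermitian {k : ℕ} {A : Fin k → Matrix (Fin n) (Fin n) ℂ}
    (hA : ∀ j, (A j).IsHermitian) (ε : Fin k → Bool) : (signSum A ε).IsHermitian := by
  show (signSum A ε)ᴴ = _
  rw [signSum, conjTranspose_sum]
  refine Finset.sum_congr rfl fun j _ => ?_
  rw [conjTranspose_smul, (hA j).eq, star_trivial]

lemma pow_sub_pow_eq_sum {R : Type*} [Ring R] (x y : R) (m : ℕ) :
    x ^ (m + 1) - y ^ (m + 1) = ∑ q ∈ Finset.range (m + 1), x ^ q * (x - y) * y ^ (m - q) := by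
  have key : ∀ q ∈ Finset.range (m + 1), x ^ q * (x - y) * y ^ (m - q)
      = x ^ (q + 1) * y ^ (m + 1 - (q + 1)) - x ^ q * y ^ (m + 1 - q) := by
    intro q hq
    have hq' : q ≤ m := Nat.lt_succ_iff.mp (Finset.mem_range.mp hq)
    rw [mul_sub, sub_mul, ← pow_succ, Nat.add_sub_add_right, Nat.succ_sub hq', mul_assoc (x ^ q),
      ← pow_succ']
  rw [Finset.sum_congr rfl key,
    Finset.sum_range_sub (fun q => x ^ q * y ^ (m + 1 - q)) (m + 1)]
  simp

lemma posSemidef_even_pow {A : Matrix (Fin n) (Fin n) ℂ} (hA : A.IsHermitian) {s : ℕ}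
    (hs : Even s) : (A ^ s).PosSemidef := by
  obtain ⟨t, rfl⟩ := hs
  have h : A ^ (t + t) = (A ^ t)ᴴ * A ^ t := by rw [conjTranspose_pow, hA.eq, pow_add]
  rw [h]
  exact posSemidef_conjTranspose_mul_self _

lemma posSemidef_sum_mul_self {k : ℕ} {A : Fin k → Matrix (Fin n) (Fin n) ℂ}
    (hA : ∀ j, (A j).IsHermitian) : (∑ j, A j * A j).PosSemidef := by
  refine posSemidef_sum _ fun j _ => ?_
  have := posSemidef_conjTranspose_mul_self (A j)
  rwa [(hA j).eq] at this

/-- One step of the noncommutative Khintchine inequality: integration by parts in the signs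
lowers the power of the random sum by two. -/
lemma sum_trace_signSum_pow_step {k : ℕ} {A : Fin k → Matrix (Fin n) (Fin n) ℂ}
    (hA : ∀ j, (A j).IsHermitian) {s : ℕ} (hs : Even s) :
    ∑ ε, (signSum A ε ^ (s + 2)).trace.re ≤
      (s + 1) * ‖∑ j, A j * A j‖ * ∑ ε, (signSum A ε ^ s).trace.re := by
  have hS := signSum_isHermitian hA
  have hj : ∀ j, ∑ ε, boolSign (ε j) * (A j * signSum A ε ^ (s + 1)).trace.re ≤
      (s + 1) * ∑ ε, (A j * A j * signSum A ε ^ s).trace.re := by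
    intro j
    -- flipping the sign `ε j` pairs the terms, so that differences of powers appear
    have h1 : ∑ ε, boolSign (ε j) * (A j * signSum A ε ^ (s + 1)).trace.re =
        ∑ ε, - (boolSign (ε j) * (A j * signSum A (flipAt j ε) ^ (s + 1)).trace.re) := by
      rw [← Equiv.sum_comp (flipAt j)]
      refine Finset.sum_congr rfl fun ε _ => ?_
      have : (flipAt j ε) j = !ε j := by simp [flipAt]
      rw [this, boolSign_not, neg_mul]
    have h2 : ∀ ε, boolSign (ε j) * (A j * signSum A ε ^ (s + 1)).trace.re
        - boolSign (ε j) * (A j * signSum A (flipAt j ε) ^ (s + 1)).trace.re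
        ≤ (s + 1) * ((A j * A j * signSum A ε ^ s).trace.re
          + (A j * A j * signSum A (flipAt j ε) ^ s).trace.re) := by
      intro ε
      have e : boolSign (ε j) * (A j * signSum A ε ^ (s + 1)).trace.re
        - boolSign (ε j) * (A j * signSum A (flipAt j ε) ^ (s + 1)).trace.re
        = 2 * ∑ q ∈ Finset.range (s + 1),
          (A j * signSum A ε ^ q * A j * signSum A (flipAt j ε) ^ (s - q)).trace.re := by
        rw [← mul_sub, ← Complex.sub_re, ← Matrix.trace_sub, ← mul_sub, pow_sub_pow_eq_sum,
          signSum_sub_flipAt, Finset.mul_sum, Matrix.trace_sum, Complex.re_sum, Finset.mul_sum,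
          Finset.mul_sum]
        refine Finset.sum_congr rfl fun q _ => ?_
        rw [mul_smul_comm, smul_mul_assoc, mul_smul_comm, Matrix.trace_smul, Complex.real_smul,
          Complex.re_ofReal_mul, ← mul_assoc, mul_left_comm, boolSign_mul_self, mul_one]
        simp only [mul_assoc]
      rw [e]
      have := sum_trace_mul_pow_mul_pow_le (hA j) (hS ε) (hS (flipAt j ε)) s hs
      linarith
    have h3 := Finset.sum_le_sum fun ε (_ : ε ∈ Finset.univ) => h2 ε
    have h4 : ∑ ε, (A j * A j * signSum A (flipAt j ε) ^ s).trace.re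
        = ∑ ε, (A j * A j * signSum A ε ^ s).trace.re :=
      Equiv.sum_comp (flipAt j) fun ε => (A j * A j * signSum A ε ^ s).trace.re
    rw [Finset.sum_sub_distrib, ← Finset.mul_sum, Finset.sum_add_distrib, h4] at h3
    rw [Finset.sum_neg_distrib] at h1
    linarith
  have e1 : ∑ ε, (signSum A ε ^ (s + 2)).trace.re
      = ∑ j, ∑ ε, boolSign (ε j) * (A j * signSum A ε ^ (s + 1)).trace.re := by
    rw [Finset.sum_comm]
    refine Finset.sum_congr rfl fun ε _ => ?_
    have : signSum A ε ^ (s + 2) = signSum A ε * signSum A ε ^ (s + 1) := by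
      rw [← pow_succ']
    rw [this]
    conv_lhs => enter [1, 1, 1]; rw [signSum]
    rw [Finset.sum_mul, Matrix.trace_sum, Complex.re_sum]
    refine Finset.sum_congr rfl fun j _ => ?_
    rw [smul_mul_assoc, Matrix.trace_smul, Complex.real_smul, Complex.re_ofReal_mul]
  rw [e1]
  calc _ ≤ ∑ j, (s + 1 : ℝ) * ∑ ε, (A j * A j * signSum A ε ^ s).trace.re :=
        Finset.sum_le_sum fun j _ => hj j
    _ = (s + 1) * ∑ ε, ((∑ j, A j * A j) * signSum A ε ^ s).trace.re := by
        rw [← Finset.mul_sum, Finset.sum_comm]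
        congr 1
        refine Finset.sum_congr rfl fun ε _ => ?_
        rw [Finset.sum_mul, Matrix.trace_sum, Complex.re_sum]
    _ ≤ (s + 1) * ∑ ε, ‖∑ j, A j * A j‖ * (signSum A ε ^ s).trace.re := by
        gcongr with ε
        exact trace_mul_le_norm_mul_trace (posSemidef_sum_mul_self hA)
          (posSemidef_even_pow (hS ε) hs)
    _ = _ := by rw [← Finset.mul_sum, mul_assoc]

/-- The noncommutative Khintchine inequality for even trace moments. -/
lemma sum_trace_signSum_pow_le {k : ℕ} {A : Fin k → Matrix (Fin n) (Fin n) ℂ}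
    (hA : ∀ j, (A j).IsHermitian) (p : ℕ) :
    ∑ ε, (signSum A ε ^ (2 * p)).trace.re ≤
      (2 * p * ‖∑ j, A j * A j‖) ^ p * (2 ^ k * n) := by
  have key : ∀ i ≤ p, ∑ ε, (signSum A ε ^ (2 * i)).trace.re ≤
      (2 * p * ‖∑ j, A j * A j‖) ^ i * (2 ^ k * n) := by
    intro i
    induction i with
    | zero => intro _; simp
    | succ i ih =>
      intro hi
      have h1 := sum_trace_signSum_pow_step hA (s := 2 * i) (even_two_mul i)
      have h2 := ih (by omega)
      have hip : ((2 * i : ℕ) : ℝ) + 1 ≤ 2 * p := by exact_mod_cast (by omega : 2 * i + 1 ≤ 2 * p)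
      have h3 : 0 ≤ ∑ ε, (signSum A ε ^ (2 * i)).trace.re :=
        Finset.sum_nonneg fun ε _ => (RCLike.nonneg_iff.mp
          (posSemidef_even_pow (signSum_isHermitian hA ε) (even_two_mul i)).trace_nonneg).1
      calc _ ≤ _ := h1
        _ ≤ (2 * p) * ‖∑ j, A j * A j‖ * ∑ ε, (signSum A ε ^ (2 * i)).trace.re := by gcongr
        _ ≤ (2 * p) * ‖∑ j, A j * A j‖ * ((2 * p * ‖∑ j, A j * A j‖) ^ i * (2 ^ k * n)) := by
            gcongr
        _ = _ := by ring
  exact key p le_rfl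

/-- The mean operator norm of a Rademacher sum of Hermitian matrices. The exponent `2 ^ (t + 1)` is
a power of two, of size at least `2 log₂ n`, so that the trace loses only a constant factor. -/
lemma mean_norm_signSum_le {k : ℕ} {A : Fin k → Matrix (Fin n) (Fin n) ℂ}
    (hA : ∀ j, (A j).IsHermitian) (t : ℕ) (hn : n ≤ 2 ^ 2 ^ t) :
    (∑ ε, ‖signSum A ε‖) / 2 ^ k ≤ √(4 * 2 ^ t * ‖∑ j, A j * A j‖) := by
  have h2k : (0 : ℝ) < 2 ^ k := by positivity
  set p : ℕ := 2 ^ t with hp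
  have hp1 : p ≠ 0 := by positivity
  set y := ‖∑ j, A j * A j‖ with hy
  have hy0 : 0 ≤ y := norm_nonneg _
  have h1 : ∑ ε, ‖signSum A ε‖ ^ (2 * p) ≤ (2 * p * y) ^ p * (2 ^ k * n) := by
    refine le_trans (Finset.sum_le_sum fun ε _ => ?_) (sum_trace_signSum_pow_le hA p)
    have hS := signSum_isHermitian hA ε
    have e : ‖signSum A ε‖ ^ (2 * p) = ‖signSum A ε ^ (2 * p)‖ := by
      have : 2 * p = 2 ^ (t + 1) := by rw [hp, pow_succ']
      rw [this]
      exact (IsSelfAdjoint.norm_pow_two_pow (x := signSum A ε) hS (t + 1)).symm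
    rw [e]
    exact norm_le_trace (posSemidef_even_pow hS (even_two_mul p))
  have h2 : ((∑ ε, ‖signSum A ε‖) / 2 ^ k) ^ (2 * p) ≤ (∑ ε, ‖signSum A ε‖ ^ (2 * p)) / 2 ^ k := by
    have := Real.pow_arith_mean_le_arith_mean_pow (Finset.univ : Finset (Fin k → Bool))
      (fun _ => 1 / 2 ^ k) (fun ε => ‖signSum A ε‖) (fun _ _ => by positivity)
      (by simp) (fun _ _ => norm_nonneg _) (2 * p)
    rw [← Finset.mul_sum, ← Finset.mul_sum, one_div, inv_mul_eq_div, inv_mul_eq_div] at this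
    exact this
  have h3 : ((∑ ε, ‖signSum A ε‖) / 2 ^ k) ^ (2 * p) ≤ (√(4 * p * y)) ^ (2 * p) := by
    rw [pow_mul (√_), Real.sq_sqrt (by positivity)]
    calc _ ≤ _ := h2
      _ ≤ ((2 * p * y) ^ p * (2 ^ k * n)) / 2 ^ k := by gcongr
      _ = (2 * p * y) ^ p * n := by field_simp
      _ ≤ (2 * p * y) ^ p * 2 ^ p := by
          gcongr
          exact_mod_cast hn
      _ = (4 * p * y) ^ p := by rw [← mul_pow]; ring
  have h4 := le_of_pow_le_pow_left₀ (by omega) (Real.sqrt_nonneg _) h3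
  rw [hp] at h4
  push_cast at h4
  exact h4

end MatrixKhintchine

/-! ### Sums of independent random variables -/

section IndependentSums

variable {S : Type*} [MeasurableSpace S] {μ : Measure S} [IsProbabilityMeasure μ] {k : ℕ}

lemma integral_sum_eval {E : Type*} [NormedAddCommGroup E] [NormedSpace ℝ E] {f : S → E}
    (hf : Integrable f μ) :
    ∫ ω : Fin k → S, ∑ j, f (ω j) ∂(Measure.pi fun _ => μ) = (k : ℝ) • ∫ α, f α ∂μ := by
  rw [integral_finsetSum _ fun j _ => integrable_comp_eval (μ := fun _ : Fin k => μ) hf]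
  have : ∀ j : Fin k, ∫ ω : Fin k → S, f (ω j) ∂(Measure.pi fun _ => μ) = ∫ α, f α ∂μ :=
    fun j => integral_comp_eval (μ := fun _ : Fin k => μ) hf.1
  simp [this, ← Nat.cast_smul_eq_nsmul ℝ]

/-- Second moment of the deviation of a sum of independent copies of `f` from a constant. -/
lemma integral_sq_sub_sum_le {f : S → ℝ} (hf : MemLp f 2 μ) (c : ℝ) :
    ∫ ω : Fin k → S, (c - ∑ j, f (ω j)) ^ 2 ∂(Measure.pi fun _ => μ) ≤
      (c - k * ∫ α, f α ∂μ) ^ 2 + k * ∫ α, f α ^ 2 ∂μ := by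
  set P : Measure (Fin k → S) := Measure.pi fun _ => μ with hP
  have hint : Integrable f μ := hf.integrable (by norm_num)
  have hfj : ∀ j : Fin k, MemLp (fun ω : Fin k → S => f (ω j)) 2 P := fun j =>
    hf.comp_measurePreserving (measurePreserving_eval (fun _ => μ) j)
  have hs : MemLp (∑ j : Fin k, fun ω : Fin k → S => f (ω j)) 2 P :=
    memLp_finsetSum' _ fun j _ => hfj j
  have hv := ProbabilityTheory.variance_sum_pi (ι := Fin k) (μ := fun _ => μ) (X := fun _ => f)
    fun _ => hf
  have hm : ∫ ω : Fin k → S, (∑ j : Fin k, fun ω : Fin k → S => f (ω j)) ω ∂P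
      = k * ∫ α, f α ∂μ := by
    simp only [Finset.sum_apply]
    exact integral_sum_eval hint
  have hvle : ProbabilityTheory.variance (∑ j : Fin k, fun ω : Fin k → S => f (ω j)) P
      ≤ k * ∫ α, f α ^ 2 ∂μ := by
    rw [hv, Finset.sum_const, Finset.card_univ, Fintype.card_fin, nsmul_eq_mul]
    gcongr
    exact ProbabilityTheory.variance_le_expectation_sq hf.1
  have hsq : ∫ ω, (∑ j : Fin k, fun ω : Fin k → S => f (ω j)) ω ^ 2 ∂P
      ≤ k * ∫ α, f α ^ 2 ∂μ + (k * ∫ α, f α ∂μ) ^ 2 := by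
    have := ProbabilityTheory.variance_eq_sub hs
    rw [hm] at this
    simp only [Pi.pow_apply] at this
    linarith
  have hi := hs.integrable (by norm_num)
  have hi2 := hs.integrable_sq
  have e : (fun ω : Fin k → S => (c - ∑ j, f (ω j)) ^ 2) = fun ω =>
      c ^ 2 - 2 * c * (∑ j : Fin k, fun ω : Fin k → S => f (ω j)) ω
        + (∑ j : Fin k, fun ω : Fin k → S => f (ω j)) ω ^ 2 := by
    ext ω
    simp only [Finset.sum_apply]
    ring
  have hi3 : Integrable (fun ω : Fin k → S =>
      c ^ 2 - 2 * c * (∑ j : Fin k, fun ω : Fin k → S => f (ω j)) ω) P :=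
    (integrable_const _).sub (hi.const_mul _)
  rw [e, integral_add hi3 hi2,
    integral_sub (integrable_const _) (hi.const_mul _), integral_const_mul, hm]
  simp only [integral_const, probReal_univ, one_smul]
  linarith

/-- Bernstein's inequality, upper tail, with a free parameter `l`. -/
lemma measureReal_sum_sub_ge_le {f : S → ℝ} (hf : Measurable f) {M v l t : ℝ}
    (hM : ∀ α, |f α| ≤ M) (hv : ∫ α, f α ^ 2 ∂μ ≤ v) (hl : 0 ≤ l) (hlM : l * (2 * M) ≤ 1) :
    (Measure.pi fun _ : Fin k => μ).real {ω | t ≤ ∑ j, f (ω j) - k * ∫ α, f α ∂μ} ≤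
      Real.exp (k * (l ^ 2 * v) - l * t) := by
  set P : Measure (Fin k → S) := Measure.pi fun _ => μ with hP
  set e := ∫ α, f α ∂μ with he
  have hint : Integrable f μ := .of_bound hf.aestronglyMeasurable M
    (ae_of_all _ fun α => by simpa using hM α)
  have hint2 : Integrable (fun α => f α ^ 2) μ := .of_bound (hf.pow_const 2).aestronglyMeasurable
    (M ^ 2) (ae_of_all _ fun α => by
      rw [Real.norm_eq_abs, abs_pow]; exact pow_le_pow_left₀ (abs_nonneg _) (hM α) 2)
  have heM : |e| ≤ M := by
    have := norm_integral_le_of_norm_le_const (μ := μ) (f := f) (C := M)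
      (ae_of_all _ fun α => by simpa using hM α)
    simpa using this
  set g : S → ℝ := fun α => l * (f α - e) with hg
  have hg1 : ∀ α, |g α| ≤ 1 := by
    intro α
    rw [hg, abs_mul, abs_of_nonneg hl]
    refine le_trans (mul_le_mul_of_nonneg_left ?_ hl) hlM
    have := abs_sub (f α) e
    linarith [hM α]
  have hgm : Measurable g := (hf.sub_const e).const_mul l
  have hgi : Integrable g μ := (hint.sub (integrable_const e)).const_mul l
  have hgi2 : Integrable (fun α => g α ^ 2) μ := .of_bound (hgm.pow_const 2).aestronglyMeasurable
    1 (ae_of_all _ fun α => by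
      rw [Real.norm_eq_abs, abs_pow]; exact pow_le_one₀ (abs_nonneg _) (hg1 α))
  have hg0 : ∫ α, g α ∂μ = 0 := by
    rw [hg, integral_const_mul, integral_sub hint (integrable_const e)]
    simp [he]
  have hgv : ∫ α, g α ^ 2 ∂μ ≤ l ^ 2 * v := by
    have : ∫ α, g α ^ 2 ∂μ = l ^ 2 * (∫ α, f α ^ 2 ∂μ - e ^ 2) := by
      have h1 : (fun α => g α ^ 2) = fun α => l ^ 2 * (f α ^ 2 - 2 * e * f α + e ^ 2) := by
        ext α; rw [hg]; ring
      have h2 : Integrable (fun α => f α ^ 2 - 2 * e * f α) μ := hint2.sub (hint.const_mul _)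
      rw [h1, integral_const_mul, integral_add h2 (integrable_const _),
        integral_sub hint2 (hint.const_mul _), integral_const_mul, ← he]
      simp only [integral_const, probReal_univ, one_smul]
      ring
    rw [this]
    gcongr
    nlinarith [sq_nonneg e]
  -- `exp x ≤ 1 + x + x²` for `|x| ≤ 1`, which is where the bound on `l` enters
  have hexp : ∫ α, Real.exp (g α) ∂μ ≤ Real.exp (l ^ 2 * v) := by
    have h1 : ∫ α, Real.exp (g α) ∂μ ≤ ∫ α, (1 + g α + g α ^ 2) ∂μ := by
      refine integral_mono_of_nonneg (ae_of_all _ fun α => (Real.exp_pos _).le)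
        (((integrable_const _).add hgi).add hgi2) (ae_of_all _ fun α => ?_)
      have := (abs_le.mp (Real.abs_exp_sub_one_sub_id_le (hg1 α))).2
      simp only
      linarith
    have h2 : ∫ α, (1 + g α + g α ^ 2) ∂μ = 1 + ∫ α, g α ^ 2 ∂μ := by
      rw [integral_add ((integrable_const _).fun_add hgi) hgi2,
        integral_add (integrable_const _) hgi, hg0]
      simp
    have h3 := Real.add_one_le_exp (l ^ 2 * v)
    linarith
  have hprod : ∫ ω : Fin k → S, Real.exp (l * (∑ j, f (ω j) - k * e)) ∂P
      = (∫ α, Real.exp (g α) ∂μ) ^ k := by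
    have := integral_fintype_prod_eq_pow (ι := Fin k) (μ := μ) (fun α => Real.exp (g α))
    rw [Fintype.card_fin] at this
    rw [← this]
    refine integral_congr_ae (ae_of_all _ fun ω => ?_)
    simp only [← Real.exp_sum]
    congr 1
    simp only [hg, ← Finset.mul_sum, Finset.sum_sub_distrib, Finset.sum_const, Finset.card_univ,
      Fintype.card_fin, nsmul_eq_mul]
  have hmeas : Measurable fun ω : Fin k → S => Real.exp (l * (∑ j, f (ω j) - k * e)) := by
    fun_prop
  have hbd : Integrable (fun ω : Fin k → S => Real.exp (l * (∑ j, f (ω j) - k * e))) P := by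
    refine .of_bound hmeas.aestronglyMeasurable (Real.exp k) (ae_of_all _ fun ω => ?_)
    rw [Real.norm_eq_abs, Real.abs_exp, Real.exp_le_exp]
    have : l * (∑ j, f (ω j) - k * e) = ∑ j, g (ω j) := by
      simp only [hg, ← Finset.mul_sum, Finset.sum_sub_distrib, Finset.sum_const, Finset.card_univ,
        Fintype.card_fin, nsmul_eq_mul]
    rw [this]
    calc _ ≤ ∑ j : Fin k, (1 : ℝ) := Finset.sum_le_sum fun j _ => (abs_le.mp (hg1 _)).2
      _ = k := by simp
  have hmk := mul_meas_ge_le_integral_of_nonneg (ae_of_all _ fun ω => (Real.exp_pos _).le) hbd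
    (Real.exp (l * t))
  rw [hprod] at hmk
  have hsub : P.real {ω | t ≤ ∑ j, f (ω j) - k * e} ≤
      P.real {ω | Real.exp (l * t) ≤ Real.exp (l * (∑ j, f (ω j) - k * e))} := by
    refine measureReal_mono fun ω hω => ?_
    simp only [Set.mem_ofPred_eq, Real.exp_le_exp] at hω ⊢
    gcongr
  have h5 : (∫ α, Real.exp (g α) ∂μ) ^ k ≤ Real.exp (k * (l ^ 2 * v)) := by
    rw [Real.exp_nat_mul]
    exact pow_le_pow_left₀ (integral_nonneg fun α => (Real.exp_pos _).le) hexp k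
  rw [Real.exp_sub, le_div_iff₀ (Real.exp_pos _)]
  calc _ ≤ P.real {ω | Real.exp (l * t) ≤ Real.exp (l * (∑ j, f (ω j) - k * e))}
        * Real.exp (l * t) := by gcongr
    _ ≤ _ := by rw [mul_comm]; exact hmk.trans h5

/-- Bernstein's inequality for both tails. -/
lemma measureReal_abs_sum_sub_ge_le {f : S → ℝ} (hf : Measurable f) {M v l t : ℝ}
    (hM : ∀ α, |f α| ≤ M) (hv : ∫ α, f α ^ 2 ∂μ ≤ v) (hl : 0 ≤ l) (hlM : l * (2 * M) ≤ 1) :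
    (Measure.pi fun _ : Fin k => μ).real {ω | t ≤ |∑ j, f (ω j) - k * ∫ α, f α ∂μ|} ≤
      2 * Real.exp (k * (l ^ 2 * v) - l * t) := by
  have h1 := measureReal_sum_sub_ge_le (k := k) (t := t) hf hM hv hl hlM
  have h2 := measureReal_sum_sub_ge_le (k := k) (t := t) hf.neg (M := M) (v := v)
    (by simpa using hM) (by simpa using hv) hl hlM
  have hsub : {ω : Fin k → S | t ≤ |∑ j, f (ω j) - k * ∫ α, f α ∂μ|} ⊆
      {ω | t ≤ ∑ j, f (ω j) - k * ∫ α, f α ∂μ} ∪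
        {ω | t ≤ ∑ j, (-f) (ω j) - k * ∫ α, (-f) α ∂μ} := by
    intro ω hω
    simp only [Set.mem_ofPred_eq, Set.mem_union, Pi.neg_apply, Finset.sum_neg_distrib,
      integral_neg] at hω ⊢
    rcases le_abs.mp hω with h | h
    · exact Or.inl h
    · exact Or.inr (by linarith)
  calc _ ≤ _ := measureReal_mono hsub
    _ ≤ _ := measureReal_union_le _ _
    _ ≤ _ := by linarith

/-- Exchanging the two coordinates of the pairs with index `j` such that `ε j = false`. -/
def swapPairs (ε : Fin k → Bool) (z : (Fin k → S) × (Fin k → S)) :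
    (Fin k → S) × (Fin k → S) :=
  (fun j => if ε j then z.1 j else z.2 j, fun j => if ε j then z.2 j else z.1 j)

lemma measurePreserving_swapPairs (ε : Fin k → Bool) :
    MeasurePreserving (swapPairs (S := S) ε)
      ((Measure.pi fun _ : Fin k => μ).prod (Measure.pi fun _ : Fin k => μ))
      ((Measure.pi fun _ : Fin k => μ).prod (Measure.pi fun _ : Fin k => μ)) := by
  have h0 := measurePreserving_arrowProdEquivProdArrow S S (Fin k) (fun _ => μ) (fun _ => μ)
  let F : (Fin k → S × S) → (Fin k → S × S) := fun z j => if ε j then z j else (z j).swap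
  have h1 : MeasurePreserving F (Measure.pi fun _ => μ.prod μ) (Measure.pi fun _ => μ.prod μ) := by
    refine measurePreserving_pi (fun _ => μ.prod μ) (fun _ => μ.prod μ)
      (f := fun j (z : S × S) => if ε j then z else z.swap) fun j => ?_
    cases ε j
    · simpa using Measure.measurePreserving_swap
    · simpa using! MeasurePreserving.id (μ.prod μ)
  have h2 := (h0.comp h1).comp h0.symm
  convert! h2 using 1
  ext z j
  · simp only [swapPairs, Function.comp_apply, F, MeasurableEquiv.arrowProdEquivProdArrow]
    cases h : ε j <;> simp [h, Equiv.arrowProdEquivProdArrow]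
  · simp only [swapPairs, Function.comp_apply, F, MeasurableEquiv.arrowProdEquivProdArrow]
    cases h : ε j <;> simp [h, Equiv.arrowProdEquivProdArrow]

end IndependentSums

/-! ### Symmetrization and sums of independent Hermitian matrices -/

section Symmetrization

variable {S : Type*} [MeasurableSpace S] {μ : Measure S} [IsProbabilityMeasure μ] {k : ℕ}
  {E : Type*} [NormedAddCommGroup E] [NormedSpace ℝ E]

lemma signSum_sub (a b : Fin k → E) (ε : Fin k → Bool) :
    signSum (fun j => a j - b j) ε = signSum a ε - signSum b ε := by
  simp only [signSum, smul_sub, Finset.sum_sub_distrib]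

lemma norm_signSum_le (a : Fin k → E) (ε : Fin k → Bool) : ‖signSum a ε‖ ≤ ∑ j, ‖a j‖ := by
  refine (norm_sum_le _ _).trans (Finset.sum_le_sum fun j _ => ?_)
  rw [norm_smul, Real.norm_eq_abs, abs_boolSign, one_mul]

lemma stronglyMeasurable_signSum {f : S → E} (hf : StronglyMeasurable f) (ε : Fin k → Bool) :
    StronglyMeasurable fun ω : Fin k → S => signSum (fun j => f (ω j)) ε := by
  refine Finset.stronglyMeasurable_fun_sum _ fun j _ => ?_
  exact (hf.comp_measurable (measurable_pi_apply j)).const_smul _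

lemma integrable_norm_signSum {f : S → E} (hf : StronglyMeasurable f) {R : ℝ}
    (hR : ∀ α, ‖f α‖ ≤ R) (ε : Fin k → Bool) :
    Integrable (fun ω : Fin k → S => ‖signSum (fun j => f (ω j)) ε‖)
      (Measure.pi fun _ => μ) := by
  refine .of_bound (stronglyMeasurable_signSum hf ε).norm.aestronglyMeasurable (∑ _j : Fin k, R)
    (ae_of_all _ fun ω => ?_)
  rw [norm_norm]
  exact (norm_signSum_le _ _).trans (Finset.sum_le_sum fun j _ => hR _)

/-- Symmetrization: the mean deviation of a sum of independent vectors from its expectation is at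
most twice the mean norm of the sum with random signs. -/
lemma integral_norm_sum_sub_le [CompleteSpace E] {f : S → E} (hf : StronglyMeasurable f) {R : ℝ}
    (hR : ∀ α, ‖f α‖ ≤ R) :
    ∫ ω : Fin k → S, ‖∑ j, f (ω j) - (k : ℝ) • ∫ α, f α ∂μ‖ ∂(Measure.pi fun _ => μ) ≤
      2 * ∫ ω : Fin k → S, (∑ ε, ‖signSum (fun j => f (ω j)) ε‖) / 2 ^ k
        ∂(Measure.pi fun _ => μ) := by
  set P : Measure (Fin k → S) := Measure.pi fun _ => μ with hP
  have hint : Integrable f μ := .of_bound hf.aestronglyMeasurable R (ae_of_all _ hR)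
  have hsm : StronglyMeasurable fun ω : Fin k → S => ∑ j, f (ω j) :=
    Finset.stronglyMeasurable_fun_sum _ fun j _ => hf.comp_measurable (measurable_pi_apply j)
  have hsb : ∀ ω : Fin k → S, ‖∑ j, f (ω j)‖ ≤ k * R := fun ω => by
    calc _ ≤ ∑ j, ‖f (ω j)‖ := norm_sum_le _ _
      _ ≤ ∑ _j : Fin k, R := Finset.sum_le_sum fun j _ => hR _
      _ = _ := by simp
  have hsi : Integrable (fun ω : Fin k → S => ∑ j, f (ω j)) P :=
    .of_bound hsm.aestronglyMeasurable _ (ae_of_all _ hsb)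
  let G : (Fin k → Bool) → (Fin k → S) × (Fin k → S) → ℝ :=
    fun ε z => ‖signSum (fun j => f (z.1 j) - f (z.2 j)) ε‖
  let G₀ : (Fin k → S) × (Fin k → S) → ℝ := fun z => ‖∑ j, f (z.1 j) - ∑ j, f (z.2 j)‖
  have hG₀m : StronglyMeasurable G₀ :=
    ((hsm.comp_measurable measurable_fst).sub (hsm.comp_measurable measurable_snd)).norm
  have hG₀i : Integrable G₀ (P.prod P) := by
    refine .of_bound hG₀m.aestronglyMeasurable (k * R + k * R) (ae_of_all _ fun z => ?_)
    rw [norm_norm]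
    exact (norm_sub_le _ _).trans (add_le_add (hsb _) (hsb _))
  -- the expectation is the mean over an independent copy, and the norm is convex
  have ha : ∫ ω, ‖∑ j, f (ω j) - (k : ℝ) • ∫ α, f α ∂μ‖ ∂P ≤ ∫ z, G₀ z ∂(P.prod P) := by
    rw [integral_prod _ hG₀i]
    refine integral_mono_of_nonneg (ae_of_all _ fun ω => norm_nonneg _) hG₀i.integral_prod_left
      (ae_of_all _ fun ω => ?_)
    have : ∑ j, f (ω j) - (k : ℝ) • ∫ α, f α ∂μ =
        ∫ ω', (∑ j, f (ω j) - ∑ j, f (ω' j)) ∂P := by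
      rw [integral_sub (integrable_const _) hsi, integral_sum_eval hint]
      simp
    simp only [this]
    exact norm_integral_le_integral_norm _
  -- swapping the pairs with negative sign does not change the distribution
  have hb : ∀ ε, ∫ z, G₀ z ∂(P.prod P) = ∫ z, G ε z ∂(P.prod P) := by
    intro ε
    have hsw := measurePreserving_swapPairs (μ := μ) ε
    have h1 : ∫ z, G₀ z ∂(P.prod P) = ∫ z, G₀ (swapPairs ε z) ∂(P.prod P) := by
      rw [← integral_map hsw.measurable.aemeasurable hG₀m.aestronglyMeasurable, hsw.map_eq]
    rw [h1]
    congr 1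
    ext z
    simp only [G₀, G, signSum, ← Finset.sum_sub_distrib]
    congr 1
    refine Finset.sum_congr rfl fun j _ => ?_
    cases h : ε j <;> simp [swapPairs, h, boolSign]
  have hc : ∀ ε, ∫ z, G ε z ∂(P.prod P) ≤ 2 * ∫ ω, ‖signSum (fun j => f (ω j)) ε‖ ∂P := by
    intro ε
    have hi := integrable_norm_signSum (μ := μ) hf hR ε
    have h1 : Integrable (fun z : (Fin k → S) × (Fin k → S) =>
        ‖signSum (fun j => f (z.1 j)) ε‖) (P.prod P) := hi.comp_fst _
    have h2 : Integrable (fun z : (Fin k → S) × (Fin k → S) =>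
        ‖signSum (fun j => f (z.2 j)) ε‖) (P.prod P) := hi.comp_snd _
    calc ∫ z, G ε z ∂(P.prod P) ≤ ∫ z, (‖signSum (fun j => f (z.1 j)) ε‖
          + ‖signSum (fun j => f (z.2 j)) ε‖) ∂(P.prod P) := by
          refine integral_mono_of_nonneg (ae_of_all _ fun z => norm_nonneg _) (h1.add h2)
            (ae_of_all _ fun z => ?_)
          simp only [G, signSum_sub]
          exact norm_sub_le _ _
      _ = _ := by
          rw [integral_add h1 h2,
            integral_fun_fst (fun ω : Fin k → S => ‖signSum (fun j => f (ω j)) ε‖),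
            integral_fun_snd (fun ω : Fin k → S => ‖signSum (fun j => f (ω j)) ε‖)]
          simp only [probReal_univ, one_smul]
          ring
  have hd : (2 : ℝ) ^ k * ∫ z, G₀ z ∂(P.prod P) ≤
      ∑ ε : Fin k → Bool, 2 * ∫ ω, ‖signSum (fun j => f (ω j)) ε‖ ∂P := by
    have : (2 : ℝ) ^ k * ∫ z, G₀ z ∂(P.prod P) =
        ∑ _ε : Fin k → Bool, ∫ z, G₀ z ∂(P.prod P) := by simp
    rw [this]
    exact Finset.sum_le_sum fun ε _ => (hb ε).trans_le (hc ε)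
  rw [integral_div, integral_finsetSum _ fun ε _ => integrable_norm_signSum (μ := μ) hf hR ε]
  rw [← Finset.mul_sum] at hd
  refine ha.trans ?_
  rw [← mul_div_assoc, le_div_iff₀ (by positivity), mul_comm]
  exact hd

end Symmetrization

section MatrixConcentration

open scoped Matrix.Norms.L2Operator MatrixOrder

variable {S : Type*} [MeasurableSpace S] {μ : Measure S} {k n : ℕ}

/-- The norm of a mean of positive semidefinite matrices is read off its quadratic form. -/
lemma norm_integral_le_of_quadratic_le {F : S → Matrix (Fin n) (Fin n) ℂ} (hF : Integrable F μ)
    (hpos : ∀ α, (F α).PosSemidef) {v : ℝ} (hv0 : 0 ≤ v)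
    (hv : ∀ x : Fin n → ℂ, ∫ α, (star x ⬝ᵥ F α *ᵥ x).re ∂μ ≤ v * (star x ⬝ᵥ x).re) :
    ‖∫ α, F α ∂μ‖ ≤ v := by
  have hherm : (∫ α, F α ∂μ).IsHermitian := by
    have h := (starL' ℝ : Matrix (Fin n) (Fin n) ℂ ≃L[ℝ] _).integral_comp_comm (μ := μ) F
    show star (∫ α, F α ∂μ) = _
    rw [starL'_apply] at h
    rw [← h]
    congr 1
    ext1 α
    exact (hpos α).1
  have hq : ∀ x : Fin n → ℂ, (star x ⬝ᵥ (∫ α, F α ∂μ) *ᵥ x).re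
      = ∫ α, (star x ⬝ᵥ F α *ᵥ x).re ∂μ := by
    intro x
    let φ : Matrix (Fin n) (Fin n) ℂ →ₗ[ℝ] ℝ :=
      { toFun := fun A => (star x ⬝ᵥ A *ᵥ x).re
        map_add' := fun A B => by rw [add_mulVec, dotProduct_add, Complex.add_re]
        map_smul' := fun c A => by
          rw [smul_mulVec, dotProduct_smul, Complex.real_smul, Complex.re_ofReal_mul]; rfl }
    exact (φ.toContinuousLinearMap.integral_comp_comm hF).symm
  have him : ∀ (A : Matrix (Fin n) (Fin n) ℂ), A.IsHermitian → ∀ x : Fin n → ℂ,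
      0 ≤ (star x ⬝ᵥ A *ᵥ x).re → 0 ≤ star x ⬝ᵥ A *ᵥ x := by
    intro A hA x h
    refine Complex.nonneg_iff.mpr ⟨h, ?_⟩
    exact (hA.im_star_dotProduct_mulVec_self x).symm
  have hp : (∫ α, F α ∂μ).PosSemidef := by
    refine .of_dotProduct_mulVec_nonneg hherm fun x => him _ hherm x ?_
    rw [hq]
    exact integral_nonneg fun α => (Complex.nonneg_iff.mp ((hpos α).dotProduct_mulVec_nonneg x)).1
  rw [CStarAlgebra.norm_le_iff_le_algebraMap _ hv0 hp.nonneg, Matrix.le_iff]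
  have hh2 : (algebraMap ℝ (Matrix (Fin n) (Fin n) ℂ) v - ∫ α, F α ∂μ).IsHermitian :=
    (show IsSelfAdjoint (algebraMap ℝ (Matrix (Fin n) (Fin n) ℂ) v) from
      (IsSelfAdjoint.all v).algebraMap _).sub hherm
  refine .of_dotProduct_mulVec_nonneg hh2 fun x => him _ hh2 x ?_
  rw [sub_mulVec, dotProduct_sub, Complex.sub_re, hq, Algebra.algebraMap_eq_smul_one, smul_mulVec,
    one_mulVec, dotProduct_smul, Complex.real_smul, Complex.re_ofReal_mul]
  linarith [hv x]

lemma sq_integral_le_integral_sq {Ω : Type*} [MeasurableSpace Ω] {P : Measure Ω}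
    [IsProbabilityMeasure P] {g : Ω → ℝ} (hg : MemLp g 2 P) :
    (∫ ω, g ω ∂P) ^ 2 ≤ ∫ ω, g ω ^ 2 ∂P := by
  have h := ProbabilityTheory.variance_nonneg g P
  rw [ProbabilityTheory.variance_eq_sub hg] at h
  simpa using h

/-- Squaring the summands once more costs a factor `R ^ 2`, by `A⁴ ≤ ‖A‖² A²`. -/
lemma norm_sum_mul_self_mul_self_le {A : Fin k → Matrix (Fin n) (Fin n) ℂ}
    (hA : ∀ j, (A j).IsHermitian) {R : ℝ} (hR : ∀ j, ‖A j‖ ≤ R) :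
    ‖∑ j, (A j * A j) * (A j * A j)‖ ≤ R ^ 2 * ‖∑ j, A j * A j‖ := by
  have hsq : ∀ j, (A j * A j).IsHermitian := fun j => by
    show (A j * A j)ᴴ = _
    rw [conjTranspose_mul, (hA j).eq]
  have h0 : 0 ≤ ∑ j, (A j * A j) * (A j * A j) := (posSemidef_sum_mul_self hsq).nonneg
  have hle : ∑ j, (A j * A j) * (A j * A j) ≤ (R ^ 2) • ∑ j, A j * A j := by
    rw [Finset.smul_sum]
    refine Finset.sum_le_sum fun j _ => ?_
    have h1 := CStarAlgebra.star_left_conjugate_le_norm_smul (a := A j) (b := A j * A j) (hsq j)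
    rw [star_eq_conjTranspose, (hA j).eq] at h1
    have h2 : A j * A j * (A j * A j) = A j * (A j * A j) * A j := by simp only [mul_assoc]
    rw [h2]
    refine h1.trans ?_
    have hp : (0 : Matrix (Fin n) (Fin n) ℂ) ≤ A j * A j := by
      have := posSemidef_conjTranspose_mul_self (A j)
      rw [(hA j).eq] at this
      exact this.nonneg
    refine smul_le_smul_of_nonneg_right ?_ hp
    calc ‖A j * A j‖ ≤ ‖A j‖ * ‖A j‖ := norm_mul_le _ _
      _ ≤ R * R := mul_le_mul (hR j) (hR j) (norm_nonneg _) ((norm_nonneg _).trans (hR j))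
      _ = R ^ 2 := by ring
  refine (CStarAlgebra.norm_le_norm_of_nonneg_of_le h0 hle).trans ?_
  rw [norm_smul, Real.norm_eq_abs, abs_of_nonneg (sq_nonneg R)]

/-- Concentration of a sum of independent bounded Hermitian matrices in mean operator norm, by
symmetrization and the noncommutative Khintchine inequality, applied to the matrices and to
their squares. -/
lemma integral_norm_sum_hermitian_sub_le [IsProbabilityMeasure μ]
    {Z : S → Matrix (Fin n) (Fin n) ℂ}
    (hZm : StronglyMeasurable Z) (hZ : ∀ α, (Z α).IsHermitian) {R v : ℝ} (hR : ∀ α, ‖Z α‖ ≤ R)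
    (hv0 : 0 ≤ v)
    (hv : ∀ x : Fin n → ℂ, ∫ α, (star x ⬝ᵥ (Z α * Z α) *ᵥ x).re ∂μ ≤ v * (star x ⬝ᵥ x).re)
    (t : ℕ) (hn : n ≤ 2 ^ 2 ^ t) :
    ∫ ω : Fin k → S, ‖∑ j, Z (ω j) - (k : ℝ) • ∫ α, Z α ∂μ‖ ∂(Measure.pi fun _ => μ) ≤
      2 * √(4 * 2 ^ t * (2 * (k * v) + 4 * (4 * 2 ^ t) * R ^ 2)) := by
  set P : Measure (Fin k → S) := Measure.pi fun _ => μ with hP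
  set c : ℝ := 4 * 2 ^ t with hc
  have hc0 : 0 ≤ c := by positivity
  have hsq : ∀ α, (Z α * Z α).IsHermitian := fun α => by
    show (Z α * Z α)ᴴ = _
    rw [conjTranspose_mul, (hZ α).eq]
  have hZ2m : StronglyMeasurable fun α => Z α * Z α := hZm.mul hZm
  have hZ2b : ∀ α, ‖Z α * Z α‖ ≤ R ^ 2 := fun α => by
    calc ‖Z α * Z α‖ ≤ ‖Z α‖ * ‖Z α‖ := norm_mul_le _ _
      _ ≤ R * R := mul_le_mul (hR α) (hR α) (norm_nonneg _) ((norm_nonneg _).trans (hR α))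
      _ = R ^ 2 := by ring
  have hZ2i : Integrable (fun α => Z α * Z α) μ :=
    .of_bound hZ2m.aestronglyMeasurable _ (ae_of_all _ hZ2b)
  -- `V ω` is the norm of the sum of squares, and `y` its mean
  let V : (Fin k → S) → ℝ := fun ω => ‖∑ j, Z (ω j) * Z (ω j)‖
  have hV0 : ∀ ω, 0 ≤ V ω := fun ω => norm_nonneg _
  have hsm : StronglyMeasurable fun ω : Fin k → S => ∑ j, Z (ω j) * Z (ω j) :=
    Finset.stronglyMeasurable_fun_sum _ fun j _ => hZ2m.comp_measurable (measurable_pi_apply j)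
  have hVm : StronglyMeasurable V := hsm.norm
  have hVb : ∀ ω, V ω ≤ k * R ^ 2 := fun ω => by
    calc _ ≤ ∑ j, ‖Z (ω j) * Z (ω j)‖ := norm_sum_le _ _
      _ ≤ ∑ _j : Fin k, R ^ 2 := Finset.sum_le_sum fun j _ => hZ2b _
      _ = _ := by simp
  have hVi : Integrable V P := .of_bound hVm.aestronglyMeasurable _ (ae_of_all _ fun ω => by
    rw [Real.norm_eq_abs, abs_of_nonneg (hV0 ω)]; exact hVb ω)
  set y := ∫ ω, V ω ∂P with hy
  have hy0 : 0 ≤ y := integral_nonneg hV0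
  have hsqrt : ∀ a : ℝ, 0 ≤ a → ∫ ω, √(a * V ω) ∂P ≤ √(a * y) := by
    intro a ha
    have hm : Measurable fun ω => √(a * V ω) := (hVm.measurable.const_mul a).sqrt
    have hL : MemLp (fun ω => √(a * V ω)) 2 P := by
      refine .of_bound hm.aestronglyMeasurable (√(a * (k * R ^ 2))) (ae_of_all _ fun ω => ?_)
      rw [Real.norm_eq_abs, abs_of_nonneg (Real.sqrt_nonneg _)]
      exact Real.sqrt_le_sqrt (mul_le_mul_of_nonneg_left (hVb ω) ha)
    refine Real.le_sqrt_of_sq_le ((sq_integral_le_integral_sq hL).trans (le_of_eq ?_))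
    rw [hy, ← integral_const_mul]
    congr 1
    ext ω
    exact Real.sq_sqrt (mul_nonneg ha (hV0 ω))
  have hsqi : ∀ a : ℝ, 0 ≤ a → Integrable (fun ω => √(a * V ω)) P := by
    intro a ha
    have hm : Measurable fun ω => √(a * V ω) := (hVm.measurable.const_mul a).sqrt
    refine .of_bound hm.aestronglyMeasurable (√(a * (k * R ^ 2))) (ae_of_all _ fun ω => ?_)
    rw [Real.norm_eq_abs, abs_of_nonneg (Real.sqrt_nonneg _)]
    exact Real.sqrt_le_sqrt (mul_le_mul_of_nonneg_left (hVb ω) ha)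
  have hnn : ∀ (f : S → Matrix (Fin n) (Fin n) ℂ) (ω : Fin k → S),
      0 ≤ (∑ ε, ‖signSum (fun j => f (ω j)) ε‖) / 2 ^ k := fun f ω => by positivity
  have h1 : ∫ ω, ‖∑ j, Z (ω j) * Z (ω j) - (k : ℝ) • ∫ α, Z α * Z α ∂μ‖ ∂P
      ≤ 2 * √(c * R ^ 2 * y) := by
    refine (integral_norm_sum_sub_le hZ2m hZ2b).trans ?_
    gcongr
    have hcR : 0 ≤ c * R ^ 2 := mul_nonneg hc0 (sq_nonneg R)
    refine le_trans (integral_mono_of_nonneg (ae_of_all _ fun ω => hnn (fun α => Z α * Z α) ω)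
      (hsqi (c * R ^ 2) hcR) (ae_of_all _ fun ω => ?_)) (hsqrt (c * R ^ 2) hcR)
    refine (mean_norm_signSum_le (fun j => hsq (ω j)) t hn).trans (Real.sqrt_le_sqrt ?_)
    rw [← hc, mul_assoc c (R ^ 2)]
    exact mul_le_mul_of_nonneg_left
      (norm_sum_mul_self_mul_self_le (fun j => hZ (ω j)) (fun j => hR (ω j))) hc0
  have h2 : y ≤ 2 * √(c * R ^ 2 * y) + k * v := by
    have hEv : ‖∫ α, Z α * Z α ∂μ‖ ≤ v := by
      refine norm_integral_le_of_quadratic_le hZ2i (fun α => ?_) hv0 hv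
      have := posSemidef_conjTranspose_mul_self (Z α)
      rwa [(hZ α).eq] at this
    have hdi : Integrable (fun ω : Fin k → S =>
        ‖∑ j, Z (ω j) * Z (ω j) - (k : ℝ) • ∫ α, Z α * Z α ∂μ‖) P := by
      have hsi : Integrable (fun ω : Fin k → S => ∑ j, Z (ω j) * Z (ω j)) P :=
        .of_bound hsm.aestronglyMeasurable _ (ae_of_all _ hVb)
      exact (hsi.sub (integrable_const ((k : ℝ) • ∫ α, Z α * Z α ∂μ))).norm
    calc y ≤ ∫ ω, (‖∑ j, Z (ω j) * Z (ω j) - (k : ℝ) • ∫ α, Z α * Z α ∂μ‖ + k * v) ∂P := by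
          refine integral_mono hVi (hdi.add (integrable_const _)) fun ω => ?_
          have h3 : ‖(k : ℝ) • ∫ α, Z α * Z α ∂μ‖ ≤ k * v := by
            rw [norm_smul, Real.norm_natCast]
            gcongr
          have h4 := norm_sub_norm_le (∑ j, Z (ω j) * Z (ω j)) ((k : ℝ) • ∫ α, Z α * Z α ∂μ)
          simp only [V]
          linarith
      _ ≤ _ := by
          rw [integral_add hdi (integrable_const _)]
          simp only [integral_const, probReal_univ, one_smul]
          linarith
  have h3 : y ≤ 2 * (k * v) + 4 * c * R ^ 2 := by
    -- the self-bounding estimate `y ≤ 2 √(c R² y) + k v` is solved by the AM-GM inequality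
    have : 2 * √(c * R ^ 2 * y) ≤ 2 * (c * R ^ 2) + y / 2 := by
      have h5 : √(c * R ^ 2 * y) ≤ c * R ^ 2 + y / 4 := by
        refine Real.sqrt_le_iff.mpr ⟨by positivity, ?_⟩
        nlinarith [sq_nonneg (c * R ^ 2 - y / 4)]
      linarith
    linarith
  refine (integral_norm_sum_sub_le hZm hR).trans ?_
  gcongr
  refine le_trans (integral_mono_of_nonneg (ae_of_all _ fun ω => hnn Z ω)
      (hsqi c hc0) (ae_of_all _ fun ω => ?_)) ((hsqrt _ hc0).trans ?_)
  · exact mean_norm_signSum_le (fun j => hZ (ω j)) t hn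
  · exact Real.sqrt_le_sqrt (mul_le_mul_of_nonneg_left h3 hc0)

end MatrixConcentration

/-! ### Golfing scheme: definitions and second moments -/

section Golfing

open scoped InnerProductSpace

variable {V : Type*} [NormedAddCommGroup V] [InnerProductSpace ℝ V] {S : Type*}

/-- The sampling operator of a batch `ω` of `k` observables drawn from the family `u`, with
normalization `N / k`. -/
noncomputable def batchOp {k : ℕ} (N : ℝ) (u : S → V) (ω : Fin k → S) (x : V) : V :=
  (N / k) • ∑ j, ⟪u (ω j), x⟫_ℝ • u (ω j)

/-- One golfing step `x ↦ x - P R x` with the sampling operator `R` of one batch. -/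
noncomputable def golfStep {k : ℕ} (N : ℝ) (u : S → V) (P : V →ₗ[ℝ] V) (ω : Fin k → S)
    (x : V) : V :=
  x - P (batchOp N u ω x)

/-- What is left of `x` after one golfing step with each of `l` batches. -/
noncomputable def golfRem {k : ℕ} (N : ℝ) (u : S → V) (P : V →ₗ[ℝ] V) :
    (l : ℕ) → (Fin l → Fin k → S) → V → V
  | 0, _, x => x
  | l + 1, ω, x => golfRem N u P l (fun i => ω i.succ) (golfStep N u P (ω 0) x)

/-- The dual certificate collected in `l` golfing steps: the sum of the images of the successive
remainders under the sampling operators. -/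
noncomputable def golfCert {k : ℕ} (N : ℝ) (u : S → V) (P : V →ₗ[ℝ] V) :
    (l : ℕ) → (Fin l → Fin k → S) → V → V
  | 0, _, _ => 0
  | l + 1, ω, x => batchOp N u (ω 0) x +
      golfCert N u P l (fun i => ω i.succ) (golfStep N u P (ω 0) x)

section Deterministic

variable {k : ℕ} {N : ℝ} {u : S → V} {P : V →ₗ[ℝ] V}

lemma proj_golfStep (hP : ∀ x, P (P x) = P x) {x : V} (hx : P x = x) (ω : Fin k → S) :
    P (golfStep N u P ω x) = golfStep N u P ω x := by
  rw [golfStep, map_sub, hP, hx]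

lemma proj_golfRem (hP : ∀ x, P (P x) = P x) (l : ℕ) (ω : Fin l → Fin k → S) {x : V}
    (hx : P x = x) : P (golfRem N u P l ω x) = golfRem N u P l ω x := by
  induction l generalizing x with
  | zero => exact hx
  | succ l ih => exact ih _ (proj_golfStep hP hx _)

lemma proj_golfCert (hP : ∀ x, P (P x) = P x) (l : ℕ) (ω : Fin l → Fin k → S) {x : V}
    (hx : P x = x) : P (golfCert N u P l ω x) = x - golfRem N u P l ω x := by
  induction l generalizing x with
  | zero => simp [golfCert, golfRem]
  | succ l ih =>
    rw [golfCert, golfRem, map_add, ih _ (proj_golfStep hP hx _), golfStep]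
    abel

/-- The certificate is a combination of the sampled observables. -/
lemma inner_golfCert_eq_zero (l : ℕ) (ω : Fin l → Fin k → S) (x : V) {d : V}
    (hd : ∀ i j, ⟪u (ω i j), d⟫_ℝ = 0) : ⟪golfCert N u P l ω x, d⟫_ℝ = 0 := by
  induction l generalizing x with
  | zero => simp [golfCert]
  | succ l ih =>
    rw [golfCert, inner_add_left, ih _ _ fun i j => hd i.succ j, batchOp, real_inner_smul_left,
      sum_inner]
    simp [real_inner_smul_left, hd]

end Deterministic

variable [MeasurableSpace S]

/-- A random vector `u` that is bounded, has bounded projection under the orthogonal projection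
`P`, and is close to a tight frame: `N 𝔼 ⟪u, x⟫ ⟪u, y⟫` is `⟪x, y⟫` up to an error `ε`. The upper
bound in `second` is exact: it survives when elements of a tight frame are set to zero. -/
structure IsSamplingFrame [MeasurableSpace V] (μ : Measure S) (u : S → V) (P : V →ₗ[ℝ] V)
    (N K τ ε : ℝ) : Prop where
  meas : Measurable u
  symm : ∀ x y, ⟪P x, y⟫_ℝ = ⟪x, P y⟫_ℝ
  idem : ∀ x, P (P x) = P x
  N_pos : 0 < N
  ε_nonneg : 0 ≤ ε
  τ_nonneg : 0 ≤ τ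
  K_nonneg : 0 ≤ K
  norm_le : ∀ α, ‖u α‖ ^ 2 ≤ K
  proj_le : ∀ α, ‖P (u α)‖ ^ 2 ≤ τ
  approx : ∀ x y, |N * ∫ α, ⟪u α, x⟫_ℝ * ⟪u α, y⟫_ℝ ∂μ - ⟪x, y⟫_ℝ| ≤ ε * ‖x‖ * ‖y‖
  second : ∀ x, N * ∫ α, ⟪u α, x⟫_ℝ ^ 2 ∂μ ≤ ‖x‖ ^ 2

namespace IsSamplingFrame

variable [MeasurableSpace V] {μ : Measure S} {u : S → V} {P : V →ₗ[ℝ] V} {N K τ ε : ℝ} {k : ℕ}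

lemma norm_proj_le (h : IsSamplingFrame μ u P N K τ ε) (x : V) : ‖P x‖ ≤ ‖x‖ := by
  have h1 : ‖P x‖ ^ 2 ≤ ‖x‖ * ‖P x‖ := by
    rw [← real_inner_self_eq_norm_sq, h.symm, h.idem]
    exact real_inner_le_norm _ _
  rcases (norm_nonneg (P x)).eq_or_lt with h0 | h0
  · rw [← h0]; exact norm_nonneg _
  · nlinarith

lemma abs_inner_le (h : IsSamplingFrame μ u P N K τ ε) (α : S) (x : V) :
    |⟪u α, x⟫_ℝ| ≤ √K * ‖x‖ :=
  (abs_real_inner_le_norm _ _).trans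
    (mul_le_mul_of_nonneg_right (Real.le_sqrt_of_sq_le (h.norm_le α)) (norm_nonneg _))

lemma norm_batchOp_le (h : IsSamplingFrame μ u P N K τ ε) (hk : 0 < k) (ω : Fin k → S) (x : V) :
    ‖batchOp N u ω x‖ ≤ N * K * ‖x‖ := by
  have hN := h.N_pos
  have hk' : (0 : ℝ) < k := by exact_mod_cast hk
  rw [batchOp, norm_smul, Real.norm_eq_abs, abs_of_nonneg (by positivity)]
  have h1 : ‖∑ j, ⟪u (ω j), x⟫_ℝ • u (ω j)‖ ≤ k * (K * ‖x‖) := by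
    calc _ ≤ ∑ j, ‖⟪u (ω j), x⟫_ℝ • u (ω j)‖ := norm_sum_le _ _
      _ ≤ ∑ _j : Fin k, K * ‖x‖ := by
          refine Finset.sum_le_sum fun j _ => ?_
          rw [norm_smul, Real.norm_eq_abs]
          have := abs_real_inner_le_norm (u (ω j)) x
          have h2 := h.norm_le (ω j)
          calc _ ≤ ‖u (ω j)‖ * ‖x‖ * ‖u (ω j)‖ := by gcongr
            _ = ‖u (ω j)‖ ^ 2 * ‖x‖ := by ring
            _ ≤ _ := by gcongr
      _ = _ := by simp
  calc _ ≤ N / k * (k * (K * ‖x‖)) := by gcongr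
    _ = _ := by field_simp

variable [BorelSpace V] [FiniteDimensional ℝ V]

lemma measurable_inner (h : IsSamplingFrame μ u P N K τ ε) (x : V) :
    Measurable fun α => ⟪u α, x⟫_ℝ := h.meas.inner measurable_const

lemma measurable_batchOp (h : IsSamplingFrame μ u P N K τ ε) :
    Measurable fun z : (Fin k → S) × V => batchOp N u z.1 z.2 := by
  have hu := h.meas
  unfold batchOp
  refine Measurable.const_smul (Finset.measurable_fun_sum _ fun j _ => ?_) _
  have h1 : Measurable fun z : (Fin k → S) × V => u (z.1 j) :=
    hu.comp ((measurable_pi_apply j).comp measurable_fst)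
  exact (h1.inner measurable_snd).smul h1

lemma measurable_golfStep (h : IsSamplingFrame μ u P N K τ ε) :
    Measurable fun z : (Fin k → S) × V => golfStep N u P z.1 z.2 :=
  measurable_snd.sub ((LinearMap.continuous_of_finiteDimensional P).measurable.comp
    h.measurable_batchOp)

lemma measurable_golfRem (h : IsSamplingFrame μ u P N K τ ε) (l : ℕ) :
    Measurable fun z : (Fin l → Fin k → S) × V => golfRem N u P l z.1 z.2 := by
  induction l with
  | zero => exact measurable_snd
  | succ l ih =>
    refine ih.comp (f := fun z : (Fin (l + 1) → Fin k → S) × V =>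
      ((fun i => z.1 i.succ, golfStep N u P (z.1 0) z.2) : (Fin l → Fin k → S) × V)) ?_
    refine Measurable.prodMk (by fun_prop) (h.measurable_golfStep.comp
      (f := fun z : (Fin (l + 1) → Fin k → S) × V => (z.1 0, z.2)) (by fun_prop))

lemma measurable_golfCert (h : IsSamplingFrame μ u P N K τ ε) (l : ℕ) :
    Measurable fun z : (Fin l → Fin k → S) × V => golfCert N u P l z.1 z.2 := by
  induction l with
  | zero => exact measurable_const
  | succ l ih =>
    refine Measurable.add (h.measurable_batchOp.comp
      (f := fun z : (Fin (l + 1) → Fin k → S) × V => (z.1 0, z.2)) (by fun_prop)) ?_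
    refine ih.comp (f := fun z : (Fin (l + 1) → Fin k → S) × V =>
      ((fun i => z.1 i.succ, golfStep N u P (z.1 0) z.2) : (Fin l → Fin k → S) × V)) ?_
    refine Measurable.prodMk (by fun_prop) (h.measurable_golfStep.comp
      (f := fun z : (Fin (l + 1) → Fin k → S) × V => (z.1 0, z.2)) (by fun_prop))

variable [IsProbabilityMeasure μ]

lemma integrable_inner_sq (h : IsSamplingFrame μ u P N K τ ε) (x : V) :
    Integrable (fun α => ⟪u α, x⟫_ℝ ^ 2) μ := by
  refine .of_bound ((h.measurable_inner x).pow_const 2).aestronglyMeasurable ((√K * ‖x‖) ^ 2)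
    (ae_of_all _ fun α => ?_)
  rw [Real.norm_eq_abs, abs_pow]
  exact pow_le_pow_left₀ (abs_nonneg _) (h.abs_inner_le α x) 2

/-- In mean square, a golfing step contracts every vector in the range of `P`. The two terms are the
squared bias and the variance, summed over an orthonormal basis. -/
lemma integral_norm_golfStep_sq_le (h : IsSamplingFrame μ u P N K τ ε) (hk : 0 < k) {x : V}
    (hx : P x = x) :
    ∫ ω : Fin k → S, ‖golfStep N u P ω x‖ ^ 2 ∂(Measure.pi fun _ => μ) ≤
      (Module.finrank ℝ V * ε ^ 2 + N * τ / k) * ‖x‖ ^ 2 := by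
  have hN := h.N_pos
  have hk' : (0 : ℝ) < k := by exact_mod_cast hk
  let b := stdOrthonormalBasis ℝ V
  let f : Fin (Module.finrank ℝ V) → S → ℝ := fun i α =>
    N / k * (⟪u α, x⟫_ℝ * ⟪u α, P (b i)⟫_ℝ)
  have hfm : ∀ i, Measurable (f i) := fun i =>
    ((h.measurable_inner x).mul (h.measurable_inner (P (b i)))).const_mul _
  have hfb : ∀ i α, ‖f i α‖ ≤ N / k * ((√K * ‖x‖) * (√K * ‖P (b i)‖)) := by
    intro i α
    rw [Real.norm_eq_abs, abs_mul, abs_of_nonneg (by positivity : 0 ≤ N / k), abs_mul]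
    gcongr
    · exact h.abs_inner_le α x
    · exact h.abs_inner_le α _
  have hfL : ∀ i, MemLp (f i) 2 μ := fun i =>
    .of_bound (hfm i).aestronglyMeasurable _ (ae_of_all _ (hfb i))
  have hcoord : ∀ (ω : Fin k → S) i,
      ⟪b i, golfStep N u P ω x⟫_ℝ = ⟪b i, x⟫_ℝ - ∑ j, f i (ω j) := by
    intro ω i
    rw [golfStep, inner_sub_right, ← h.symm, batchOp, real_inner_smul_right, inner_sum,
      Finset.mul_sum]
    simp only [real_inner_smul_right, f, real_inner_comm (P (b i))]
  have hsum : ∀ ω : Fin k → S, ‖golfStep N u P ω x‖ ^ 2 =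
      ∑ i, (⟪b i, x⟫_ℝ - ∑ j, f i (ω j)) ^ 2 := by
    intro ω
    rw [← b.sum_sq_inner_right]
    simp only [hcoord]
  have hint : ∀ i, Integrable (fun ω : Fin k → S => (⟪b i, x⟫_ℝ - ∑ j, f i (ω j)) ^ 2)
      (Measure.pi fun _ => μ) := by
    intro i
    have hs : MemLp (fun ω : Fin k → S => ∑ j, f i (ω j)) 2 (Measure.pi fun _ => μ) :=
      memLp_finsetSum _ fun j _ =>
        (hfL i).comp_measurePreserving (measurePreserving_eval (fun _ => μ) j)
    exact ((memLp_const _).sub hs).integrable_sq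
  simp only [hsum]
  rw [integral_finsetSum _ fun i _ => hint i]
  have hone : ∀ i, ∫ ω : Fin k → S, (⟪b i, x⟫_ℝ - ∑ j, f i (ω j)) ^ 2 ∂(Measure.pi fun _ => μ)
      ≤ (ε * ‖x‖) ^ 2 + k * ∫ α, f i α ^ 2 ∂μ := by
    intro i
    refine (integral_sq_sub_sum_le (hfL i) _).trans ?_
    gcongr ?_ + _
    refine sq_le_sq' ?_ ?_ <;> [rw [neg_le]; skip] <;>
    · have h1 : (k : ℝ) * ∫ α, f i α ∂μ = N * ∫ α, ⟪u α, x⟫_ℝ * ⟪u α, P (b i)⟫_ℝ ∂μ := by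
        rw [integral_const_mul]
        field_simp
      have h2 := h.approx x (P (b i))
      have h3 : ⟪x, P (b i)⟫_ℝ = ⟪b i, x⟫_ℝ := by rw [← h.symm, hx, real_inner_comm]
      have h4 : ‖P (b i)‖ ≤ 1 := (h.norm_proj_le _).trans (b.norm_eq_one i).le
      have h5 : ε * ‖x‖ * ‖P (b i)‖ ≤ ε * ‖x‖ :=
        mul_le_of_le_one_right (mul_nonneg h.ε_nonneg (norm_nonneg _)) h4
      rw [h3, ← h1] at h2
      have h6 := abs_le.mp h2
      linarith [h6.1, h6.2]
  have hvar : ∑ i, (k : ℝ) * ∫ α, f i α ^ 2 ∂μ ≤ N * τ / k * ‖x‖ ^ 2 := by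
    have h1 : ∀ i, Integrable (fun α => f i α ^ 2) μ := fun i => (hfL i).integrable_sq
    rw [← Finset.mul_sum, ← integral_finsetSum _ fun i _ => h1 i]
    have h2 : ∀ α, ∑ i, f i α ^ 2 = (N / k) ^ 2 * (⟪u α, x⟫_ℝ ^ 2 * ‖P (u α)‖ ^ 2) := by
      intro α
      rw [← b.sum_sq_inner_left, Finset.mul_sum, Finset.mul_sum]
      refine Finset.sum_congr rfl fun i _ => ?_
      simp only [f, h.symm]
      ring
    simp only [h2]
    have h3 : ∫ α, (N / k) ^ 2 * (⟪u α, x⟫_ℝ ^ 2 * ‖P (u α)‖ ^ 2) ∂μ ≤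
        ∫ α, (N / k) ^ 2 * (⟪u α, x⟫_ℝ ^ 2 * τ) ∂μ := by
      refine integral_mono_of_nonneg (ae_of_all _ fun α => by positivity)
        (((h.integrable_inner_sq x).mul_const τ).const_mul _) (ae_of_all _ fun α => ?_)
      have := h.proj_le α
      simp only
      gcongr
    rw [integral_const_mul ((N / k) ^ 2) fun α => ⟪u α, x⟫_ℝ ^ 2 * τ, integral_mul_const] at h3
    have h4 := h.second x
    have h5 := h.τ_nonneg
    calc _ ≤ (k : ℝ) * ((N / k) ^ 2 * ((∫ α, ⟪u α, x⟫_ℝ ^ 2 ∂μ) * τ)) := by gcongr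
      _ = (N * τ / k) * (N * ∫ α, ⟪u α, x⟫_ℝ ^ 2 ∂μ) := by field_simp
      _ ≤ _ := by gcongr
  calc _ ≤ ∑ i, ((ε * ‖x‖) ^ 2 + k * ∫ α, f i α ^ 2 ∂μ) := Finset.sum_le_sum fun i _ => hone i
    _ ≤ Module.finrank ℝ V * (ε * ‖x‖) ^ 2 + N * τ / k * ‖x‖ ^ 2 := by
        rw [Finset.sum_add_distrib]
        simp only [Finset.sum_const, Finset.card_univ, Fintype.card_fin, nsmul_eq_mul]
        gcongr
    _ = _ := by ring

end IsSamplingFrame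
end Golfing

/-! ### Injectivity of the sampling operator on the tangent space -/

lemma lintegral_pi_succ {Ω : Type*} [MeasurableSpace Ω] (Q : Measure Ω) [IsProbabilityMeasure Q]
    (l : ℕ) {F : (Fin (l + 1) → Ω) → ENNReal} (hF : Measurable F) :
    ∫⁻ ω, F ω ∂(Measure.pi fun _ => Q) =
      ∫⁻ a, ∫⁻ ω, F (Fin.cons a ω) ∂(Measure.pi fun _ : Fin l => Q) ∂Q := by
  have h := (measurePreserving_piFinSuccAbove (fun _ : Fin (l + 1) => Q) 0).symm
  rw [← h.map_eq, lintegral_map hF h.measurable,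
    lintegral_prod (fun z => F ((MeasurableEquiv.piFinSuccAbove (fun _ => Ω) 0).symm z))
      (hF.comp h.measurable).aemeasurable]
  simp only [MeasurableEquiv.piFinSuccAbove, MeasurableEquiv.symm_mk, MeasurableEquiv.coe_mk,
    Fin.insertNthEquiv_zero, Equiv.symm_symm]
  rfl

lemma measure_pi_succ {Ω : Type*} [MeasurableSpace Ω] (Q : Measure Ω) [IsProbabilityMeasure Q]
    (l : ℕ) {A : Set (Fin (l + 1) → Ω)} (hA : MeasurableSet A) :
    (Measure.pi fun _ => Q) A =
      ∫⁻ a, (Measure.pi fun _ : Fin l => Q) {ω | (Fin.cons a ω : Fin (l + 1) → Ω) ∈ A} ∂Q := by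
  rw [← lintegral_indicator_one hA, lintegral_pi_succ _ _ (measurable_one.indicator hA)]
  refine lintegral_congr fun a => ?_
  have hcons : Measurable fun ω : Fin l → Ω => (Fin.cons a ω : Fin (l + 1) → Ω) := by
    refine measurable_pi_iff.mpr fun i => ?_
    refine Fin.cases ?_ (fun j => ?_) i
    · simp
    · simpa using measurable_pi_apply j
  exact lintegral_indicator_one (hcons hA)

section SecondMoments

open scoped InnerProductSpace

namespace IsSamplingFrame

variable {V : Type*} [NormedAddCommGroup V] [InnerProductSpace ℝ V] {S : Type*}
  [MeasurableSpace S] [MeasurableSpace V] [FiniteDimensional ℝ V]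
  {μ : Measure S} {u : S → V} {P : V →ₗ[ℝ] V} {N K τ ε : ℝ} {k : ℕ}

/-- If golfing from every vector `P e` of a family leaves little and its certificates are bounded,
then a vector `d` orthogonal to all samples has its component `P d` controlled by `d - P d`. -/
lemma norm_proj_sq_le_of_golf (h : IsSamplingFrame μ u P N K τ ε) {l : ℕ}
    {ω : Fin l → Fin k → S} {B : ℝ}
    (h1 : ∑ i, ‖golfRem N u P l ω (P (stdOrthonormalBasis ℝ V i))‖ ^ 2 ≤ 1 / 4)
    (h2 : ∑ i, ‖golfCert N u P l ω (P (stdOrthonormalBasis ℝ V i))‖ ^ 2 ≤ B) {d : V}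
    (hd : ∀ i j, ⟪u (ω i j), d⟫_ℝ = 0) : ‖P d‖ ^ 2 ≤ 4 * B * ‖d - P d‖ ^ 2 := by
  let b := stdOrthonormalBasis ℝ V
  have key : ∀ i, ⟪b i, P d⟫_ℝ ^ 2 ≤ 2 * (‖golfCert N u P l ω (P (b i))‖ ^ 2 * ‖d - P d‖ ^ 2) +
      2 * (‖golfRem N u P l ω (P (b i))‖ ^ 2 * ‖P d‖ ^ 2) := by
    intro i
    have hPP := h.idem (b i)
    have e1 := proj_golfCert (N := N) (u := u) h.idem l ω hPP
    have e2 := proj_golfRem (N := N) (u := u) h.idem l ω hPP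
    have e3 := inner_golfCert_eq_zero (N := N) (P := P) l ω (P (b i)) hd
    set Y := golfCert N u P l ω (P (b i))
    set Z := golfRem N u P l ω (P (b i))
    have e4 : ⟪b i, P d⟫_ℝ = -⟪Y, d - P d⟫_ℝ + ⟪Z, P d⟫_ℝ := by
      have : ⟪b i, P d⟫_ℝ = ⟪P Y + Z, P d⟫_ℝ := by
        rw [e1, sub_add_cancel, h.symm, h.idem]
      rw [this, inner_add_left, h.symm, h.idem, inner_sub_right, e3]
      ring
    have e5 := abs_real_inner_le_norm Y (d - P d)
    have e6 := abs_real_inner_le_norm Z (P d)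
    have e7 : ⟪Y, d - P d⟫_ℝ ^ 2 ≤ ‖Y‖ ^ 2 * ‖d - P d‖ ^ 2 := by
      rw [← mul_pow, ← sq_abs]; gcongr
    have e8 : ⟪Z, P d⟫_ℝ ^ 2 ≤ ‖Z‖ ^ 2 * ‖P d‖ ^ 2 := by
      rw [← mul_pow, ← sq_abs]; gcongr
    rw [e4]
    nlinarith [sq_nonneg (⟪Y, d - P d⟫_ℝ + ⟪Z, P d⟫_ℝ)]
  have hs := Finset.sum_le_sum fun i (_ : i ∈ Finset.univ) => key i
  rw [b.sum_sq_inner_right, Finset.sum_add_distrib, ← Finset.mul_sum, ← Finset.mul_sum,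
    ← Finset.sum_mul, ← Finset.sum_mul] at hs
  have h3 : (∑ i, ‖golfCert N u P l ω (P (b i))‖ ^ 2) * ‖d - P d‖ ^ 2 ≤ B * ‖d - P d‖ ^ 2 := by
    gcongr
  have h4 : (∑ i, ‖golfRem N u P l ω (P (b i))‖ ^ 2) * ‖P d‖ ^ 2 ≤ 1 / 4 * ‖P d‖ ^ 2 := by
    gcongr
  linarith

variable [BorelSpace V]

lemma measurable_golfStep_left (h : IsSamplingFrame μ u P N K τ ε) (x : V) :
    Measurable fun ω : Fin k → S => golfStep N u P ω x :=
  h.measurable_golfStep.comp (measurable_id.prodMk measurable_const)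

lemma measurable_golfRem_left (h : IsSamplingFrame μ u P N K τ ε) (l : ℕ) (x : V) :
    Measurable fun ω : Fin l → Fin k → S => golfRem N u P l ω x :=
  (h.measurable_golfRem l).comp (measurable_id.prodMk measurable_const)

lemma measurable_golfCert_left (h : IsSamplingFrame μ u P N K τ ε) (l : ℕ) (x : V) :
    Measurable fun ω : Fin l → Fin k → S => golfCert N u P l ω x :=
  (h.measurable_golfCert l).comp (measurable_id.prodMk measurable_const)

variable [IsProbabilityMeasure μ]

lemma integrable_norm_golfStep_sq (h : IsSamplingFrame μ u P N K τ ε) (hk : 0 < k) (x : V) :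
    Integrable (fun ω : Fin k → S => ‖golfStep N u P ω x‖ ^ 2) (Measure.pi fun _ => μ) := by
  refine .of_bound ((h.measurable_golfStep_left x).norm.pow_const 2).aestronglyMeasurable
    ((‖x‖ + N * K * ‖x‖) ^ 2) (ae_of_all _ fun ω => ?_)
  rw [Real.norm_eq_abs, abs_of_nonneg (sq_nonneg _)]
  refine pow_le_pow_left₀ (norm_nonneg _) ?_ 2
  exact (norm_sub_le _ _).trans (add_le_add le_rfl
    ((h.norm_proj_le _).trans (h.norm_batchOp_le hk ω x)))

lemma lintegral_norm_golfStep_sq_le (h : IsSamplingFrame μ u P N K τ ε) (hk : 0 < k) {x : V}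
    (hx : P x = x) :
    ∫⁻ ω : Fin k → S, ENNReal.ofReal (‖golfStep N u P ω x‖ ^ 2) ∂(Measure.pi fun _ => μ) ≤
      ENNReal.ofReal ((Module.finrank ℝ V * ε ^ 2 + N * τ / k) * ‖x‖ ^ 2) := by
  rw [← ofReal_integral_eq_lintegral_ofReal (h.integrable_norm_golfStep_sq hk x)
    (ae_of_all _ fun ω => sq_nonneg _)]
  exact ENNReal.ofReal_le_ofReal (h.integral_norm_golfStep_sq_le hk hx)

lemma lintegral_norm_golfRem_sq_le (h : IsSamplingFrame μ u P N K τ ε) (hk : 0 < k) (l : ℕ) {x : V}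
    (hx : P x = x) :
    ∫⁻ ω : Fin l → Fin k → S, ENNReal.ofReal (‖golfRem N u P l ω x‖ ^ 2)
        ∂(Measure.pi fun _ => Measure.pi fun _ => μ) ≤
      ENNReal.ofReal ((Module.finrank ℝ V * ε ^ 2 + N * τ / k) ^ l * ‖x‖ ^ 2) := by
  set θ : ℝ := Module.finrank ℝ V * ε ^ 2 + N * τ / k with hθ
  have hθ0 : 0 ≤ θ := by
    have := h.N_pos; have := h.τ_nonneg; positivity
  induction l generalizing x with
  | zero => simp [golfRem]
  | succ l ih =>
    rw [lintegral_pi_succ _ _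
      ((h.measurable_golfRem_left (l + 1) x).norm.pow_const 2).ennreal_ofReal]
    simp only [golfRem, Fin.cons_succ, Fin.cons_zero]
    calc _ ≤ ∫⁻ a : Fin k → S, ENNReal.ofReal (θ ^ l) *
            ENNReal.ofReal (‖golfStep N u P a x‖ ^ 2) ∂(Measure.pi fun _ => μ) := by
          refine lintegral_mono fun a => ?_
          rw [← ENNReal.ofReal_mul (by positivity)]
          exact ih (proj_golfStep h.idem hx a)
      _ ≤ ENNReal.ofReal (θ ^ l) * ENNReal.ofReal (θ * ‖x‖ ^ 2) := by
          rw [lintegral_const_mul _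
            ((h.measurable_golfStep_left x).norm.pow_const 2).ennreal_ofReal]
          gcongr
          exact h.lintegral_norm_golfStep_sq_le hk hx
      _ = _ := by
          rw [← ENNReal.ofReal_mul (by positivity), pow_succ θ, mul_assoc]

/-- The certificate stays bounded in mean square, since the remainders decay geometrically. The
crude bound `N K` for a single increment suffices. -/
lemma lintegral_norm_golfCert_sq_le (h : IsSamplingFrame μ u P N K τ ε) (hk : 0 < k)
    (hθ : Module.finrank ℝ V * ε ^ 2 + N * τ / k ≤ 1 / 4) (l : ℕ) {x : V} (hx : P x = x) :
    ∫⁻ ω : Fin l → Fin k → S, ENNReal.ofReal (‖golfCert N u P l ω x‖ ^ 2)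
        ∂(Measure.pi fun _ => Measure.pi fun _ => μ) ≤
      ENNReal.ofReal (4 * (N * K) ^ 2 * ‖x‖ ^ 2) := by
  induction l generalizing x with
  | zero => simp [golfCert]
  | succ l ih =>
    rw [lintegral_pi_succ _ _
      ((h.measurable_golfCert_left (l + 1) x).norm.pow_const 2).ennreal_ofReal]
    simp only [golfCert, Fin.cons_succ, Fin.cons_zero]
    have h1 : ∀ (a : Fin k → S) (ω : Fin l → Fin k → S), ENNReal.ofReal
        (‖batchOp N u a x + golfCert N u P l ω (golfStep N u P a x)‖ ^ 2) ≤
        ENNReal.ofReal (2 * (N * K * ‖x‖) ^ 2) +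
          2 * ENNReal.ofReal (‖golfCert N u P l ω (golfStep N u P a x)‖ ^ 2) := by
      intro a ω
      rw [← ENNReal.ofReal_ofNat 2, ← ENNReal.ofReal_mul (by norm_num),
        ← ENNReal.ofReal_add (by positivity) (by positivity)]
      refine ENNReal.ofReal_le_ofReal ?_
      have h2 := norm_add_le (batchOp N u a x) (golfCert N u P l ω (golfStep N u P a x))
      have h3 := h.norm_batchOp_le hk a x
      have h4 : ‖batchOp N u a x‖ ^ 2 ≤ (N * K * ‖x‖) ^ 2 := by gcongr
      have h5 := pow_le_pow_left₀ (norm_nonneg _) h2 2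
      nlinarith [sq_nonneg (‖batchOp N u a x‖ - ‖golfCert N u P l ω (golfStep N u P a x)‖)]
    have h6 : ∀ a : Fin k → S, ∫⁻ ω : Fin l → Fin k → S, ENNReal.ofReal
        (‖batchOp N u a x + golfCert N u P l ω (golfStep N u P a x)‖ ^ 2)
          ∂(Measure.pi fun _ => Measure.pi fun _ => μ) ≤
        ENNReal.ofReal (2 * (N * K * ‖x‖) ^ 2) + ENNReal.ofReal (8 * (N * K) ^ 2) *
          ENNReal.ofReal (‖golfStep N u P a x‖ ^ 2) := by
      intro a
      refine (lintegral_mono (h1 a)).trans ?_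
      rw [lintegral_add_left measurable_const, lintegral_const, measure_univ, mul_one,
        lintegral_const_mul _ ((h.measurable_golfCert_left l _).norm.pow_const 2).ennreal_ofReal]
      refine add_le_add le_rfl ?_
      calc _ ≤ 2 * ENNReal.ofReal (4 * (N * K) ^ 2 * ‖golfStep N u P a x‖ ^ 2) := by
            gcongr
            exact ih (proj_golfStep h.idem hx a)
        _ = _ := by
            rw [← ENNReal.ofReal_ofNat 2, ← ENNReal.ofReal_mul (by norm_num),
              ← ENNReal.ofReal_mul (by positivity)]
            congr 1
            ring
    refine (lintegral_mono h6).trans ?_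
    rw [lintegral_add_left measurable_const, lintegral_const, measure_univ, mul_one,
      lintegral_const_mul _ ((h.measurable_golfStep_left x).norm.pow_const 2).ennreal_ofReal]
    calc _ ≤ ENNReal.ofReal (2 * (N * K * ‖x‖) ^ 2) + ENNReal.ofReal (8 * (N * K) ^ 2) *
          ENNReal.ofReal (1 / 4 * ‖x‖ ^ 2) := by
          gcongr
          refine (h.lintegral_norm_golfStep_sq_le hk hx).trans (ENNReal.ofReal_le_ofReal ?_)
          gcongr
      _ = _ := by
          rw [← ENNReal.ofReal_mul (by positivity), ← ENNReal.ofReal_add (by positivity)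
            (by positivity)]
          congr 1
          ring

/-- With high probability, every vector `d` orthogonal to all samples has its component `P d`
controlled by `d - P d`. By Markov's inequality, this follows from the mean square bounds for
golfing from an orthonormal basis; the factor `B` may be polynomially large. -/
lemma measure_not_norm_proj_sq_le (h : IsSamplingFrame μ u P N K τ ε) (hk : 0 < k) {l : ℕ}
    (hθ : Module.finrank ℝ V * ε ^ 2 + N * τ / k ≤ 1 / 4)
    (hl : 128 * (Module.finrank ℝ V * (1 / 4 : ℝ) ^ l) ≤ 1) {B : ℝ} (hB : 0 < B)
    (hB' : 128 * (Module.finrank ℝ V * (N * K) ^ 2) ≤ B) :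
    (Measure.pi fun _ : Fin l => Measure.pi fun _ : Fin k => μ)
      {ω | ¬ ∀ d, (∀ i j, ⟪u (ω i j), d⟫_ℝ = 0) → ‖P d‖ ^ 2 ≤ 4 * B * ‖d - P d‖ ^ 2} ≤
      ENNReal.ofReal (1 / 16) := by
  set Pl := Measure.pi fun _ : Fin l => Measure.pi fun _ : Fin k => μ with hPl
  let b := stdOrthonormalBasis ℝ V
  have hN := h.N_pos
  have hK := h.K_nonneg
  have hτ := h.τ_nonneg
  let F : (Fin l → Fin k → S) → ENNReal := fun ω =>
    ∑ i, ENNReal.ofReal (‖golfRem N u P l ω (P (b i))‖ ^ 2)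
  let G : (Fin l → Fin k → S) → ENNReal := fun ω =>
    ∑ i, ENNReal.ofReal (‖golfCert N u P l ω (P (b i))‖ ^ 2)
  have hFm : ∀ i, Measurable fun ω : Fin l → Fin k → S =>
      ENNReal.ofReal (‖golfRem N u P l ω (P (b i))‖ ^ 2) := fun i =>
    ((h.measurable_golfRem_left l _).norm.pow_const 2).ennreal_ofReal
  have hGm : ∀ i, Measurable fun ω : Fin l → Fin k → S =>
      ENNReal.ofReal (‖golfCert N u P l ω (P (b i))‖ ^ 2) := fun i =>
    ((h.measurable_golfCert_left l _).norm.pow_const 2).ennreal_ofReal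
  have hb : ∀ i, ‖P (b i)‖ ^ 2 ≤ 1 := fun i =>
    pow_le_one₀ (norm_nonneg _) ((h.norm_proj_le _).trans (b.norm_eq_one i).le)
  have hF : ∫⁻ ω, F ω ∂Pl ≤ ENNReal.ofReal (Module.finrank ℝ V * (1 / 4 : ℝ) ^ l) := by
    rw [lintegral_finsetSum _ fun i _ => hFm i]
    calc _ ≤ ∑ _i : Fin (Module.finrank ℝ V), ENNReal.ofReal ((1 / 4 : ℝ) ^ l) := by
          refine Finset.sum_le_sum fun i _ =>
            (h.lintegral_norm_golfRem_sq_le hk l (h.idem (b i))).trans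
              (ENNReal.ofReal_le_ofReal ?_)
          calc _ ≤ (1 / 4 : ℝ) ^ l * 1 := by
                gcongr
                exact hb i
            _ = _ := mul_one _
      _ = _ := by
          rw [Finset.sum_const, Finset.card_univ, Fintype.card_fin,
            ENNReal.ofReal_mul (Nat.cast_nonneg _),
            ENNReal.ofReal_natCast, nsmul_eq_mul]
  have hG : ∫⁻ ω, G ω ∂Pl ≤ ENNReal.ofReal (Module.finrank ℝ V * (4 * (N * K) ^ 2)) := by
    rw [lintegral_finsetSum _ fun i _ => hGm i]
    calc _ ≤ ∑ _i : Fin (Module.finrank ℝ V), ENNReal.ofReal (4 * (N * K) ^ 2) := by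
          refine Finset.sum_le_sum fun i _ =>
            (h.lintegral_norm_golfCert_sq_le hk hθ l (h.idem (b i))).trans
              (ENNReal.ofReal_le_ofReal ?_)
          calc _ ≤ 4 * (N * K) ^ 2 * 1 := by
                gcongr
                exact hb i
            _ = _ := mul_one _
      _ = _ := by
          rw [Finset.sum_const, Finset.card_univ, Fintype.card_fin,
            ENNReal.ofReal_mul (Nat.cast_nonneg _),
            ENNReal.ofReal_natCast, nsmul_eq_mul]
  have hF2 : Pl {ω | ENNReal.ofReal (1 / 4) ≤ F ω} ≤ ENNReal.ofReal (1 / 32) := by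
    refine (meas_ge_le_lintegral_div (Finset.measurable_fun_sum _ fun i _ => hFm i).aemeasurable
      (by simp) ENNReal.ofReal_ne_top).trans ?_
    refine ENNReal.div_le_of_le_mul (hF.trans ?_)
    rw [← ENNReal.ofReal_mul (by norm_num)]
    refine ENNReal.ofReal_le_ofReal ?_
    linarith
  have hG2 : Pl {ω | ENNReal.ofReal B ≤ G ω} ≤ ENNReal.ofReal (1 / 32) := by
    refine (meas_ge_le_lintegral_div (Finset.measurable_fun_sum _ fun i _ => hGm i).aemeasurable
      (by simpa using hB) ENNReal.ofReal_ne_top).trans ?_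
    refine ENNReal.div_le_of_le_mul (hG.trans ?_)
    rw [← ENNReal.ofReal_mul (by norm_num)]
    refine ENNReal.ofReal_le_ofReal ?_
    linarith
  have hsub : {ω | ¬ ∀ d, (∀ i j, ⟪u (ω i j), d⟫_ℝ = 0) → ‖P d‖ ^ 2 ≤ 4 * B * ‖d - P d‖ ^ 2} ⊆
      {ω | ENNReal.ofReal (1 / 4) ≤ F ω} ∪ {ω | ENNReal.ofReal B ≤ G ω} := by
    intro ω hω
    by_contra hcon
    simp only [Set.mem_union, Set.mem_ofPred_eq, not_or, not_le, F, G] at hcon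
    rw [← ENNReal.ofReal_sum_of_nonneg (fun i _ => sq_nonneg _),
      ← ENNReal.ofReal_sum_of_nonneg (fun i _ => sq_nonneg _),
      ENNReal.ofReal_lt_ofReal_iff (by norm_num), ENNReal.ofReal_lt_ofReal_iff hB] at hcon
    exact hω fun d hd => h.norm_proj_sq_le_of_golf hcon.1.le hcon.2.le hd
  calc _ ≤ _ := measure_mono hsub
    _ ≤ _ := measure_union_le _ _
    _ ≤ ENNReal.ofReal (1 / 32) + ENNReal.ofReal (1 / 32) := add_le_add hF2 hG2
    _ = _ := by
        rw [← ENNReal.ofReal_add (by norm_num) (by norm_num)]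
        norm_num

end IsSamplingFrame
end SecondMoments

/-! ### Golfing scheme: decay of the remainder and of the certificate increments -/

section GolfingStep

open scoped InnerProductSpace

variable {V : Type*} [NormedAddCommGroup V] [InnerProductSpace ℝ V] {S : Type*}

/-- The coefficient `⟪u α, x⟫`, replaced by zero where it exceeds the level `c`. -/
noncomputable def truncCoef (u : S → V) (x : V) (c : ℝ) (α : S) : ℝ :=
  if |⟪u α, x⟫_ℝ| ≤ c then ⟪u α, x⟫_ℝ else 0

/-- The sampling operator of a batch with truncated coefficients. -/
noncomputable def truncOp {k : ℕ} (N : ℝ) (u : S → V) (x : V) (c : ℝ) (ω : Fin k → S) : V :=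
  (N / k) • ∑ j, truncCoef u x c (ω j) • u (ω j)

lemma abs_truncCoef_le (u : S → V) (x : V) {c : ℝ} (hc : 0 ≤ c) (α : S) :
    |truncCoef u x c α| ≤ c := by
  unfold truncCoef
  split_ifs with h
  · exact h
  · simpa using hc

lemma batchOp_eq_truncOp {k : ℕ} (N : ℝ) (u : S → V) (x : V) (c : ℝ) {ω : Fin k → S}
    (h : ∀ j, |⟪u (ω j), x⟫_ℝ| ≤ c) : batchOp N u ω x = truncOp N u x c ω := by
  simp only [batchOp, truncOp, truncCoef, h, if_true]

variable [MeasurableSpace S]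

/-- The invariant of the golfing scheme at scale `s`: the vector `x` lies in the range of `P`, has
norm at most `s √r`, and all but a fraction `δ` of the observables have overlap at most `s β` with
it. -/
structure IsIncoherent (μ : Measure S) (u : S → V) (P : V →ₗ[ℝ] V) (r β δ : ℝ) (x : V) (s : ℝ) :
    Prop where
  proj : P x = x
  norm_le : ‖x‖ ^ 2 ≤ s ^ 2 * r
  overlap : μ.real {α | s * β < |⟪u α, x⟫_ℝ|} ≤ δ

namespace IsSamplingFrame

variable [MeasurableSpace V] [BorelSpace V] [FiniteDimensional ℝ V]
  {μ : Measure S} [IsProbabilityMeasure μ] {u : S → V} {P : V →ₗ[ℝ] V} {N K τ ε : ℝ} {k : ℕ}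

lemma measurableSet_overlap_gt {μ : Measure S} (h : IsSamplingFrame μ u P N K τ ε) (x : V)
    (c : ℝ) : MeasurableSet {α | c < |⟪u α, x⟫_ℝ|} :=
  measurableSet_lt measurable_const (h.measurable_inner x).abs

lemma measurable_truncCoef {μ : Measure S} (h : IsSamplingFrame μ u P N K τ ε) (x : V) (c : ℝ) :
    Measurable (truncCoef u x c) :=
  Measurable.ite (measurableSet_le (h.measurable_inner x).abs measurable_const)
    (h.measurable_inner x) measurable_const

lemma measurable_truncOp {μ : Measure S} (h : IsSamplingFrame μ u P N K τ ε) (x : V) (c : ℝ) :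
    Measurable fun ω : Fin k → S => truncOp N u x c ω := by
  refine Measurable.const_smul (Finset.measurable_fun_sum _ fun j _ => ?_) _
  exact ((h.measurable_truncCoef x c).comp (measurable_pi_apply j)).smul
    (h.meas.comp (measurable_pi_apply j))

lemma integrable_inner_mul_inner (h : IsSamplingFrame μ u P N K τ ε) (x y : V) :
    Integrable (fun α => ⟪u α, x⟫_ℝ * ⟪u α, y⟫_ℝ) μ := by
  refine .of_bound ((h.measurable_inner x).mul (h.measurable_inner y)).aestronglyMeasurable
    ((√K * ‖x‖) * (√K * ‖y‖)) (ae_of_all _ fun α => ?_)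
  rw [Real.norm_eq_abs, abs_mul]
  exact mul_le_mul (h.abs_inner_le α x) (h.abs_inner_le α y) (abs_nonneg _)
    (mul_nonneg (Real.sqrt_nonneg _) (norm_nonneg _))

/-- The bias caused by truncation is at most of the order of the mass that is cut off. -/
lemma abs_integral_truncCoef_sub_le (h : IsSamplingFrame μ u P N K τ ε) (x y : V) (c : ℝ) :
    |N * ∫ α, truncCoef u x c α * ⟪u α, y⟫_ℝ ∂μ - ⟪x, y⟫_ℝ| ≤
      (ε + N * K * μ.real {α | c < |⟪u α, x⟫_ℝ|}) * ‖x‖ * ‖y‖ := by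
  set L : Set S := {α | c < |⟪u α, x⟫_ℝ|} with hL
  have hLm : MeasurableSet L := h.measurableSet_overlap_gt x c
  have hN := h.N_pos
  have hi := h.integrable_inner_mul_inner x y
  have e1 : ∀ α, truncCoef u x c α * ⟪u α, y⟫_ℝ = ⟪u α, x⟫_ℝ * ⟪u α, y⟫_ℝ -
      L.indicator (fun α => ⟪u α, x⟫_ℝ * ⟪u α, y⟫_ℝ) α := by
    intro α
    by_cases hα : α ∈ L
    · rw [Set.indicator_of_mem hα, truncCoef, if_neg (not_le.mpr hα)]
      ring
    · rw [Set.indicator_of_notMem hα, truncCoef, if_pos (not_lt.mp hα)]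
      ring
  have e2 : ∫ α, truncCoef u x c α * ⟪u α, y⟫_ℝ ∂μ = ∫ α, ⟪u α, x⟫_ℝ * ⟪u α, y⟫_ℝ ∂μ -
      ∫ α in L, ⟪u α, x⟫_ℝ * ⟪u α, y⟫_ℝ ∂μ := by
    simp only [e1]
    rw [integral_sub hi (hi.indicator hLm), integral_indicator hLm]
  have e3 : |∫ α in L, ⟪u α, x⟫_ℝ * ⟪u α, y⟫_ℝ ∂μ| ≤ (K * ‖x‖ * ‖y‖) * μ.real L := by
    rw [← Real.norm_eq_abs]
    refine norm_setIntegral_le_of_norm_le_const (measure_lt_top μ L) fun α _ => ?_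
    rw [Real.norm_eq_abs, abs_mul]
    calc _ ≤ (√K * ‖x‖) * (√K * ‖y‖) :=
          mul_le_mul (h.abs_inner_le α x) (h.abs_inner_le α y) (abs_nonneg _)
            (mul_nonneg (Real.sqrt_nonneg _) (norm_nonneg _))
      _ = (√K * √K) * ‖x‖ * ‖y‖ := by ring
      _ = _ := by rw [Real.mul_self_sqrt h.K_nonneg]
  have e4 := h.approx x y
  rw [e2, mul_sub]
  calc _ ≤ |N * ∫ α, ⟪u α, x⟫_ℝ * ⟪u α, y⟫_ℝ ∂μ - ⟪x, y⟫_ℝ| +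
        |N * ∫ α in L, ⟪u α, x⟫_ℝ * ⟪u α, y⟫_ℝ ∂μ| := by
        rw [sub_right_comm]
        exact abs_sub _ _
    _ ≤ ε * ‖x‖ * ‖y‖ + N * ((K * ‖x‖ * ‖y‖) * μ.real L) := by
        rw [abs_mul, abs_of_pos hN]
        gcongr
    _ = _ := by ring

/-- Concentration of the overlap of one golfing step with a fixed vector `v` in the range of `P`. -/
lemma measureReal_overlap_truncOp_le (h : IsSamplingFrame μ u P N K τ ε) (hk : 0 < k) {x v : V}
    {c a : ℝ} (hc : 0 < c) (ha : 0 < a) (hak : N * τ / k ≤ a) (hv : P v = v) (hvτ : ‖v‖ ^ 2 ≤ τ)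
    (hbias : (ε + N * K * μ.real {α | c < |⟪u α, x⟫_ℝ|}) * ‖x‖ * ‖v‖ ≤ c / 4) :
    (Measure.pi fun _ : Fin k => μ).real
      {ω | c / 2 < |⟪v, x⟫_ℝ - ⟪v, truncOp N u x c ω⟫_ℝ|} ≤ 2 * Real.exp (-(1 / (64 * a))) := by
  have hN := h.N_pos
  have hk' : (0 : ℝ) < k := by exact_mod_cast hk
  let f : S → ℝ := fun α => N / k * (truncCoef u x c α * ⟪u α, v⟫_ℝ)
  have hfm : Measurable f := ((h.measurable_truncCoef x c).mul (h.measurable_inner v)).const_mul _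
  have huv : ∀ α, |⟪u α, v⟫_ℝ| ≤ τ := by
    intro α
    have h1 : ⟪u α, v⟫_ℝ = ⟪P (u α), v⟫_ℝ := by rw [h.symm, hv]
    rw [h1]
    refine (abs_real_inner_le_norm _ _).trans ?_
    nlinarith [h.proj_le α, sq_nonneg (‖P (u α)‖ - ‖v‖)]
  have hfb : ∀ α, |f α| ≤ a * c := by
    intro α
    rw [abs_mul, abs_of_nonneg (by positivity : 0 ≤ N / k), abs_mul]
    calc _ ≤ N / k * (c * τ) := by
          gcongr
          · exact abs_truncCoef_le u x hc.le α
          · exact huv α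
      _ = N * τ / k * c := by ring
      _ ≤ _ := by gcongr
  have hfv : ∫ α, f α ^ 2 ∂μ ≤ a * c ^ 2 / k := by
    have h1 : ∫ α, f α ^ 2 ∂μ ≤ ∫ α, (N / k) ^ 2 * (c ^ 2 * ⟪u α, v⟫_ℝ ^ 2) ∂μ := by
      refine integral_mono_of_nonneg (ae_of_all _ fun α => sq_nonneg _)
        (((h.integrable_inner_sq v).const_mul _).const_mul _) (ae_of_all _ fun α => ?_)
      simp only [f]
      rw [mul_pow, mul_pow]
      have h3 : truncCoef u x c α ^ 2 ≤ c ^ 2 := by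
        rw [← sq_abs]
        exact pow_le_pow_left₀ (abs_nonneg _) (abs_truncCoef_le u x hc.le α) 2
      gcongr
    rw [integral_const_mul, integral_const_mul] at h1
    have h2 := h.second v
    calc _ ≤ _ := h1
      _ = N / k * (c ^ 2 / k) * (N * ∫ α, ⟪u α, v⟫_ℝ ^ 2 ∂μ) := by field_simp
      _ ≤ N / k * (c ^ 2 / k) * τ := by
          gcongr
          exact h2.trans hvτ
      _ = N * τ / k * c ^ 2 / k := by field_simp
      _ ≤ _ := by gcongr
  have hl0 : 0 ≤ 1 / (8 * a * c) := by positivity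
  have hB := measureReal_abs_sum_sub_ge_le (k := k) (t := c / 4) hfm hfb hfv hl0
    (by
      have : 1 / (8 * a * c) * (2 * (a * c)) = 1 / 4 := by field_simp; norm_num
      rw [this]; norm_num)
  have hexp : (k : ℝ) * ((1 / (8 * a * c)) ^ 2 * (a * c ^ 2 / k)) - 1 / (8 * a * c) * (c / 4) =
      -(1 / (64 * a)) := by field_simp; norm_num
  rw [hexp] at hB
  refine (measureReal_mono fun ω hω => ?_).trans hB
  simp only [Set.mem_ofPred_eq] at hω ⊢
  have e1 : ⟪v, truncOp N u x c ω⟫_ℝ = ∑ j, f (ω j) := by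
    rw [truncOp, real_inner_smul_right, inner_sum, Finset.mul_sum]
    refine Finset.sum_congr rfl fun j _ => ?_
    simp only [f]
    rw [real_inner_smul_right, real_inner_comm]
  have e2 : (k : ℝ) * ∫ α, f α ∂μ = N * ∫ α, truncCoef u x c α * ⟪u α, v⟫_ℝ ∂μ := by
    rw [integral_const_mul]
    field_simp
  have e3 := h.abs_integral_truncCoef_sub_le x v c
  rw [← e2, real_inner_comm] at e3
  have e4 := e3.trans hbias
  rw [e1] at hω
  have e5 : |⟪v, x⟫_ℝ - ∑ j, f (ω j)| ≤ |(k : ℝ) * ∫ α, f α ∂μ - ⟪v, x⟫_ℝ| +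
      |∑ j, f (ω j) - k * ∫ α, f α ∂μ| := by
    have : ⟪v, x⟫_ℝ - ∑ j, f (ω j) = -((k : ℝ) * ∫ α, f α ∂μ - ⟪v, x⟫_ℝ) -
      (∑ j, f (ω j) - k * ∫ α, f α ∂μ) := by ring
    rw [this]
    refine (abs_sub _ _).trans ?_
    rw [abs_neg]
  linarith

/-- After one golfing step with truncated coefficients, all but a fraction `δ` of the observables
have small overlap with the new remainder. The tail bound for a fixed observable is turned into
this statement by Fubini's theorem and Markov's inequality. -/
lemma measureReal_overlap_step_le (h : IsSamplingFrame μ u P N K τ ε) (hk : 0 < k) {x : V}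
    {c a δ η : ℝ} (hδ : 0 < δ) (hx : P x = x) (hc : 0 < c) (ha : 0 < a) (hak : N * τ / k ≤ a)
    (hbias : (ε + N * K * μ.real {α | c < |⟪u α, x⟫_ℝ|}) * ‖x‖ * √K ≤ c / 4)
    (htail : 2 * Real.exp (-(1 / (64 * a))) ≤ δ * η) :
    (Measure.pi fun _ : Fin k => μ).real
      {ω | δ < μ.real {α | c / 2 < |⟪u α, x - P (truncOp N u x c ω)⟫_ℝ|}} ≤ η := by
  set Q : Measure (Fin k → S) := Measure.pi fun _ => μ with hQ
  have hη : 0 ≤ η := by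
    by_contra hcon
    have := Real.exp_pos (-(1 / (64 * a)))
    nlinarith
  let B : Set ((Fin k → S) × S) :=
    {z | c / 2 < |⟪u z.2, x - P (truncOp N u x c z.1)⟫_ℝ|}
  have hB : MeasurableSet B := by
    refine measurableSet_lt measurable_const (Measurable.abs (Measurable.inner
      (h.meas.comp measurable_snd) (measurable_const.sub ?_)))
    exact (LinearMap.continuous_of_finiteDimensional P).measurable.comp
      ((h.measurable_truncOp x c).comp measurable_fst)
  have hsec : ∀ α, Q ((fun ω => (ω, α)) ⁻¹' B) ≤ ENNReal.ofReal (δ * η) := by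
    intro α
    rw [← ofReal_measureReal]
    refine ENNReal.ofReal_le_ofReal (le_trans ?_ htail)
    refine le_trans (le_of_eq ?_) (h.measureReal_overlap_truncOp_le (x := x) (v := P (u α)) hk hc
      ha hak (h.idem _) (h.proj_le α) ?_)
    · congr 1
      ext ω
      simp only [B, Set.mem_preimage, Set.mem_ofPred_eq]
      rw [inner_sub_right, h.symm, hx, h.symm]
    · refine le_trans (mul_le_mul_of_nonneg_left ?_ ?_) hbias
      · exact (h.norm_proj_le _).trans (Real.le_sqrt_of_sq_le (h.norm_le α))
      · have := h.N_pos; have := h.K_nonneg; have := h.ε_nonneg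
        positivity
  have hprod : ∫⁻ ω, μ (Prod.mk ω ⁻¹' B) ∂Q ≤ ENNReal.ofReal (δ * η) := by
    rw [← Measure.prod_apply hB, Measure.prod_apply_symm hB]
    calc _ ≤ ∫⁻ _α, ENNReal.ofReal (δ * η) ∂μ := lintegral_mono hsec
      _ = _ := by simp
  have hmk : Q {ω | ENNReal.ofReal δ ≤ μ (Prod.mk ω ⁻¹' B)} ≤ ENNReal.ofReal η := by
    refine (meas_ge_le_lintegral_div (measurable_measure_prodMk_left hB).aemeasurable
      (by simpa using hδ) ENNReal.ofReal_ne_top).trans ?_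
    refine ENNReal.div_le_of_le_mul (hprod.trans ?_)
    rw [← ENNReal.ofReal_mul hη, mul_comm]
  refine ENNReal.toReal_le_of_le_ofReal hη ((measure_mono fun ω hω => ?_).trans hmk)
  simp only [Set.mem_ofPred_eq] at hω ⊢
  rw [ENNReal.ofReal_le_iff_le_toReal (measure_ne_top _ _)]
  exact hω.le

/-- One golfing step preserves the invariant at half the scale, and the increment of the certificate
is small in the seminorm `Q`, except with probability `η`. -/
lemma measureReal_not_step_le (h : IsSamplingFrame μ u P N K τ ε) (hk : 0 < k) {r β δ η a : ℝ}
    (hr : 0 < r) (hβ : 0 < β) (hδ : 0 < δ) (ha : 0 < a) (hak : N * τ / k ≤ a)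
    (hθ : 16 * (Module.finrank ℝ V * ε ^ 2 + N * τ / k) ≤ η) (hkδ : 4 * (k * δ) ≤ η)
    (htail : 8 * Real.exp (-(1 / (64 * a))) ≤ δ * η)
    (hbias : 4 * ((ε + N * K * δ) * √(K * r)) ≤ β) {Q : V → ℝ}
    (hQ : ∀ x s, 0 < s → IsIncoherent μ u P r β δ x s → (Measure.pi fun _ : Fin k => μ).real
      {ω | s / 4 < Q (truncOp N u x (s * β) ω)} ≤ η / 4) {x : V} {s : ℝ} (hs : 0 < s)
    (hx : IsIncoherent μ u P r β δ x s) :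
    (Measure.pi fun _ : Fin k => μ).real
      {ω | ¬ (IsIncoherent μ u P r β δ (golfStep N u P ω x) (s / 2) ∧
        Q (batchOp N u ω x) ≤ s / 4)} ≤ η := by
  set M : Measure (Fin k → S) := Measure.pi fun _ => μ with hM
  have hK := h.K_nonneg
  have hN := h.N_pos
  have hε := h.ε_nonneg
  -- outside `A₁`, truncation of the coefficients has no effect on the batch
  let A₁ : Set (Fin k → S) := ⋃ j, {ω | s * β < |⟪u (ω j), x⟫_ℝ|}
  let A₂ : Set (Fin k → S) := {ω | s ^ 2 * r / 4 ≤ ‖golfStep N u P ω x‖ ^ 2}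
  let A₃ : Set (Fin k → S) :=
    {ω | δ < μ.real {α | s * β / 2 < |⟪u α, x - P (truncOp N u x (s * β) ω)⟫_ℝ|}}
  let A₄ : Set (Fin k → S) := {ω | s / 4 < Q (truncOp N u x (s * β) ω)}
  have h1 : M.real A₁ ≤ η / 4 := by
    calc M.real A₁ ≤ ∑ j : Fin k, M.real {ω | s * β < |⟪u (ω j), x⟫_ℝ|} :=
          measureReal_iUnion_fintype_le _
      _ = ∑ _j : Fin k, μ.real {α | s * β < |⟪u α, x⟫_ℝ|} := by
          refine Finset.sum_congr rfl fun j _ => ?_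
          exact (measurePreserving_eval (fun _ : Fin k => μ) j).measureReal_preimage
            (h.measurableSet_overlap_gt x (s * β)).nullMeasurableSet
      _ ≤ ∑ _j : Fin k, δ := Finset.sum_le_sum fun j _ => hx.overlap
      _ = k * δ := by simp
      _ ≤ _ := by linarith
  have h2 : M.real A₂ ≤ η / 4 := by
    have hmk := mul_meas_ge_le_integral_of_nonneg (ae_of_all _ fun ω => sq_nonneg _)
      (h.integrable_norm_golfStep_sq hk x) (s ^ 2 * r / 4)
    have hle := hmk.trans (h.integral_norm_golfStep_sq_le hk hx.proj)
    have hsr : 0 < s ^ 2 * r := by positivity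
    have hθ0 : 0 ≤ Module.finrank ℝ V * ε ^ 2 + N * τ / k := by
      have := h.τ_nonneg; positivity
    have hle2 : s ^ 2 * r / 4 * M.real A₂ ≤
        (Module.finrank ℝ V * ε ^ 2 + N * τ / k) * (s ^ 2 * r) :=
      hle.trans (mul_le_mul_of_nonneg_left hx.norm_le hθ0)
    have : M.real A₂ ≤ 4 * (Module.finrank ℝ V * ε ^ 2 + N * τ / k) := by
      refine le_of_mul_le_mul_left ?_ hsr
      linarith
    linarith
  have h3 : M.real A₃ ≤ η / 4 := by
    refine h.measureReal_overlap_step_le hk hδ hx.proj (mul_pos hs hβ) ha hak ?_ (by linarith)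
    have hxn : ‖x‖ ≤ s * √r := by
      refine le_of_sq_le_sq ?_ (by positivity)
      rw [mul_pow, Real.sq_sqrt hr.le]
      exact hx.norm_le
    calc _ ≤ (ε + N * K * δ) * (s * √r) * √K := by
          gcongr
          exact hx.overlap
      _ = s * ((ε + N * K * δ) * √(K * r)) := by rw [Real.sqrt_mul hK]; ring
      _ ≤ s * (β / 4) := by gcongr; linarith
      _ = _ := by ring
  have h4 : M.real A₄ ≤ η / 4 := hQ x s hs hx
  have hsub : {ω | ¬ (IsIncoherent μ u P r β δ (golfStep N u P ω x) (s / 2) ∧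
        Q (batchOp N u ω x) ≤ s / 4)} ⊆ (A₁ ∪ A₂) ∪ (A₃ ∪ A₄) := by
    intro ω hω
    by_contra hcon
    simp only [A₁, A₂, A₃, A₄, Set.mem_union, Set.mem_iUnion, Set.mem_ofPred_eq, not_or,
      not_exists, not_lt, not_le] at hcon
    obtain ⟨⟨c1, c2⟩, c3, c4⟩ := hcon
    have e := batchOp_eq_truncOp N u x (s * β) c1
    refine hω ⟨⟨proj_golfStep h.idem hx.proj ω, ?_, ?_⟩, by rwa [e]⟩
    · refine c2.le.trans (le_of_eq (by ring))
    · rw [golfStep, e]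
      have e2 : s / 2 * β = s * β / 2 := by ring
      rw [e2]
      exact c3
  calc _ ≤ M.real ((A₁ ∪ A₂) ∪ (A₃ ∪ A₄)) := measureReal_mono hsub
    _ ≤ (M.real A₁ + M.real A₂) + (M.real A₃ + M.real A₄) :=
        (measureReal_union_le _ _).trans
          (add_le_add (measureReal_union_le _ _) (measureReal_union_le _ _))
    _ ≤ η := by linarith

/-- The golfing scheme: after `l` steps the remainder has shrunk by the factor `2 ^ l`, and the
certificate is small in the seminorm `Q`, except with probability `l η`. -/
lemma measure_not_golf_le (h : IsSamplingFrame μ u P N K τ ε) {r β δ η : ℝ} {Q : V → ℝ}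
    (hQm : Measurable Q) (hQ0 : Q 0 = 0) (hQadd : ∀ x y, Q (x + y) ≤ Q x + Q y) (hη : 0 ≤ η)
    (hstep : ∀ x s, 0 < s → IsIncoherent μ u P r β δ x s → (Measure.pi fun _ : Fin k => μ).real
      {ω | ¬ (IsIncoherent μ u P r β δ (golfStep N u P ω x) (s / 2) ∧
        Q (batchOp N u ω x) ≤ s / 4)} ≤ η) (l : ℕ) {x : V} {s : ℝ} (hs : 0 < s)
    (hx : IsIncoherent μ u P r β δ x s) :
    (Measure.pi fun _ : Fin l => Measure.pi fun _ : Fin k => μ)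
      {ω | ¬ (‖golfRem N u P l ω x‖ ^ 2 ≤ (s / 2 ^ l) ^ 2 * r ∧ Q (golfCert N u P l ω x) ≤ s / 2)} ≤
      ENNReal.ofReal (l * η) := by
  induction l generalizing x s with
  | zero =>
    have : {ω : Fin 0 → Fin k → S | ¬ (‖golfRem N u P 0 ω x‖ ^ 2 ≤ (s / 2 ^ 0) ^ 2 * r ∧
        Q (golfCert N u P 0 ω x) ≤ s / 2)} = ∅ := by
      ext ω
      simp only [golfRem, golfCert, hQ0, pow_zero, div_one, Set.mem_ofPred_eq,
        Set.mem_empty_iff_false, not_not, iff_false]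
      exact ⟨hx.norm_le, by positivity⟩
    rw [this]
    simp
  | succ l ih =>
    set M : Measure (Fin k → S) := Measure.pi fun _ => μ with hM
    have hmeas : MeasurableSet {ω : Fin (l + 1) → Fin k → S |
        ¬ (‖golfRem N u P (l + 1) ω x‖ ^ 2 ≤ (s / 2 ^ (l + 1)) ^ 2 * r ∧
          Q (golfCert N u P (l + 1) ω x) ≤ s / 2)} := by
      refine (MeasurableSet.inter ?_ ?_).compl
      · exact measurableSet_le ((h.measurable_golfRem_left _ x).norm.pow_const 2) measurable_const
      · exact measurableSet_le (hQm.comp (h.measurable_golfCert_left _ x)) measurable_const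
    -- a measurable hull spares a proof that the event of a failed step is measurable
    let B : Set (Fin k → S) := toMeasurable M
      {ω | ¬ (IsIncoherent μ u P r β δ (golfStep N u P ω x) (s / 2) ∧ Q (batchOp N u ω x) ≤ s / 4)}
    have hB : M B ≤ ENNReal.ofReal η := by
      rw [measure_toMeasurable, ← ofReal_measureReal]
      exact ENNReal.ofReal_le_ofReal (hstep x s hs hx)
    rw [measure_pi_succ _ _ hmeas]
    have hin : ∀ a : Fin k → S, (Measure.pi fun _ : Fin l => M) {ω |
        (Fin.cons a ω : Fin (l + 1) → Fin k → S) ∈ {ω : Fin (l + 1) → Fin k → S |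
        ¬ (‖golfRem N u P (l + 1) ω x‖ ^ 2 ≤ (s / 2 ^ (l + 1)) ^ 2 * r ∧
          Q (golfCert N u P (l + 1) ω x) ≤ s / 2)}} ≤
        B.indicator (fun _ => 1) a + ENNReal.ofReal (l * η) := by
      intro a
      by_cases ha : a ∈ B
      · rw [Set.indicator_of_mem ha]
        exact prob_le_one.trans le_self_add
      · rw [Set.indicator_of_notMem ha, zero_add]
        have ha' := Set.notMem_subset (subset_toMeasurable M _) ha
        simp only [Set.mem_ofPred_eq, not_not] at ha'
        obtain ⟨hg, hq⟩ := ha'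
        refine le_trans (measure_mono fun ω hω => ?_) (ih (half_pos hs) hg)
        simp only [Set.mem_ofPred_eq, golfRem, golfCert, Fin.cons_succ, Fin.cons_zero] at hω ⊢
        refine fun hcon => hω ⟨?_, ?_⟩
        · rw [pow_succ' (2 : ℝ), ← div_div]
          exact hcon.1
        · refine (hQadd _ _).trans ?_
          linarith [hcon.2]
    calc _ ≤ ∫⁻ a, (B.indicator (fun _ => 1) a + ENNReal.ofReal (l * η)) ∂M :=
          lintegral_mono hin
      _ = M B + ENNReal.ofReal (l * η) := by
          rw [lintegral_add_right _ measurable_const,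
            lintegral_indicator (measurableSet_toMeasurable _ _), lintegral_const, lintegral_const,
            Measure.restrict_apply_univ, measure_univ, mul_one, one_mul]
      _ ≤ ENNReal.ofReal η + ENNReal.ofReal (l * η) := by gcongr
      _ = _ := by
          rw [← ENNReal.ofReal_add hη (by positivity)]
          congr 1
          push_cast
          ring

end IsSamplingFrame
end GolfingStep

/-! ### The Hilbert-Schmidt space of Hermitian matrices -/

section HermitianSpace

variable {n : ℕ}

lemma hsInner_eq_sum (A B : Matrix (Fin n) (Fin n) ℂ) :
    hsInner A B = ∑ i, ∑ j, ((A i j).re * (B i j).re + (A i j).im * (B i j).im) := by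
  rw [hsInner, Matrix.trace, Complex.re_sum, Finset.sum_comm]
  refine Finset.sum_congr rfl fun j _ => ?_
  rw [diag_apply, Matrix.mul_apply, Complex.re_sum]
  refine Finset.sum_congr rfl fun i _ => ?_
  simp [conjTranspose_apply, Complex.mul_re]

lemma hsInner_comm (A B : Matrix (Fin n) (Fin n) ℂ) : hsInner A B = hsInner B A := by
  simp only [hsInner_eq_sum, mul_comm]

lemma hsInner_add_left (A B C : Matrix (Fin n) (Fin n) ℂ) :
    hsInner (A + B) C = hsInner A C + hsInner B C := by
  rw [hsInner, conjTranspose_add, add_mul, Matrix.trace_add, Complex.add_re]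
  rfl

lemma hsInner_add_right (A B C : Matrix (Fin n) (Fin n) ℂ) :
    hsInner A (B + C) = hsInner A B + hsInner A C := by
  rw [hsInner, mul_add, Matrix.trace_add, Complex.add_re]
  rfl

lemma hsInner_smul_left (c : ℝ) (A B : Matrix (Fin n) (Fin n) ℂ) :
    hsInner (c • A) B = c * hsInner A B := by
  rw [hsInner, conjTranspose_smul, star_trivial, smul_mul_assoc, Matrix.trace_smul,
    Complex.real_smul, Complex.re_ofReal_mul]
  rfl

lemma hsInner_smul_right (c : ℝ) (A B : Matrix (Fin n) (Fin n) ℂ) :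
    hsInner A (c • B) = c * hsInner A B := by
  rw [hsInner_comm, hsInner_smul_left, hsInner_comm]

lemma hsInner_sub_right (A B C : Matrix (Fin n) (Fin n) ℂ) :
    hsInner A (B - C) = hsInner A B - hsInner A C := by
  rw [hsInner, mul_sub, Matrix.trace_sub, Complex.sub_re]
  rfl

lemma hsNormSq_nonneg (A : Matrix (Fin n) (Fin n) ℂ) : 0 ≤ hsNormSq A := by
  rw [hsNormSq, hsInner_eq_sum]
  exact Finset.sum_nonneg fun i _ => Finset.sum_nonneg fun j _ =>
    add_nonneg (mul_self_nonneg _) (mul_self_nonneg _)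

lemma eq_zero_of_hsNormSq_eq_zero {A : Matrix (Fin n) (Fin n) ℂ} (h : hsNormSq A = 0) : A = 0 := by
  have hnn : ∀ i j, 0 ≤ (A i j).re * (A i j).re + (A i j).im * (A i j).im := fun i j =>
    add_nonneg (mul_self_nonneg _) (mul_self_nonneg _)
  rw [hsNormSq, hsInner_eq_sum,
    Finset.sum_eq_zero_iff_of_nonneg fun i _ => Finset.sum_nonneg fun j _ => hnn i j] at h
  ext i j
  have h1 := h i (Finset.mem_univ i)
  rw [Finset.sum_eq_zero_iff_of_nonneg fun j _ => hnn i j] at h1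
  have h2 := h1 j (Finset.mem_univ j)
  have h3 := mul_self_nonneg (A i j).re
  have h4 := mul_self_nonneg (A i j).im
  refine Complex.ext ?_ ?_
  · exact mul_self_eq_zero.mp (by linarith)
  · exact mul_self_eq_zero.mp (by linarith)

/-- The real vector space of Hermitian matrices, to be equipped with the Hilbert-Schmidt scalar
product. It is a type of its own so that no other norm on matrices interferes. -/
def HermMat (n : ℕ) : Type := selfAdjoint.submodule ℝ (Matrix (Fin n) (Fin n) ℂ)

namespace HermMat

noncomputable instance : AddCommGroup (HermMat n) :=
  inferInstanceAs (AddCommGroup (selfAdjoint.submodule ℝ (Matrix (Fin n) (Fin n) ℂ)))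

noncomputable instance : Module ℝ (HermMat n) :=
  inferInstanceAs (Module ℝ (selfAdjoint.submodule ℝ (Matrix (Fin n) (Fin n) ℂ)))

instance : FiniteDimensional ℝ (HermMat n) :=
  inferInstanceAs (FiniteDimensional ℝ (selfAdjoint.submodule ℝ (Matrix (Fin n) (Fin n) ℂ)))

/-- The underlying matrix. -/
noncomputable def toMat : HermMat n →ₗ[ℝ] Matrix (Fin n) (Fin n) ℂ :=
  (selfAdjoint.submodule ℝ (Matrix (Fin n) (Fin n) ℂ)).subtype

/-- A Hermitian matrix as an element of the space of Hermitian matrices. -/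
def ofMat (A : Matrix (Fin n) (Fin n) ℂ) (hA : A.IsHermitian) : HermMat n := ⟨A, hA⟩

@[simp] lemma toMat_ofMat (A : Matrix (Fin n) (Fin n) ℂ) (hA : A.IsHermitian) :
    toMat (ofMat A hA) = A := rfl

lemma toMat_isHermitian (x : HermMat n) : (toMat x).IsHermitian := x.2

lemma toMat_injective : Function.Injective (toMat (n := n)) := Subtype.val_injective

/-- The Hilbert-Schmidt scalar product on Hermitian matrices. -/
noncomputable abbrev innerCore : InnerProductSpace.Core ℝ (HermMat n) where
  inner x y := hsInner (toMat x) (toMat y)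
  conj_inner_symm x y := by simp [hsInner_comm]
  re_inner_nonneg x := hsNormSq_nonneg (toMat x)
  add_left x y z := by simp [hsInner_add_left]
  smul_left x y c := by simp [hsInner_smul_left]
  definite x h := toMat_injective (by rw [eq_zero_of_hsNormSq_eq_zero h, map_zero])

noncomputable instance : NormedAddCommGroup (HermMat n) := innerCore.toNormedAddCommGroup

noncomputable instance : InnerProductSpace ℝ (HermMat n) :=
  InnerProductSpace.ofCore innerCore.toCore

noncomputable instance : MeasurableSpace (HermMat n) := borel _

instance : BorelSpace (HermMat n) := ⟨rfl⟩

lemma inner_eq (x y : HermMat n) : inner ℝ x y = hsInner (toMat x) (toMat y) := rfl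

lemma norm_sq_eq (x : HermMat n) : ‖x‖ ^ 2 = hsNormSq (toMat x) := by
  rw [← real_inner_self_eq_norm_sq, inner_eq, hsNormSq]

/-- The dimension is `n ^ 2`; the dimension of all complex matrices over `ℝ` is a sufficient
bound. -/
lemma finrank_le : Module.finrank ℝ (HermMat n) ≤ 2 * n ^ 2 := by
  have h1 : Module.finrank ℝ (HermMat n) ≤ Module.finrank ℝ (Matrix (Fin n) (Fin n) ℂ) :=
    Submodule.finrank_le (selfAdjoint.submodule ℝ (Matrix (Fin n) (Fin n) ℂ))
  refine h1.trans (le_of_eq ?_)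
  rw [Module.finrank_matrix, Complex.finrank_real_complex, Fintype.card_fin]
  ring

lemma measurable_of_measurable_entries {S : Type*} [MeasurableSpace S] {f : S → HermMat n}
    (hf : ∀ i j, Measurable fun α => toMat (f α) i j) : Measurable f := by
  let b := stdOrthonormalBasis ℝ (HermMat n)
  have h1 : f = fun α => ∑ i, inner ℝ (b i) (f α) • b i := by
    ext1 α
    exact (b.sum_repr' (f α)).symm
  rw [h1]
  refine Finset.measurable_fun_sum _ fun i _ => Measurable.smul_const ?_ _
  simp only [inner_eq, hsInner_eq_sum]
  refine Finset.measurable_fun_sum _ fun a _ => Finset.measurable_fun_sum _ fun c _ => ?_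
  exact ((Complex.measurable_re.comp (hf a c)).const_mul _).add
    ((Complex.measurable_im.comp (hf a c)).const_mul _)

/-- The projection `P_T` on the space of Hermitian matrices. -/
noncomputable def proj (ρ : Matrix (Fin n) (Fin n) ℂ) : HermMat n →ₗ[ℝ] HermMat n where
  toFun x := ofMat (projT ρ (toMat x)) (projT_mem ρ x.toMat_isHermitian).1
  map_add' x y := by
    apply toMat_injective
    simp only [toMat_ofMat, map_add, projT]
    rw [mul_add, add_mul]
    abel
  map_smul' c x := by
    apply toMat_injective
    simp only [toMat_ofMat, map_smul, projT, RingHom.id_apply]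
    rw [mul_smul_comm, smul_mul_assoc, smul_sub]

@[simp] lemma toMat_proj (ρ : Matrix (Fin n) (Fin n) ℂ) (x : HermMat n) :
    toMat (proj ρ x) = projT ρ (toMat x) := rfl

lemma proj_proj (ρ : Matrix (Fin n) (Fin n) ℂ) (x : HermMat n) :
    proj ρ (proj ρ x) = proj ρ x := by
  apply toMat_injective
  have h := (projT_mem ρ x.toMat_isHermitian).2
  rw [toMat_proj, toMat_proj]
  conv_lhs => rw [projT, h, sub_zero]

lemma inner_proj_left (ρ : Matrix (Fin n) (Fin n) ℂ) (x y : HermMat n) :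
    inner ℝ (proj ρ x) y = inner ℝ x (proj ρ y) := by
  have key : ∀ x y : HermMat n, inner ℝ (proj ρ x) y = inner ℝ (proj ρ x) (proj ρ y) := by
    intro x y
    have h := hsInner_sub_projT ρ (toMat y) (projT_mem ρ x.toMat_isHermitian)
    rw [hsInner_sub_right] at h
    simp only [inner_eq, toMat_proj]
    linarith
  rw [key, ← real_inner_comm, ← key, real_inner_comm]

/-- The compression of a Hermitian matrix to the kernel of `ρ`. -/
noncomputable def compress (ρ : Matrix (Fin n) (Fin n) ℂ) :
    HermMat n →ₗ[ℝ] Matrix (Fin n) (Fin n) ℂ where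
  toFun x := kerProj ρ * toMat x * kerProj ρ
  map_add' x y := by rw [map_add, mul_add, add_mul]
  map_smul' c x := by
    rw [map_smul, mul_smul_comm, smul_mul_assoc, RingHom.id_apply]

lemma compress_apply (ρ : Matrix (Fin n) (Fin n) ℂ) (x : HermMat n) :
    compress ρ x = kerProj ρ * toMat x * kerProj ρ := rfl

lemma compress_eq (ρ : Matrix (Fin n) (Fin n) ℂ) (x : HermMat n) :
    compress ρ x = toMat (x - proj ρ x) := by
  rw [map_sub, toMat_proj, projT, sub_sub_cancel, compress_apply]

lemma compress_isHermitian (ρ : Matrix (Fin n) (Fin n) ℂ) (x : HermMat n) :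
    (compress ρ x).IsHermitian := by
  rw [compress_eq]
  exact toMat_isHermitian _

section OperatorNorm

open scoped Matrix.Norms.L2Operator

/-- The operator norm is at most the Hilbert-Schmidt norm. -/
lemma norm_toMat_le (x : HermMat n) : ‖toMat x‖ ≤ ‖x‖ := by
  refine le_of_sq_le_sq ?_ (norm_nonneg _)
  rw [norm_sq_eq, sq, ← l2_opNorm_conjTranspose_mul_self]
  exact norm_le_trace (posSemidef_conjTranspose_mul_self _)

lemma norm_compress_le (ρ : Matrix (Fin n) (Fin n) ℂ) (x : HermMat n) :
    ‖compress ρ x‖ ≤ ‖x - proj ρ x‖ := by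
  rw [compress_eq]
  exact norm_toMat_le _

lemma norm_sub_proj_le (ρ : Matrix (Fin n) (Fin n) ℂ) (x : HermMat n) :
    ‖x - proj ρ x‖ ≤ ‖x‖ := by
  refine le_of_sq_le_sq ?_ (norm_nonneg _)
  have h1 : ‖x - proj ρ x‖ ^ 2 = ‖x‖ ^ 2 - ‖proj ρ x‖ ^ 2 := by
    rw [norm_sub_sq_real, ← real_inner_self_eq_norm_sq (proj ρ x), inner_proj_left, proj_proj]
    ring
  rw [h1]
  linarith [sq_nonneg ‖proj ρ x‖]

end OperatorNorm

end HermMat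
end HermitianSpace

/-! ### Operator norm of the certificate on the kernel -/

section CertificateNorm

variable {n : ℕ}

lemma hsInner_conjTranspose_right {U : Matrix (Fin n) (Fin n) ℂ} (hU : U.IsHermitian)
    (A : Matrix (Fin n) (Fin n) ℂ) : hsInner U Aᴴ = hsInner U A := by
  rw [hsInner, ← conjTranspose_mul, trace_conjTranspose, hsInner, hU.eq, Matrix.trace_mul_comm]
  simp

lemma hsNormSq_conjTranspose (A : Matrix (Fin n) (Fin n) ℂ) : hsNormSq Aᴴ = hsNormSq A := by
  rw [hsNormSq, hsNormSq, hsInner, hsInner, conjTranspose_conjTranspose, Matrix.trace_mul_comm]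

lemma re_star_dotProduct_self (y : Fin n → ℂ) :
    (star y ⬝ᵥ y).re = ∑ i, ((y i).re ^ 2 + (y i).im ^ 2) := by
  rw [dotProduct, Complex.re_sum]
  refine Finset.sum_congr rfl fun i _ => ?_
  simp [Complex.mul_re, sq]

lemma re_star_dotProduct_self_nonneg (y : Fin n → ℂ) : 0 ≤ (star y ⬝ᵥ y).re := by
  rw [re_star_dotProduct_self]
  positivity

lemma star_dotProduct_mul_self {A : Matrix (Fin n) (Fin n) ℂ} (hA : A.IsHermitian)
    (x : Fin n → ℂ) : star x ⬝ᵥ (A * A) *ᵥ x = star (A *ᵥ x) ⬝ᵥ (A *ᵥ x) := by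
  rw [star_mulVec, hA.eq, ← dotProduct_mulVec, mulVec_mulVec]

/-- Orthogonal projections do not increase the Euclidean norm. -/
lemma re_star_dotProduct_mulVec_le {p : Matrix (Fin n) (Fin n) ℂ} (hp : p.IsHermitian)
    (hp2 : p * p = p) (y : Fin n → ℂ) :
    (star (p *ᵥ y) ⬝ᵥ (p *ᵥ y)).re ≤ (star y ⬝ᵥ y).re := by
  have hq : (1 - p).IsHermitian := isHermitian_one.sub hp
  have h0 := re_star_dotProduct_self_nonneg ((1 - p) *ᵥ y)
  rw [← star_dotProduct_mul_self hq] at h0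
  rw [← star_dotProduct_mul_self hp, hp2]
  have h1 : (1 - p) * (1 - p) = 1 - p := by
    rw [mul_sub, sub_mul, sub_mul, hp2]
    simp
  rw [h1, sub_mulVec, one_mulVec, dotProduct_sub, Complex.sub_re] at h0
  linarith

namespace IsSamplingFrame

variable {S : Type*} [MeasurableSpace S] {u : S → HermMat n} {ρ : Matrix (Fin n) (Fin n) ℂ}
  {N K τ ε : ℝ} {k : ℕ}

/-- The second moment bound for Hermitian test matrices extends to all test matrices. -/
lemma integral_hsInner_sq_le {μ : Measure S} {P : HermMat n →ₗ[ℝ] HermMat n}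
    (h : IsSamplingFrame μ u P N K τ ε)
    (A : Matrix (Fin n) (Fin n) ℂ) :
    N * ∫ α, hsInner (u α).toMat A ^ 2 ∂μ ≤ hsNormSq A := by
  have hH : ((1 / 2 : ℝ) • (A + Aᴴ)).IsHermitian := by
    show ((1 / 2 : ℝ) • (A + Aᴴ))ᴴ = _
    rw [conjTranspose_smul, star_trivial, conjTranspose_add, conjTranspose_conjTranspose, add_comm]
  have h1 := h.second (HermMat.ofMat _ hH)
  rw [HermMat.norm_sq_eq] at h1
  simp only [HermMat.inner_eq, HermMat.toMat_ofMat, hsInner_smul_right, hsInner_add_right,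
    hsInner_conjTranspose_right (HermMat.toMat_isHermitian _)] at h1
  have h2 : ∀ α, (1 / 2 * (hsInner (u α).toMat A + hsInner (u α).toMat A)) ^ 2 =
      hsInner (u α).toMat A ^ 2 := fun α => by ring
  simp only [h2] at h1
  refine h1.trans ?_
  have h3 := hsNormSq_nonneg (A - Aᴴ)
  have h4 := hsNormSq_conjTranspose A
  simp only [hsNormSq, hsInner_smul_right, hsInner_smul_left, hsInner_add_right, hsInner_add_left,
    hsInner_sub_right, hsInner_comm (A - Aᴴ)] at h3 h4 ⊢
  rw [hsInner_comm Aᴴ A] at *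
  linarith

variable {μ : Measure S} [IsProbabilityMeasure μ]

lemma integrable_hsInner_sq {P : HermMat n →ₗ[ℝ] HermMat n} (h : IsSamplingFrame μ u P N K τ ε)
    (A : Matrix (Fin n) (Fin n) ℂ) : Integrable (fun α => hsInner (u α).toMat A ^ 2) μ := by
  have hH : ((1 / 2 : ℝ) • (A + Aᴴ)).IsHermitian := by
    show ((1 / 2 : ℝ) • (A + Aᴴ))ᴴ = _
    rw [conjTranspose_smul, star_trivial, conjTranspose_add, conjTranspose_conjTranspose, add_comm]
  refine (h.integrable_inner_sq (HermMat.ofMat _ hH)).congr (ae_of_all _ fun α => ?_)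
  simp only [HermMat.inner_eq, HermMat.toMat_ofMat, hsInner_smul_right, hsInner_add_right,
    hsInner_conjTranspose_right (HermMat.toMat_isHermitian _)]
  ring

/-- The matrix variance of the observables: `N 𝔼 U² ≤ 2 n`. -/
lemma integral_mulVec_sq_le {P : HermMat n →ₗ[ℝ] HermMat n} (h : IsSamplingFrame μ u P N K τ ε)
    (x : Fin n → ℂ) :
    Integrable (fun α => (star ((u α).toMat *ᵥ x) ⬝ᵥ ((u α).toMat *ᵥ x)).re) μ ∧
    N * ∫ α, (star ((u α).toMat *ᵥ x) ⬝ᵥ ((u α).toMat *ᵥ x)).re ∂μ ≤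
      2 * n * (star x ⬝ᵥ x).re := by
  -- row `i` of `U x` is a pair of Hilbert-Schmidt products of `U` with matrices of norm `‖x‖`
  let A : Fin n → Matrix (Fin n) (Fin n) ℂ := fun i => Matrix.of fun a b =>
    if a = i then star (x b) else 0
  have hre : ∀ (α : S) (i : Fin n), (((u α).toMat *ᵥ x) i).re = hsInner (u α).toMat (A i) := by
    intro α i
    rw [hsInner_eq_sum, Finset.sum_eq_single i]
    · rw [mulVec, dotProduct, Complex.re_sum]
      refine Finset.sum_congr rfl fun j _ => ?_
      simp [A, Complex.mul_re, sub_eq_add_neg]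
    · intro a _ ha
      simp [A, ha]
    · simp
  have him : ∀ (α : S) (i : Fin n),
      (((u α).toMat *ᵥ x) i).im = hsInner (u α).toMat (Complex.I • A i) := by
    intro α i
    rw [hsInner_eq_sum, Finset.sum_eq_single i]
    · rw [mulVec, dotProduct, Complex.im_sum]
      refine Finset.sum_congr rfl fun j _ => ?_
      simp [A, Complex.mul_im]
    · intro a _ ha
      simp [A, ha]
    · simp
  have hnA : ∀ i, hsNormSq (A i) = (star x ⬝ᵥ x).re := by
    intro i
    rw [hsNormSq, hsInner_eq_sum, re_star_dotProduct_self, Finset.sum_eq_single i]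
    · refine Finset.sum_congr rfl fun j _ => ?_
      simp [A, sq]
    · intro a _ ha
      simp [A, ha]
    · simp
  have hnI : ∀ i, hsNormSq (Complex.I • A i) = (star x ⬝ᵥ x).re := by
    intro i
    rw [← hnA i, hsNormSq, hsNormSq, hsInner_eq_sum, hsInner_eq_sum]
    refine Finset.sum_congr rfl fun a _ => Finset.sum_congr rfl fun b _ => ?_
    simp
    ring
  have hi : ∀ i, Integrable (fun α => hsInner (u α).toMat (A i) ^ 2 +
      hsInner (u α).toMat (Complex.I • A i) ^ 2) μ := fun i =>
    (h.integrable_hsInner_sq (A i)).add (h.integrable_hsInner_sq (Complex.I • A i))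
  simp only [re_star_dotProduct_self ((u _).toMat *ᵥ x), hre, him]
  refine ⟨integrable_finsetSum _ fun i _ => hi i, ?_⟩
  rw [integral_finsetSum _ fun i _ => hi i, Finset.mul_sum]
  calc _ ≤ ∑ _i : Fin n, ((star x ⬝ᵥ x).re + (star x ⬝ᵥ x).re) := by
        refine Finset.sum_le_sum fun i _ => ?_
        rw [integral_add (h.integrable_hsInner_sq (A i))
          (h.integrable_hsInner_sq (Complex.I • A i)), mul_add]
        refine add_le_add ?_ ?_
        · exact (h.integral_hsInner_sq_le (A i)).trans_eq (hnA i)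
        · exact (h.integral_hsInner_sq_le _).trans_eq (hnI i)
    _ = _ := by
        rw [Finset.sum_const, Finset.card_univ, Fintype.card_fin, nsmul_eq_mul]
        ring

lemma integrable_truncCoef_smul {P : HermMat n →ₗ[ℝ] HermMat n}
    (h : IsSamplingFrame μ u P N K τ ε) (x : HermMat n) {c : ℝ} (hc : 0 ≤ c) :
    Integrable (fun α => truncCoef u x c α • u α) μ := by
  refine .of_bound ((h.measurable_truncCoef x c).smul h.meas).aestronglyMeasurable (c * √K)
    (ae_of_all _ fun α => ?_)
  rw [norm_smul, Real.norm_eq_abs]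
  exact mul_le_mul (abs_truncCoef_le u x hc α) (Real.le_sqrt_of_sq_le (h.norm_le α))
    (norm_nonneg _) hc

open scoped Matrix.Norms.L2Operator

/-- The mean of the truncated sampling operator, applied to a vector in the range of the
projection, is almost in that range: without truncation and for an exact tight frame, it is the
vector itself. -/
lemma norm_compress_integral_le (h : IsSamplingFrame μ u (HermMat.proj ρ) N K τ ε)
    {x : HermMat n} (hx : HermMat.proj ρ x = x) {c : ℝ} (hc : 0 ≤ c) :
    ‖HermMat.compress ρ (N • ∫ α, truncCoef u x c α • u α ∂μ)‖ ≤
      (ε + N * K * μ.real {α | c < |inner ℝ (u α) x|}) * ‖x‖ := by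
  have hN := h.N_pos
  have hK := h.K_nonneg
  have hε := h.ε_nonneg
  set y : HermMat n := N • ∫ α, truncCoef u x c α • u α ∂μ with hy
  set d : HermMat n := y - HermMat.proj ρ y with hd
  refine (HermMat.norm_compress_le ρ y).trans ?_
  rw [← hd]
  have hPd : HermMat.proj ρ d = 0 := by rw [hd, map_sub, h.idem, sub_self]
  have hxd : inner ℝ x d = 0 := by rw [← hx, h.symm, hPd, inner_zero_right]
  have h1 : inner ℝ d y = N * ∫ α, truncCoef u x c α * inner ℝ (u α) d ∂μ := by
    rw [hy, real_inner_smul_right, ← integral_inner (h.integrable_truncCoef_smul x hc)]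
    congr 1
    refine integral_congr_ae (ae_of_all _ fun α => ?_)
    simp only [real_inner_smul_right]
    rw [real_inner_comm]
  have h2 : inner ℝ d y = ‖d‖ ^ 2 := by
    have : y = d + HermMat.proj ρ y := by rw [hd]; abel
    rw [this, inner_add_right, ← h.symm, hPd, inner_zero_left, add_zero,
      real_inner_self_eq_norm_sq]
  have h3 := h.abs_integral_truncCoef_sub_le x d c
  rw [← h1, hxd, sub_zero, h2, abs_of_nonneg (sq_nonneg _)] at h3
  rcases (norm_nonneg d).eq_or_lt with h0 | h0
  · rw [← h0]
    positivity
  · rw [sq] at h3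
    exact le_of_mul_le_mul_right h3 h0

/-- The increment of the certificate in one golfing step has small operator norm on the kernel of
the state, by concentration of sums of independent Hermitian matrices. -/
lemma measureReal_lt_norm_compress_le (h : IsSamplingFrame μ u (HermMat.proj ρ) N K τ ε)
    (hk : 0 < k) {r β δ η : ℝ} (hr : 0 < r) (hβ : 0 < β) (hδ : 0 < δ) (hη : 0 ≤ η)
    (hbias : 8 * ((ε + N * K * δ) * √r) ≤ 1) (t : ℕ) (hn : n ≤ 2 ^ 2 ^ t)
    (hvar : 4096 * ((4 * 2 ^ t) * (4 * n * N * β ^ 2 / k +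
      4 * (4 * 2 ^ t) * (N ^ 2 * β ^ 2 * K / k ^ 2))) ≤ η ^ 2)
    (x : HermMat n) (s : ℝ) (hs : 0 < s) (hx : IsIncoherent μ u (HermMat.proj ρ) r β δ x s) :
    (Measure.pi fun _ : Fin k => μ).real
      {ω | s / 4 < ‖HermMat.compress ρ (truncOp N u x (s * β) ω)‖} ≤ η / 4 := by
  set M : Measure (Fin k → S) := Measure.pi fun _ => μ with hM
  have hN := h.N_pos
  have hK := h.K_nonneg
  have hε := h.ε_nonneg
  have hk' : (0 : ℝ) < k := by exact_mod_cast hk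
  have hc : 0 ≤ s * β := by positivity
  set c := s * β with hcdef
  let F : HermMat n →L[ℝ] Matrix (Fin n) (Fin n) ℂ :=
    LinearMap.toContinuousLinearMap (HermMat.compress ρ)
  have hFa : ∀ y, F y = HermMat.compress ρ y := fun _ => rfl
  let Z : S → Matrix (Fin n) (Fin n) ℂ := fun α => F ((N / k) • truncCoef u x c α • u α)
  have hi := h.integrable_truncCoef_smul x hc
  have hZm : StronglyMeasurable Z := by
    refine F.continuous.comp_stronglyMeasurable ?_
    exact (((h.measurable_truncCoef x c).smul h.meas).const_smul (N / (k : ℝ))).stronglyMeasurable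
  have hZH : ∀ α, (Z α).IsHermitian := fun α => HermMat.compress_isHermitian ρ _
  have hZval : ∀ α, Z α = ((N / k) * truncCoef u x c α) •
      (kerProj ρ * (u α).toMat * kerProj ρ) := by
    intro α
    simp only [Z, hFa, map_smul, HermMat.compress_apply, smul_smul]
  have hR : ∀ α, ‖Z α‖ ≤ N / k * (c * √K) := by
    intro α
    simp only [Z, hFa]
    refine (HermMat.norm_compress_le ρ _).trans ((HermMat.norm_sub_proj_le ρ _).trans ?_)
    rw [norm_smul, norm_smul, Real.norm_of_nonneg (by positivity : 0 ≤ N / (k : ℝ)),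
      Real.norm_eq_abs]
    gcongr
    · exact abs_truncCoef_le u x hc α
    · exact Real.le_sqrt_of_sq_le (h.norm_le α)
  have hv : ∀ y : Fin n → ℂ, ∫ α, (star y ⬝ᵥ (Z α * Z α) *ᵥ y).re ∂μ ≤
      (N / k) ^ 2 * c ^ 2 * (2 * n / N) * (star y ⬝ᵥ y).re := by
    intro y
    have hp := kerProj_isHermitian ρ
    have hp2 := kerProj_mul_self ρ
    obtain ⟨i1, i2⟩ := h.integral_mulVec_sq_le (kerProj ρ *ᵥ y)
    have h1 : ∀ α, (star y ⬝ᵥ (Z α * Z α) *ᵥ y).re ≤ (N / k) ^ 2 * c ^ 2 *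
        (star ((u α).toMat *ᵥ (kerProj ρ *ᵥ y)) ⬝ᵥ ((u α).toMat *ᵥ (kerProj ρ *ᵥ y))).re := by
      intro α
      have e1 : ((N / k) * truncCoef u x c α) ^ 2 ≤ (N / k) ^ 2 * c ^ 2 := by
        rw [mul_pow]
        gcongr ?_ * ?_
        rw [← sq_abs]
        exact pow_le_pow_left₀ (abs_nonneg _) (abs_truncCoef_le u x hc α) 2
      have e2 := re_star_dotProduct_mulVec_le hp hp2 ((u α).toMat *ᵥ (kerProj ρ *ᵥ y))
      have e3 : Z α *ᵥ y = ((N / k) * truncCoef u x c α) •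
          (kerProj ρ *ᵥ ((u α).toMat *ᵥ (kerProj ρ *ᵥ y))) := by
        rw [hZval, smul_mulVec, mulVec_mulVec, mulVec_mulVec, mul_assoc]
      rw [star_dotProduct_mul_self (hZH α), e3, star_smul, star_trivial, smul_dotProduct,
        dotProduct_smul, smul_smul, Complex.real_smul, Complex.re_ofReal_mul, ← sq]
      exact mul_le_mul e1 e2 (re_star_dotProduct_self_nonneg _) (by positivity)
    calc _ ≤ ∫ α, (N / k) ^ 2 * c ^ 2 * (star ((u α).toMat *ᵥ (kerProj ρ *ᵥ y)) ⬝ᵥ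
          ((u α).toMat *ᵥ (kerProj ρ *ᵥ y))).re ∂μ := by
          refine integral_mono_of_nonneg (ae_of_all _ fun α => ?_) (i1.const_mul _)
            (ae_of_all _ h1)
          simp only [Pi.zero_apply]
          rw [star_dotProduct_mul_self (hZH α)]
          exact re_star_dotProduct_self_nonneg _
      _ = (N / k) ^ 2 * c ^ 2 / N * (N * ∫ α, (star ((u α).toMat *ᵥ (kerProj ρ *ᵥ y)) ⬝ᵥ
          ((u α).toMat *ᵥ (kerProj ρ *ᵥ y))).re ∂μ) := by
          rw [integral_const_mul]
          field_simp
      _ ≤ (N / k) ^ 2 * c ^ 2 / N * (2 * n * (star y ⬝ᵥ y).re) := by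
          refine mul_le_mul_of_nonneg_left (i2.trans ?_) (by positivity)
          exact mul_le_mul_of_nonneg_left (re_star_dotProduct_mulVec_le hp hp2 y) (by positivity)
      _ = _ := by ring
  have hmean := integral_norm_sum_hermitian_sub_le (k := k) (μ := μ) hZm hZH hR (by positivity)
    hv t hn
  have hint : (k : ℝ) • ∫ α, Z α ∂μ =
      HermMat.compress ρ (N • ∫ α, truncCoef u x c α • u α ∂μ) := by
    have e : ∫ α, Z α ∂μ = F (∫ α, (N / (k : ℝ)) • truncCoef u x c α • u α ∂μ) :=
      F.integral_comp_comm (hi.smul (N / (k : ℝ)))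
    rw [e, integral_smul, hFa, ← map_smul, smul_smul, mul_div_cancel₀ _ hk'.ne']
  have hsum : ∀ ω : Fin k → S, ∑ j, Z (ω j) = HermMat.compress ρ (truncOp N u x c ω) := by
    intro ω
    simp only [Z, hFa, truncOp]
    rw [← map_sum, Finset.smul_sum]
  have hb : ‖(k : ℝ) • ∫ α, Z α ∂μ‖ ≤ s / 8 := by
    rw [hint]
    refine (h.norm_compress_integral_le hx.proj hc).trans ?_
    have hxn : ‖x‖ ≤ s * √r := by
      refine le_of_sq_le_sq ?_ (by positivity)
      rw [mul_pow, Real.sq_sqrt hr.le]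
      exact hx.norm_le
    calc _ ≤ (ε + N * K * δ) * (s * √r) := by
          gcongr
          exact hx.overlap
      _ = s / 8 * (8 * ((ε + N * K * δ) * √r)) := by ring
      _ ≤ s / 8 * 1 := by gcongr
      _ = s / 8 := by ring
  have hZi : Integrable (fun ω : Fin k → S => ‖∑ j, Z (ω j) - (k : ℝ) • ∫ α, Z α ∂μ‖) M := by
    have hZs : ∀ j : Fin k, StronglyMeasurable fun ω : Fin k → S => Z (ω j) := fun j =>
      hZm.comp_measurable (measurable_pi_apply j)
    have hbd : ∀ j : Fin k, Integrable (fun ω : Fin k → S => Z (ω j)) M := fun j =>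
      .of_bound (hZs j).aestronglyMeasurable _ (ae_of_all _ fun ω => hR (ω j))
    exact ((integrable_finsetSum _ fun j _ => hbd j).sub (integrable_const _)).norm
  have hmk := mul_meas_ge_le_integral_of_nonneg (ae_of_all M fun ω => norm_nonneg _) hZi (s / 8)
  have hsq : 2 * √(4 * 2 ^ t * (2 * (k * ((N / k) ^ 2 * c ^ 2 * (2 * n / N))) +
      4 * (4 * 2 ^ t) * (N / k * (c * √K)) ^ 2)) ≤ s / 8 * (η / 4) := by
    have e : 4 * 2 ^ t * (2 * (k * ((N / k) ^ 2 * c ^ 2 * (2 * n / N))) +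
        4 * (4 * 2 ^ t) * (N / k * (c * √K)) ^ 2) = (s / 64) ^ 2 *
        (4096 * ((4 * 2 ^ t) * (4 * n * N * β ^ 2 / k +
          4 * (4 * 2 ^ t) * (N ^ 2 * β ^ 2 * K / k ^ 2)))) := by
      have hKs : √K ^ 2 = K := Real.sq_sqrt hK
      rw [hcdef]
      field_simp
      rw [hKs]
      ring
    rw [e]
    have : √((s / 64) ^ 2 * (4096 * ((4 * 2 ^ t) * (4 * n * N * β ^ 2 / k +
          4 * (4 * 2 ^ t) * (N ^ 2 * β ^ 2 * K / k ^ 2))))) ≤ s / 64 * η := by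
      refine Real.sqrt_le_iff.mpr ⟨by positivity, ?_⟩
      rw [mul_pow]
      gcongr
    linarith
  have hfin : s / 8 * M.real {ω | s / 8 ≤ ‖∑ j, Z (ω j) - (k : ℝ) • ∫ α, Z α ∂μ‖} ≤
      s / 8 * (η / 4) := hmk.trans (hmean.trans hsq)
  refine (measureReal_mono fun ω hω => ?_).trans
    (le_of_mul_le_mul_left hfin (by positivity))
  simp only [Set.mem_ofPred_eq] at hω ⊢
  rw [← hsum] at hω
  have := norm_sub_norm_le (∑ j, Z (ω j)) ((k : ℝ) • ∫ α, Z α ∂μ)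
  linarith

end IsSamplingFrame
end CertificateNorm

/-! ### Discarding the exceptional frame elements -/

section FrameTruncation

variable {n : ℕ} {S : Type*} [MeasurableSpace S]

lemma measurable_hsInner {A B : S → Matrix (Fin n) (Fin n) ℂ}
    (hA : ∀ i j, Measurable fun α => A α i j) (hB : ∀ i j, Measurable fun α => B α i j) :
    Measurable fun α => hsInner (A α) (B α) := by
  simp only [hsInner_eq_sum]
  refine Finset.measurable_fun_sum _ fun i _ => Finset.measurable_fun_sum _ fun j _ => ?_
  exact ((Complex.measurable_re.comp (hA i j)).mul (Complex.measurable_re.comp (hB i j))).add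
    ((Complex.measurable_im.comp (hA i j)).mul (Complex.measurable_im.comp (hB i j)))

lemma measurable_projT {A : S → Matrix (Fin n) (Fin n) ℂ}
    (hA : ∀ i j, Measurable fun α => A α i j) (ρ : Matrix (Fin n) (Fin n) ℂ) (i j : Fin n) :
    Measurable fun α => projT ρ (A α) i j := by
  simp only [projT, Matrix.sub_apply, Matrix.mul_apply]
  refine (hA i j).sub (Finset.measurable_fun_sum _ fun b _ => Measurable.mul_const ?_ _)
  exact Finset.measurable_fun_sum _ fun a _ => (hA a b).const_mul _

lemma measurableSet_badSet {w : S → Matrix (Fin n) (Fin n) ℂ}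
    (hw : ∀ i j, Measurable fun α => w α i j) (ρ : Matrix (Fin n) (Fin n) ℂ) (r : ℕ) (ν : ℝ) :
    MeasurableSet (badSet w ρ r ν) := by
  have h1 : Measurable fun α => hsNormSq (projT ρ (w α)) :=
    measurable_hsInner (measurable_projT hw ρ) (measurable_projT hw ρ)
  have h2 : Measurable fun α => hsInner (w α) (sgn ρ) ^ 2 :=
    (measurable_hsInner (B := fun _ => sgn ρ) hw
      fun i j => measurable_const (a := sgn ρ i j)).pow_const 2
  have h3 : MeasurableSet {α | hsNormSq (projT ρ (w α)) ≤ 2 * ν * r / n} :=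
    measurableSet_le h1 measurable_const
  have h4 : MeasurableSet {α | hsInner (w α) (sgn ρ) ^ 2 ≤ ν * r / (n : ℝ) ^ 2} :=
    measurableSet_le h2 measurable_const
  have e : badSet w ρ r ν = {α | hsNormSq (projT ρ (w α)) ≤ 2 * ν * r / n}ᶜ ∪
      {α | hsInner (w α) (sgn ρ) ^ 2 ≤ ν * r / (n : ℝ) ^ 2}ᶜ := by
    ext α
    simp only [badSet, Set.mem_ofPred_eq, Set.mem_union, Set.mem_compl_iff, not_and_or]
  rw [e]
  exact h3.compl.union h4.compl

namespace IsTightFrame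

variable {μ : Measure S} {w : S → Matrix (Fin n) (Fin n) ℂ}

/-- The defining identity of a tight frame in weak form. -/
lemma integral_hsInner_mul (hw : IsTightFrame μ w) {σ τ : Matrix (Fin n) (Fin n) ℂ}
    (hσ : σ.IsHermitian) :
    Integrable (fun α => hsInner (w α) σ * hsInner (w α) τ) μ ∧
      ∫ α, hsInner (w α) σ * hsInner (w α) τ ∂μ = hsInner σ τ / (n : ℝ) ^ 2 := by
  have e : ∀ α, hsInner (w α) σ * hsInner (w α) τ = ∑ i, ∑ j,
      (Complex.reCLM ((hsInner (w α) σ • w α) i j) * (τ i j).re +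
        Complex.imCLM ((hsInner (w α) σ • w α) i j) * (τ i j).im) := by
    intro α
    rw [← hsInner_smul_left, hsInner_eq_sum]
    rfl
  have hre : ∀ i j, Integrable (fun α => Complex.reCLM ((hsInner (w α) σ • w α) i j)) μ :=
    fun i j => Complex.reCLM.integrable_comp (hw.integrable σ hσ i j)
  have him : ∀ i j, Integrable (fun α => Complex.imCLM ((hsInner (w α) σ • w α) i j)) μ :=
    fun i j => Complex.imCLM.integrable_comp (hw.integrable σ hσ i j)
  have hi : ∀ i j, Integrable (fun α => Complex.reCLM ((hsInner (w α) σ • w α) i j) * (τ i j).re +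
        Complex.imCLM ((hsInner (w α) σ • w α) i j) * (τ i j).im) μ := fun i j =>
    ((hre i j).mul_const _).add ((him i j).mul_const _)
  have hn : (n : ℂ) ^ 2 = (((n : ℝ) ^ 2 : ℝ) : ℂ) := by push_cast; rfl
  simp only [e]
  refine ⟨integrable_finsetSum _ fun i _ => integrable_finsetSum _ fun j _ => hi i j, ?_⟩
  rw [integral_finsetSum _ fun i _ => integrable_finsetSum _ fun j _ => hi i j, hsInner_eq_sum,
    Finset.sum_div]
  refine Finset.sum_congr rfl fun i _ => ?_
  rw [integral_finsetSum _ fun j _ => hi i j, Finset.sum_div]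
  refine Finset.sum_congr rfl fun j _ => ?_
  rw [integral_add ((hre i j).mul_const _) ((him i j).mul_const _), integral_mul_const,
    integral_mul_const, Complex.reCLM.integral_comp_comm (hw.integrable σ hσ i j),
    Complex.imCLM.integral_comp_comm (hw.integrable σ hσ i j), hw.integral_eq σ hσ, hn,
    Complex.reCLM_apply, Complex.imCLM_apply, Complex.div_ofReal_re, Complex.div_ofReal_im]
  ring

/-- The elements of a tight frame that violate an incoherence condition or exceed the bound on the
norm. -/
def exceptional (w : S → Matrix (Fin n) (Fin n) ℂ) (ρ : Matrix (Fin n) (Fin n) ℂ) (r : ℕ)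
    (ν K : ℝ) : Set S :=
  badSet w ρ r ν ∪ {α | K < hsNormSq (w α)}

lemma measurableSet_exceptional (hw : IsTightFrame μ w) (ρ : Matrix (Fin n) (Fin n) ℂ) (r : ℕ)
    (ν K : ℝ) : MeasurableSet (exceptional w ρ r ν K) :=
  (measurableSet_badSet hw.measurable ρ r ν).union
    (measurableSet_lt measurable_const (measurable_hsInner hw.measurable hw.measurable))

/-- The frame with its exceptional elements replaced by zero. -/
noncomputable def truncFrame (hw : IsTightFrame μ w) (ρ : Matrix (Fin n) (Fin n) ℂ) (r : ℕ)
    (ν K : ℝ) : S → HermMat n :=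
  (exceptional w ρ r ν K)ᶜ.indicator fun α => HermMat.ofMat (w α) (hw.hermitian α)

lemma inner_truncFrame (hw : IsTightFrame μ w) (ρ : Matrix (Fin n) (Fin n) ℂ) (r : ℕ)
    (ν K : ℝ) (α : S) (x : HermMat n) : inner ℝ (hw.truncFrame ρ r ν K α) x =
      (exceptional w ρ r ν K)ᶜ.indicator (fun α => hsInner (w α) x.toMat) α := by
  unfold truncFrame
  by_cases h : α ∈ (exceptional w ρ r ν K)ᶜ
  · rw [Set.indicator_of_mem h, Set.indicator_of_mem h]
    rfl
  · rw [Set.indicator_of_notMem h, Set.indicator_of_notMem h, inner_zero_left]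

lemma truncFrame_of_notMem (hw : IsTightFrame μ w) (ρ : Matrix (Fin n) (Fin n) ℂ) {r : ℕ}
    {ν K : ℝ} {α : S} (h : α ∉ exceptional w ρ r ν K) :
    hw.truncFrame ρ r ν K α = HermMat.ofMat (w α) (hw.hermitian α) :=
  Set.indicator_of_mem (s := (exceptional w ρ r ν K)ᶜ) h _

lemma truncFrame_of_mem (hw : IsTightFrame μ w) (ρ : Matrix (Fin n) (Fin n) ℂ) {r : ℕ}
    {ν K : ℝ} {α : S} (h : α ∈ exceptional w ρ r ν K) : hw.truncFrame ρ r ν K α = 0 :=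
  Set.indicator_of_notMem (s := (exceptional w ρ r ν K)ᶜ) (fun h' => h' h) _

/-- Without its exceptional elements, a tight frame is still close to a tight frame, provided that
they have small measure. -/
lemma isSamplingFrame_truncFrame [IsProbabilityMeasure μ] (hw : IsTightFrame μ w)
    (ρ : Matrix (Fin n) (Fin n) ℂ) (r : ℕ) {ν K : ℝ} (hn : 0 < n) (hν : 0 ≤ ν) (hK : 0 ≤ K)
    (hwK : ∀ᵐ α ∂μ, hsNormSq (w α) ≤ K) :
    IsSamplingFrame μ (hw.truncFrame ρ r ν K) (HermMat.proj ρ) ((n : ℝ) ^ 2) K (2 * ν * r / n)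
      ((n : ℝ) ^ 2 * K * μ.real (exceptional w ρ r ν K)) := by
  have hn' : (0 : ℝ) < n := by exact_mod_cast hn
  set E := exceptional w ρ r ν K with hE
  have hEm : MeasurableSet E := hw.measurableSet_exceptional ρ r ν K
  have hprod : ∀ (x y : HermMat n) (α : S), inner ℝ (hw.truncFrame ρ r ν K α) x *
      inner ℝ (hw.truncFrame ρ r ν K α) y =
      Eᶜ.indicator (fun α => hsInner (w α) x.toMat * hsInner (w α) y.toMat) α := by
    intro x y α
    rw [inner_truncFrame, inner_truncFrame, ← hE]
    by_cases h : α ∈ E <;> simp [h]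
  refine ⟨?_, HermMat.inner_proj_left ρ, HermMat.proj_proj ρ, by positivity, by positivity,
    by positivity, hK, ?_, ?_, ?_, ?_⟩
  · exact (HermMat.measurable_of_measurable_entries hw.measurable).indicator hEm.compl
  · intro α
    by_cases h : α ∈ E
    · rw [hw.truncFrame_of_mem ρ h]
      simpa using hK
    · rw [hw.truncFrame_of_notMem ρ h, HermMat.norm_sq_eq, HermMat.toMat_ofMat]
      by_contra h'
      exact h (Or.inr (not_le.mp h'))
  · intro α
    by_cases h : α ∈ E
    · rw [hw.truncFrame_of_mem ρ h, map_zero, norm_zero, zero_pow two_ne_zero]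
      positivity
    · rw [hw.truncFrame_of_notMem ρ h, HermMat.norm_sq_eq, HermMat.toMat_proj, HermMat.toMat_ofMat]
      by_contra h'
      exact h (Or.inl fun h'' => h' h''.1)
  · intro x y
    obtain ⟨hi, he⟩ := hw.integral_hsInner_mul (τ := y.toMat) x.toMat_isHermitian
    have hbd : ∀ᵐ α ∂μ, α ∈ E →
        ‖hsInner (w α) x.toMat * hsInner (w α) y.toMat‖ ≤ K * ‖x‖ * ‖y‖ := by
      filter_upwards [hwK] with α hα _
      have h1 : ‖HermMat.ofMat (w α) (hw.hermitian α)‖ ^ 2 ≤ K := by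
        rw [HermMat.norm_sq_eq]; exact hα
      rw [norm_mul]
      have h2 := norm_inner_le_norm (𝕜 := ℝ) (HermMat.ofMat (w α) (hw.hermitian α)) x
      have h3 := norm_inner_le_norm (𝕜 := ℝ) (HermMat.ofMat (w α) (hw.hermitian α)) y
      calc _ ≤ (‖HermMat.ofMat (w α) (hw.hermitian α)‖ * ‖x‖) *
            (‖HermMat.ofMat (w α) (hw.hermitian α)‖ * ‖y‖) :=
            mul_le_mul h2 h3 (norm_nonneg _) (by positivity)
        _ = ‖HermMat.ofMat (w α) (hw.hermitian α)‖ ^ 2 * ‖x‖ * ‖y‖ := by ring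
        _ ≤ _ := by gcongr
    have h4 := norm_setIntegral_le_of_norm_le_const_ae' (measure_lt_top μ E) hbd
    have h5 : ∫ α, inner ℝ (hw.truncFrame ρ r ν K α) x *
        inner ℝ (hw.truncFrame ρ r ν K α) y ∂μ = hsInner x.toMat y.toMat / (n : ℝ) ^ 2 -
        ∫ α in E, hsInner (w α) x.toMat * hsInner (w α) y.toMat ∂μ := by
      simp only [hprod]
      rw [integral_indicator hEm.compl, ← he, ← integral_add_compl hEm hi]
      ring
    rw [h5, HermMat.inner_eq, mul_sub, mul_div_cancel₀ _ (by positivity), sub_sub_cancel_left,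
      abs_neg, abs_mul, abs_of_nonneg (by positivity : (0 : ℝ) ≤ (n : ℝ) ^ 2)]
    rw [Real.norm_eq_abs] at h4
    calc _ ≤ (n : ℝ) ^ 2 * (K * ‖x‖ * ‖y‖ * μ.real E) := by gcongr
      _ = _ := by ring
  · intro x
    obtain ⟨hi, he⟩ := hw.integral_hsInner_mul (τ := x.toMat) x.toMat_isHermitian
    have h1 : ∫ α, inner ℝ (hw.truncFrame ρ r ν K α) x ^ 2 ∂μ ≤
        hsInner x.toMat x.toMat / (n : ℝ) ^ 2 := by
      rw [← he]
      simp only [sq, hprod]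
      refine integral_mono_of_nonneg (ae_of_all _ fun α => ?_) hi (ae_of_all _ fun α => ?_)
      · exact Set.indicator_nonneg (fun α _ => mul_self_nonneg _) α
      · exact Set.indicator_le_self' (fun α _ => mul_self_nonneg _) α
    rw [HermMat.norm_sq_eq, hsNormSq]
    calc _ ≤ (n : ℝ) ^ 2 * (hsInner x.toMat x.toMat / (n : ℝ) ^ 2) := by gcongr
      _ = _ := by field_simp

end IsTightFrame
end FrameTruncation

/-! ### Trace norm, duality and the certificate criterion -/

section DualCertificate

variable {n : ℕ}

section FunctionalCalculus

open scoped MatrixOrder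

lemma continuousOn_spectrum (f : ℝ → ℝ) (A : Matrix (Fin n) (Fin n) ℂ) :
    ContinuousOn f (spectrum ℝ A) :=
  A.finite_real_spectrum.continuousOn f

lemma continuousOn_image_spectrum (f g : ℝ → ℝ) (A : Matrix (Fin n) (Fin n) ℂ) :
    ContinuousOn f (g '' spectrum ℝ A) :=
  (A.finite_real_spectrum.image g).continuousOn f

lemma cfc_mul_matrix (f g : ℝ → ℝ) (A : Matrix (Fin n) (Fin n) ℂ) :
    cfc (fun x => f x * g x) A = cfc f A * cfc g A :=
  cfc_mul f g A (continuousOn_spectrum f A) (continuousOn_spectrum g A)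

lemma spectrum_nonneg {A : Matrix (Fin n) (Fin n) ℂ} (hA : A.PosSemidef) {x : ℝ}
    (hx : x ∈ spectrum ℝ A) : 0 ≤ x := by
  rw [hA.1.spectrum_real_eq_range_eigenvalues] at hx
  obtain ⟨i, rfl⟩ := hx
  exact hA.eigenvalues_nonneg i

lemma trace_cfc {A : Matrix (Fin n) (Fin n) ℂ} (hA : A.IsHermitian) (f : ℝ → ℝ) :
    (cfc f A).trace = ∑ i, (f (hA.eigenvalues i) : ℂ) := by
  rw [hA.cfc_eq f, IsHermitian.cfc, Unitary.conjStarAlgAut_apply, Matrix.trace_mul_comm,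
    ← mul_assoc]
  simp [Matrix.trace_diagonal]

/-- The trace norm of a Hermitian matrix is the trace of its absolute value. -/
lemma traceNorm_eq {A : Matrix (Fin n) (Fin n) ℂ} (hA : A.IsHermitian) :
    traceNorm A = (cfc (fun x : ℝ => |x|) A).trace.re := by
  have hA' : IsSelfAdjoint A := hA
  have h1 : Aᴴ * A = cfc (fun x : ℝ => x * x) A := by
    rw [cfc_mul_matrix, cfc_id' ℝ A hA', hA.eq]
  rw [traceNorm, h1, ← cfc_comp' Real.sqrt (fun x : ℝ => x * x) A
    (continuousOn_image_spectrum _ _ A) (continuousOn_spectrum _ A) hA']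
  simp only [Real.sqrt_mul_self_eq_abs]

lemma traceNorm_of_posSemidef {A : Matrix (Fin n) (Fin n) ℂ} (hA : A.PosSemidef) :
    traceNorm A = A.trace.re := by
  have hA' : IsSelfAdjoint A := hA.1
  rw [traceNorm_eq hA.1,
    cfc_congr (g := fun x => x) fun x hx => abs_of_nonneg (spectrum_nonneg hA hx), cfc_id' ℝ A hA']

/-- Duality between the operator norm and the trace norm, with the bound `‖M‖ ≤ 1` expressed as
`-1 ≤ M ≤ 1`. -/
lemma hsInner_le_traceNorm {M A : Matrix (Fin n) (Fin n) ℂ} (hA : A.IsHermitian)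
    (h1 : (1 - M).PosSemidef) (h2 : (1 + M).PosSemidef) : hsInner M A ≤ traceNorm A := by
  have hA' : IsSelfAdjoint A := hA
  have hM : M.IsHermitian := by
    have := h2.1.sub isHermitian_one
    rwa [add_sub_cancel_left] at this
  -- positive and negative part of `A`
  set p := cfc (fun x : ℝ => max x 0) A with hp
  set q := cfc (fun x : ℝ => max (-x) 0) A with hq
  have hp0 : p.PosSemidef := nonneg_iff_posSemidef.mp (cfc_nonneg fun x _ => le_max_right _ _)
  have hq0 : q.PosSemidef := nonneg_iff_posSemidef.mp (cfc_nonneg fun x _ => le_max_right _ _)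
  have e1 : p - q = A := by
    rw [hp, hq, ← cfc_sub _ _ A (continuousOn_spectrum _ A) (continuousOn_spectrum _ A)]
    conv_rhs => rw [← cfc_id' ℝ A hA']
    congr 1
    ext x
    rcases le_total x 0 with hx | hx
    · rw [max_eq_right hx, max_eq_left (by linarith)]
      ring
    · rw [max_eq_left hx, max_eq_right (by linarith)]
      ring
  have e2 : p + q = cfc (fun x : ℝ => |x|) A := by
    rw [hp, hq, ← cfc_add A _ _ (continuousOn_spectrum _ A) (continuousOn_spectrum _ A)]
    congr 1
    ext x
    rcases le_total x 0 with hx | hx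
    · rw [max_eq_right hx, max_eq_left (by linarith), abs_of_nonpos hx]
      ring
    · rw [max_eq_left hx, max_eq_right (by linarith), abs_of_nonneg hx]
      ring
  have h3 := trace_mul_re_nonneg h1 hp0
  have h4 := trace_mul_re_nonneg h2 hq0
  rw [traceNorm_eq hA, ← e2, hsInner, hM.eq]
  conv_lhs => rw [← e1]
  rw [sub_mul, one_mul, Matrix.trace_sub, Complex.sub_re] at h3
  rw [add_mul, one_mul, Matrix.trace_add, Complex.add_re] at h4
  rw [mul_sub, Matrix.trace_sub, Complex.sub_re, Matrix.trace_add, Complex.add_re]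
  linarith

lemma mul_kerProj (ρ : Matrix (Fin n) (Fin n) ℂ) : ρ * kerProj ρ = 0 := by
  apply EquivLike.injective (Matrix.toEuclideanCLM (n := Fin n) (𝕜 := ℂ))
  rw [map_mul, map_zero]
  unfold kerProj
  rw [StarAlgEquiv.apply_symm_apply]
  ext1 x
  exact LinearMap.mem_ker.mp (Submodule.starProjection_apply_mem
    (LinearMap.ker (Matrix.toEuclideanCLM (n := Fin n) (𝕜 := ℂ) ρ).toLinearMap) x)

lemma kerProj_mul {ρ : Matrix (Fin n) (Fin n) ℂ} (hρ : ρ.IsHermitian) : kerProj ρ * ρ = 0 := by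
  have h := congrArg conjTranspose (mul_kerProj ρ)
  rwa [conjTranspose_mul, hρ.eq, (kerProj_isHermitian ρ).eq, conjTranspose_zero] at h

/-- A matrix whose columns lie in the kernel of `ρ` is fixed by the projection onto that kernel. -/
lemma kerProj_mul_of_mul_eq_zero {ρ A : Matrix (Fin n) (Fin n) ℂ} (h : ρ * A = 0) :
    kerProj ρ * A = A := by
  apply EquivLike.injective (Matrix.toEuclideanCLM (n := Fin n) (𝕜 := ℂ))
  have h' := congrArg (Matrix.toEuclideanCLM (n := Fin n) (𝕜 := ℂ)) h
  rw [map_mul, map_zero] at h'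
  rw [map_mul]
  unfold kerProj
  rw [StarAlgEquiv.apply_symm_apply]
  ext1 x
  refine Submodule.starProjection_eq_self_iff.mpr (LinearMap.mem_ker.mpr ?_)
  exact congrArg (fun f => f x) h'

/-- `sgn ρ = ρ ρ⁻¹`, with the inverse taken on the nonzero eigenvalues, is the projection onto the
support of `ρ`. -/
lemma sgn_eq {ρ : Matrix (Fin n) (Fin n) ℂ} (hρ : ρ.PosSemidef) : sgn ρ = 1 - kerProj ρ := by
  have hρ' : IsSelfAdjoint ρ := hρ.1
  have e1 : sgn ρ = ρ * cfc (fun x : ℝ => x⁻¹) ρ := by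
    calc sgn ρ = cfc (fun x : ℝ => x * x⁻¹) ρ := by
          refine cfc_congr fun x hx => ?_
          rcases (spectrum_nonneg hρ hx).eq_or_lt with h | h
          · simp [← h]
          · simp [Real.sign_of_pos h, h.ne']
      _ = cfc (fun x : ℝ => x) ρ * cfc (fun x : ℝ => x⁻¹) ρ := cfc_mul_matrix _ _ _
      _ = _ := by rw [cfc_id' ℝ ρ hρ']
  have e2 : ρ * sgn ρ = ρ := by
    calc ρ * sgn ρ = cfc (fun x : ℝ => x) ρ * cfc Real.sign ρ := by rw [cfc_id' ℝ ρ hρ', sgn]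
      _ = cfc (fun x : ℝ => x * Real.sign x) ρ := (cfc_mul_matrix _ _ _).symm
      _ = cfc (fun x : ℝ => x) ρ := by
          refine cfc_congr fun x hx => ?_
          rcases (spectrum_nonneg hρ hx).eq_or_lt with h | h
          · simp [← h]
          · simp [Real.sign_of_pos h]
      _ = ρ := cfc_id' ℝ ρ hρ'
  have h1 : kerProj ρ * (1 - sgn ρ) = 1 - sgn ρ :=
    kerProj_mul_of_mul_eq_zero (by rw [mul_sub, e2, mul_one, sub_self])
  rw [mul_sub, mul_one, e1, ← mul_assoc, kerProj_mul hρ.1, zero_mul, sub_zero, ← e1] at h1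
  rw [h1, sub_sub_cancel]

lemma trace_sgn {ρ : Matrix (Fin n) (Fin n) ℂ} (hρ : ρ.PosSemidef) :
    (sgn ρ).trace.re = ρ.rank := by
  rw [sgn, trace_cfc hρ.1, hρ.1.rank_eq_card_non_zero_eigs, Complex.re_sum, Fintype.card_subtype,
    Finset.card_filter]
  push_cast
  refine Finset.sum_congr rfl fun i _ => ?_
  rcases (hρ.eigenvalues_nonneg i).eq_or_lt with h | h
  · simp [← h]
  · simp [Real.sign_of_pos h, h.ne']

end FunctionalCalculus

lemma isHermitian_one_sub_kerProj (ρ : Matrix (Fin n) (Fin n) ℂ) : (1 - kerProj ρ).IsHermitian :=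
  isHermitian_one.sub (kerProj_isHermitian ρ)

lemma one_sub_kerProj_mul_self (ρ : Matrix (Fin n) (Fin n) ℂ) :
    (1 - kerProj ρ) * (1 - kerProj ρ) = 1 - kerProj ρ := by
  rw [mul_sub, mul_one, sub_mul, one_mul, kerProj_mul_self, sub_self, sub_zero]

lemma posSemidef_one_sub_kerProj (ρ : Matrix (Fin n) (Fin n) ℂ) :
    (1 - kerProj ρ).PosSemidef := by
  have h := posSemidef_conjTranspose_mul_self (1 - kerProj ρ)
  rwa [(isHermitian_one_sub_kerProj ρ).eq, one_sub_kerProj_mul_self] at h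

/-- The projection onto the support of `ρ`; for a state, this is `sgn ρ`. -/
noncomputable def support (ρ : Matrix (Fin n) (Fin n) ℂ) : HermMat n :=
  HermMat.ofMat (1 - kerProj ρ) (isHermitian_one_sub_kerProj ρ)

lemma toMat_support {ρ : Matrix (Fin n) (Fin n) ℂ} (hρ : ρ.PosSemidef) :
    (support ρ).toMat = sgn ρ := (sgn_eq hρ).symm

lemma compress_support (ρ : Matrix (Fin n) (Fin n) ℂ) : HermMat.compress ρ (support ρ) = 0 := by
  rw [HermMat.compress_apply, support, HermMat.toMat_ofMat, mul_sub, mul_one, kerProj_mul_self,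
    sub_self, zero_mul]

lemma proj_support (ρ : Matrix (Fin n) (Fin n) ℂ) : HermMat.proj ρ (support ρ) = support ρ := by
  have h : support ρ - HermMat.proj ρ (support ρ) = 0 := by
    apply HermMat.toMat_injective
    rw [← HermMat.compress_eq, compress_support, map_zero]
  exact (sub_eq_zero.mp h).symm

lemma norm_support_sq {ρ : Matrix (Fin n) (Fin n) ℂ} (hρ : ρ.PosSemidef) :
    ‖support ρ‖ ^ 2 = ρ.rank := by
  rw [HermMat.norm_sq_eq, hsNormSq, hsInner, (support ρ).toMat_isHermitian.eq]
  have : (support ρ).toMat * (support ρ).toMat = (support ρ).toMat := one_sub_kerProj_mul_self ρ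
  rw [this, toMat_support hρ, trace_sgn hρ]

open scoped Matrix.Norms.L2Operator MatrixOrder in
lemma posSemidef_one_sub_of_norm_le_one {W : Matrix (Fin n) (Fin n) ℂ} (hW : W.IsHermitian)
    (h : ‖W‖ ≤ 1) : (1 - W).PosSemidef := by
  have hW' : IsSelfAdjoint W := hW
  have h1 : W ≤ algebraMap ℝ _ ‖W‖ := hW'.le_algebraMap_norm_self
  have h2 : algebraMap ℝ (Matrix (Fin n) (Fin n) ℂ) ‖W‖ ≤ algebraMap ℝ _ 1 := algebraMap_mono _ h
  have h3 := h1.trans h2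
  rw [map_one] at h3
  exact Matrix.le_iff.mp h3

open scoped Matrix.Norms.L2Operator in
/-- A Hermitian contraction that lives on the kernel of `ρ` is at most the projection onto that
kernel. -/
lemma posSemidef_kerProj_sub {ρ W : Matrix (Fin n) (Fin n) ℂ} (hW : W.IsHermitian)
    (h : ‖W‖ ≤ 1) (hp : kerProj ρ * W * kerProj ρ = W) : (kerProj ρ - W).PosSemidef := by
  have h1 := (posSemidef_one_sub_of_norm_le_one hW h).conjTranspose_mul_mul_same (kerProj ρ)
  rwa [(kerProj_isHermitian ρ).eq, mul_sub, sub_mul, mul_one, kerProj_mul_self, hp] at h1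

open scoped Matrix.Norms.L2Operator in
/-- An approximate dual certificate excludes every perturbation that does not increase the trace
norm. The subgradient of the trace norm used here is the certificate on the kernel of `ρ`, plus
half of the normalized perturbation on the kernel, plus the identity on the support. -/
lemma eq_zero_of_traceNorm_add_le {ρ : Matrix (Fin n) (Fin n) ℂ} (hρ : IsState ρ)
    {d y x : HermMat n} {B : ℝ} (hyd : inner ℝ y d = 0)
    (hy : HermMat.proj ρ y = support ρ - x) (hx : HermMat.proj ρ x = x)
    (hc : ‖HermMat.compress ρ y‖ ≤ 1 / 2)
    (hd : ‖HermMat.proj ρ d‖ ^ 2 ≤ 4 * B * ‖d - HermMat.proj ρ d‖ ^ 2)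
    (hxB : 16 * (B * ‖x‖ ^ 2) < 1) (ht : traceNorm (ρ + d.toMat) ≤ 1) : d = 0 := by
  set e := d - HermMat.proj ρ d with he
  by_cases he0 : e = 0
  · rw [he0, norm_zero] at hd
    have h1 : ‖HermMat.proj ρ d‖ = 0 := by
      have := sq_nonneg ‖HermMat.proj ρ d‖
      exact pow_eq_zero_iff two_ne_zero |>.mp (le_antisymm (by simpa using hd) this)
    have h2 : d = e + HermMat.proj ρ d := by rw [he]; abel
    rw [h2, he0, norm_eq_zero.mp h1, add_zero]
  exfalso
  have hen : 0 < ‖e‖ := norm_pos_iff.mpr he0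
  have hPe : HermMat.proj ρ e = 0 := by rw [he, map_sub, HermMat.proj_proj, sub_self]
  have hee : HermMat.compress ρ e = e.toMat := by
    rw [HermMat.compress_eq, hPe, sub_zero]
  let b : HermMat n := (y - HermMat.proj ρ y) + (1 / (2 * ‖e‖)) • e
  have hPb : HermMat.proj ρ b = 0 := by
    simp only [b]
    rw [map_add, map_sub, HermMat.proj_proj, sub_self, map_smul, hPe, smul_zero, add_zero]
  have hbW : kerProj ρ * b.toMat * kerProj ρ = b.toMat := by
    rw [← HermMat.compress_apply, HermMat.compress_eq, hPb, sub_zero]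
  have hbH := b.toMat_isHermitian
  have hbn : ‖b.toMat‖ ≤ 1 := by
    simp only [b]
    rw [map_add, ← HermMat.compress_eq, map_smul]
    have h1 : ‖(1 / (2 * ‖e‖)) • e.toMat‖ ≤ 1 / 2 := by
      rw [norm_smul, Real.norm_of_nonneg (by positivity)]
      calc _ ≤ 1 / (2 * ‖e‖) * ‖e‖ := by gcongr; exact HermMat.norm_toMat_le e
        _ = 1 / 2 := by field_simp
    exact (norm_add_le _ _).trans (by linarith)
  let M : HermMat n := support ρ + b
  have hM1 : (1 - M.toMat).PosSemidef := by
    have h1 : 1 - M.toMat = kerProj ρ - b.toMat := by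
      simp only [M, map_add, support, HermMat.toMat_ofMat]
      abel
    rw [h1]
    exact posSemidef_kerProj_sub hbH hbn hbW
  have hM2 : (1 + M.toMat).PosSemidef := by
    have h1 : 1 + M.toMat = (1 - kerProj ρ) + (1 - kerProj ρ) + (kerProj ρ - -b.toMat) := by
      simp only [M, map_add, support, HermMat.toMat_ofMat]
      abel
    rw [h1]
    refine ((posSemidef_one_sub_kerProj ρ).add (posSemidef_one_sub_kerProj ρ)).add
      (posSemidef_kerProj_sub hbH.neg (by rwa [norm_neg]) ?_)
    rw [mul_neg, neg_mul, hbW]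
  have hle := (hsInner_le_traceNorm (hρ.1.1.add d.toMat_isHermitian) hM1 hM2).trans ht
  have h1 : hsInner M.toMat ρ = 1 := by
    rw [hsInner, M.toMat_isHermitian.eq]
    simp only [M, map_add, support, HermMat.toMat_ofMat]
    rw [← hbW, add_mul, sub_mul, one_mul, mul_assoc _ (kerProj ρ) ρ, kerProj_mul hρ.1.1, mul_zero,
      sub_zero, add_zero, hρ.2, Complex.one_re]
  have h2 : hsInner M.toMat d.toMat = inner ℝ x d + ‖e‖ / 2 := by
    have h3 : M = y + x + (1 / (2 * ‖e‖)) • e := by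
      simp only [M, b]
      rw [hy]
      abel
    have h4 : inner ℝ e d = ‖e‖ ^ 2 := by
      have : d = e + HermMat.proj ρ d := by rw [he]; abel
      conv_lhs => rw [this]
      rw [inner_add_right, ← HermMat.inner_proj_left, hPe, inner_zero_left, add_zero,
        real_inner_self_eq_norm_sq]
    rw [← HermMat.inner_eq, h3, inner_add_left, inner_add_left, hyd, real_inner_smul_left, h4]
    field_simp
    ring
  rw [hsInner_add_right, h1, h2] at hle
  have h5 : inner ℝ x d = inner ℝ x (HermMat.proj ρ d) := by
    rw [← HermMat.inner_proj_left, hx]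
  have h6 := abs_real_inner_le_norm x (HermMat.proj ρ d)
  rw [← h5] at h6
  have h7 : ‖x‖ * ‖HermMat.proj ρ d‖ < ‖e‖ / 2 := by
    refine lt_of_pow_lt_pow_left₀ 2 (by positivity) ?_
    calc (‖x‖ * ‖HermMat.proj ρ d‖) ^ 2 = ‖x‖ ^ 2 * ‖HermMat.proj ρ d‖ ^ 2 := by ring
      _ ≤ ‖x‖ ^ 2 * (4 * B * ‖e‖ ^ 2) := by gcongr
      _ = 16 * (B * ‖x‖ ^ 2) * (‖e‖ ^ 2 / 4) := by ring
      _ < 1 * (‖e‖ ^ 2 / 4) := by gcongr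
      _ = _ := by ring
  linarith [neg_le_of_abs_le h6]

lemma samplingOp_sub {m : ℕ} (w : Fin m → Matrix (Fin n) (Fin n) ℂ)
    (σ τ : Matrix (Fin n) (Fin n) ℂ) :
    samplingOp w (σ - τ) = samplingOp w σ - samplingOp w τ := by
  simp only [samplingOp, hsInner_sub_right, sub_smul, Finset.sum_sub_distrib, smul_sub]

/-- The kernel of the sampling operator is the orthogonal complement of the observables. -/
lemma hsInner_eq_zero_of_samplingOp_eq_zero {m : ℕ} (hn : 0 < n)
    {w : Fin m → Matrix (Fin n) (Fin n) ℂ} {σ : Matrix (Fin n) (Fin n) ℂ} (h : samplingOp w σ = 0)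
    (i : Fin m) : hsInner (w i) σ = 0 := by
  have hm : 0 < m := i.pos
  have hc : (n : ℝ) ^ 2 / m ≠ 0 := by
    have : (0 : ℝ) < n := by exact_mod_cast hn
    have : (0 : ℝ) < m := by exact_mod_cast hm
    positivity
  rw [samplingOp] at h
  have h1 := (smul_eq_zero.mp h).resolve_left hc
  have h2 : ∑ j, hsInner (w j) σ ^ 2 = hsInner (∑ j, hsInner (w j) σ • w j) σ := by
    have h3 : ∀ s : Finset (Fin m), hsInner (∑ j ∈ s, hsInner (w j) σ • w j) σ =
        ∑ j ∈ s, hsInner (w j) σ ^ 2 := by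
      intro s
      induction s using Finset.induction_on with
      | empty => simp [hsInner]
      | insert a s ha ih =>
        rw [Finset.sum_insert ha, Finset.sum_insert ha, hsInner_add_left, ih, hsInner_smul_left, sq]
    exact (h3 _).symm
  rw [h1] at h2
  have h4 : ∑ j, hsInner (w j) σ ^ 2 = 0 := by rw [h2]; simp [hsInner]
  have h5 := (Finset.sum_eq_zero_iff_of_nonneg fun j _ => sq_nonneg (hsInner (w j) σ)).mp h4 i
    (Finset.mem_univ i)
  exact pow_eq_zero_iff two_ne_zero |>.mp h5

/-- A state is the unique solution as soon as no nonzero perturbation in the kernel of the sampling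
operator keeps the trace norm at most one. -/
lemma solutions_eq_singleton {m : ℕ} (hn : 0 < n) {w : Fin m → Matrix (Fin n) (Fin n) ℂ}
    {ρ : Matrix (Fin n) (Fin n) ℂ} (hρ : IsState ρ)
    (h : ∀ d : HermMat n, (∀ i, hsInner (w i) d.toMat = 0) → traceNorm (ρ + d.toMat) ≤ 1 → d = 0) :
    solutions w ρ = {ρ} := by
  have hρ1 : traceNorm ρ = 1 := by rw [traceNorm_of_posSemidef hρ.1, hρ.2, Complex.one_re]
  have key : ∀ σ ∈ feasible w ρ, traceNorm σ ≤ 1 → σ = ρ := by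
    rintro σ ⟨hσ, hσ'⟩ ht
    have h0 : samplingOp w (σ - ρ) = 0 := by rw [samplingOp_sub, hσ', sub_self]
    have h1 := h (HermMat.ofMat (σ - ρ) (hσ.sub hρ.1.1))
      (hsInner_eq_zero_of_samplingOp_eq_zero hn h0) (by rwa [HermMat.toMat_ofMat, add_sub_cancel])
    have h2 := congrArg HermMat.toMat h1
    rw [HermMat.toMat_ofMat, map_zero] at h2
    exact sub_eq_zero.mp h2
  have hmem : ρ ∈ feasible w ρ := ⟨hρ.1.1, rfl⟩
  ext σ
  rw [Set.mem_singleton_iff]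
  refine ⟨fun hσ => key σ hσ.1 (hρ1 ▸ hσ.2 ρ hmem), ?_⟩
  rintro rfl
  refine ⟨hmem, fun τ hτ => ?_⟩
  by_contra hlt
  rw [not_le, hρ1] at hlt
  rw [key τ hτ hlt.le, hρ1] at hlt
  exact lt_irrefl _ hlt

end DualCertificate

/-! ### Failure probability for explicit parameters -/

section FailureProbability

/-- Evaluating independent samples along an injection gives independent samples. -/
lemma measurePreserving_comp_injective {ι κ S : Type*} [Fintype ι] [Fintype κ] [MeasurableSpace S]
    (μ : Measure S) [IsProbabilityMeasure μ] {f : κ → ι} (hf : Function.Injective f) :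
    MeasurePreserving (fun (s : ι → S) (p : κ) => s (f p)) (Measure.pi fun _ => μ)
      (Measure.pi fun _ => μ) := by
  have hm : Measurable fun (s : ι → S) (p : κ) => s (f p) :=
    measurable_pi_lambda _ fun p => measurable_pi_apply (f p)
  refine ⟨hm, (Measure.pi_eq fun t ht => ?_).symm⟩
  rw [Measure.map_apply hm (MeasurableSet.univ_pi ht)]
  have h1 : (fun (s : ι → S) (p : κ) => s (f p)) ⁻¹' Set.univ.pi t =
      Set.univ.pi (Function.extend f t fun _ => Set.univ) := by
    ext s
    simp only [Set.mem_preimage, Set.mem_pi, Set.mem_univ, true_imp_iff]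
    constructor
    · intro h j
      by_cases hj : ∃ p, f p = j
      · obtain ⟨p, rfl⟩ := hj
        rw [hf.extend_apply]
        exact h p
      · rw [Function.extend_apply' _ _ _ hj]
        trivial
    · intro h p
      have := h (f p)
      rwa [hf.extend_apply] at this
  rw [h1, Measure.pi_pi]
  refine (Fintype.prod_of_injective f hf _ _ (fun j hj => ?_) fun p => ?_).symm
  · rw [Function.extend_apply' _ _ _ hj, measure_univ]
  · rw [hf.extend_apply]

/-- Splitting independent samples into independent batches, dropping the remainder. -/
lemma exists_batches {S : Type*} [MeasurableSpace S] (μ : Measure S) [IsProbabilityMeasure μ]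
    {l k m : ℕ} (h : l * k ≤ m) : ∃ f : Fin l → Fin k → Fin m,
      MeasurePreserving (fun (s : Fin m → S) i j => s (f i j)) (Measure.pi fun _ => μ)
        (Measure.pi fun _ : Fin l => Measure.pi fun _ : Fin k => μ) := by
  let e : Fin l × Fin k → Fin m := fun p => Fin.castLE h (finProdFinEquiv p)
  have he : Function.Injective e := fun p q hpq =>
    finProdFinEquiv.injective (Fin.castLE_injective h hpq)
  refine ⟨fun i j => e (i, j), ?_⟩
  have h1 := measurePreserving_comp_injective μ he
  have h2 : MeasurePreserving (MeasurableEquiv.curry (Fin l) (Fin k) S)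
      (Measure.pi fun _ => μ) (Measure.pi fun _ : Fin l => Measure.pi fun _ : Fin k => μ) := by
    refine ⟨(MeasurableEquiv.curry (Fin l) (Fin k) S).measurable, ?_⟩
    have h3 := Measure.infinitePi_map_curry (ι := Fin l) (κ := Fin k) (fun _ _ => μ)
    simpa only [Measure.infinitePi_eq_pi] using h3
  exact h2.comp h1

lemma measure_exists_mem_le {S : Type*} [MeasurableSpace S] (μ : Measure S)
    [IsProbabilityMeasure μ] (m : ℕ) (E : Set S) :
    (Measure.pi fun _ : Fin m => μ) {s | ∃ i, s i ∈ E} ≤ m * μ E := by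
  have h1 : {s : Fin m → S | ∃ i, s i ∈ E} = ⋃ i, (fun s : Fin m → S => s i) ⁻¹' E := by
    ext s
    simp
  rw [h1]
  refine (measure_iUnion_le _).trans ?_
  rw [tsum_fintype]
  refine (Finset.sum_le_sum fun i _ =>
    (measurePreserving_eval (fun _ : Fin m => μ) i).measure_preimage_le E).trans ?_
  simp

lemma IsSamplingFrame.mono {V S : Type*} [NormedAddCommGroup V] [InnerProductSpace ℝ V]
    [MeasurableSpace V] [MeasurableSpace S] {μ : Measure S} {u : S → V} {P : V →ₗ[ℝ] V}
    {N K τ ε ε' : ℝ} (h : IsSamplingFrame μ u P N K τ ε) (hε : ε ≤ ε') :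
    IsSamplingFrame μ u P N K τ ε' where
  meas := h.meas
  symm := h.symm
  idem := h.idem
  N_pos := h.N_pos
  ε_nonneg := h.ε_nonneg.trans hε
  τ_nonneg := h.τ_nonneg
  K_nonneg := h.K_nonneg
  norm_le := h.norm_le
  proj_le := h.proj_le
  approx x y := (h.approx x y).trans (by gcongr)
  second := h.second

open scoped Matrix.Norms.L2Operator

variable {n : ℕ} {S : Type*} [MeasurableSpace S] {μ : Measure S} [IsProbabilityMeasure μ]
  {w : S → Matrix (Fin n) (Fin n) ℂ} {ρ : Matrix (Fin n) (Fin n) ℂ}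

/-- The failure probability for explicit parameters: `l` batches of `k` samples, overlap bound `β`
with exceptional mass `δ`, failure probability `η` of one golfing step, and near-tightness `ε`. -/
theorem failureProb_lt_half_of_parameters (hw : IsTightFrame μ w) (hρ : IsState ρ) {r m l k t : ℕ}
    (hrank : ρ.rank = r) (hn : 0 < n) (hr : 0 < r) {ν K β δ η a ε : ℝ} (hν : 0 < ν) (hK : 0 ≤ K)
    (hwK : ∀ᵐ α ∂μ, hsNormSq (w α) ≤ K) (hk : 0 < k) (hlk : l * k ≤ m)
    (hE : m * μ.real (IsTightFrame.exceptional w ρ r ν K) ≤ 1 / 16)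
    (hε : (n : ℝ) ^ 2 * K * μ.real (IsTightFrame.exceptional w ρ r ν K) ≤ ε)
    (hβ : β = √(ν * r) / n) (hδ : 0 < δ) (ha : 0 < a) (hη : l * η ≤ 1 / 8) (hη1 : η ≤ 1)
    (hak : (n : ℝ) ^ 2 * (2 * ν * r / n) / k ≤ a)
    (hθ : 16 * (2 * (n : ℝ) ^ 2 * ε ^ 2 + (n : ℝ) ^ 2 * (2 * ν * r / n) / k) ≤ η)
    (hkδ : 4 * (k * δ) ≤ η) (htail : 8 * Real.exp (-(1 / (64 * a))) ≤ δ * η)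
    (hbias : 4 * ((ε + (n : ℝ) ^ 2 * K * δ) * √(K * r)) ≤ β)
    (hbias' : 8 * ((ε + (n : ℝ) ^ 2 * K * δ) * √r) ≤ 1) (ht : n ≤ 2 ^ 2 ^ t)
    (hvar : 4096 * ((4 * 2 ^ t) * (4 * n * (n : ℝ) ^ 2 * β ^ 2 / k +
      4 * (4 * 2 ^ t) * (((n : ℝ) ^ 2) ^ 2 * β ^ 2 * K / k ^ 2))) ≤ η ^ 2)
    (hl : 256 * (n : ℝ) ^ 2 ≤ 4 ^ l)
    (hl' : 16 * (256 * (n : ℝ) ^ 2 * ((n : ℝ) ^ 2 * K) ^ 2 * r) < 4 ^ l) :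
    failureProb μ w ρ m < 1 / 2 := by
  have hn' : (0 : ℝ) < n := by exact_mod_cast hn
  have hr' : (0 : ℝ) < r := by exact_mod_cast hr
  have hk' : (0 : ℝ) < k := by exact_mod_cast hk
  have hβ0 : 0 < β := by rw [hβ]; positivity
  have hη0 : 0 ≤ η := le_trans (by positivity) hkδ
  set E := IsTightFrame.exceptional w ρ r ν K with hEdef
  have hf := (hw.isSamplingFrame_truncFrame ρ r hn hν.le hK hwK).mono hε
  set u := hw.truncFrame ρ r ν K with hu
  have hu0 : ∀ α ∈ E, u α = 0 := fun α hα => hw.truncFrame_of_mem ρ hα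
  have hu1 : ∀ α, α ∉ E → u α = HermMat.ofMat (w α) (hw.hermitian α) := fun α hα =>
    hw.truncFrame_of_notMem ρ hα
  set N : ℝ := (n : ℝ) ^ 2 with hN
  have hε0 := hf.ε_nonneg
  have hfin : (Module.finrank ℝ (HermMat n) : ℝ) ≤ 2 * (n : ℝ) ^ 2 := by
    exact_mod_cast HermMat.finrank_le
  have hθ' : 16 * (Module.finrank ℝ (HermMat n) * ε ^ 2 + N * (2 * ν * r / n) / k) ≤ η := by
    refine le_trans ?_ hθ
    gcongr
  set B₀ : ℝ := 256 * (n : ℝ) ^ 2 * (N * K) ^ 2 with hB₀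
  have hB₀0 : 0 ≤ B₀ := by positivity
  -- a positive constant slightly above the bound still satisfies the strict inequality
  obtain ⟨B, hB, hB0, hBl⟩ : ∃ B, B₀ ≤ B ∧ 0 < B ∧ 16 * (B * r) < 4 ^ l := by
    refine ⟨B₀ + (4 ^ l - 16 * (B₀ * r)) / (32 * r), ?_, ?_, ?_⟩
    · have : 0 < (4 ^ l - 16 * (B₀ * r)) / (32 * r) := div_pos (by linarith) (by positivity)
      linarith
    · have : 0 < (4 ^ l - 16 * (B₀ * r)) / (32 * r) := div_pos (by linarith) (by positivity)
      linarith
    · have : (B₀ + (4 ^ l - 16 * (B₀ * r)) / (32 * r)) * r =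
          B₀ * r + (4 ^ l - 16 * (B₀ * r)) / 32 := by
        field_simp
      rw [this]
      linarith
  have hA1 := hf.measure_not_norm_proj_sq_le hk (l := l) (B := B) (by linarith) (by
    rw [one_div, inv_pow, ← div_eq_mul_inv, ← mul_div_assoc, div_le_one (by positivity)]
    linarith) hB0 (by
    refine le_trans ?_ hB
    rw [hB₀]
    have : 0 ≤ (N * K) ^ 2 := sq_nonneg _
    nlinarith)
  -- for the remainder `sgn ρ` the incoherence condition leaves no exceptional observables
  have hstart : IsIncoherent μ u (HermMat.proj ρ) r β δ (support ρ) 1 := by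
    refine ⟨proj_support ρ, ?_, ?_⟩
    · rw [norm_support_sq hρ.1, hrank]
      simp
    · have : {α | 1 * β < |inner ℝ (u α) (support ρ)|} = ∅ := by
        refine Set.eq_empty_of_forall_notMem fun α hα => ?_
        simp only [Set.mem_ofPred_eq, one_mul] at hα
        by_cases h : α ∈ E
        · rw [hu0 α h, inner_zero_left, abs_zero] at hα
          linarith
        · have h1 : hsInner (w α) (sgn ρ) ^ 2 ≤ ν * r / (n : ℝ) ^ 2 := by
            by_contra h'
            exact h (Or.inl fun h'' => h' h''.2)
          rw [hu1 α h, HermMat.inner_eq, HermMat.toMat_ofMat,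
            toMat_support hρ.1] at hα
          have h2 : β = √(ν * r / (n : ℝ) ^ 2) := by
            rw [hβ, Real.sqrt_div' _ (by positivity), Real.sqrt_sq hn'.le]
          rw [h2] at hα
          exact absurd (Real.abs_le_sqrt h1) (not_le.mpr hα)
      rw [this]
      simpa using hδ.le
  let Q : HermMat n → ℝ := fun x => ‖HermMat.compress ρ x‖
  have hQm : Measurable Q :=
    ((LinearMap.toContinuousLinearMap (HermMat.compress ρ)).continuous.norm).measurable
  have hstep : ∀ x s, 0 < s → IsIncoherent μ u (HermMat.proj ρ) r β δ x s →
      (Measure.pi fun _ : Fin k => μ).real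
        {ω | ¬ (IsIncoherent μ u (HermMat.proj ρ) r β δ
          (golfStep N u (HermMat.proj ρ) ω x) (s / 2) ∧ Q (batchOp N u ω x) ≤ s / 4)} ≤ η := by
    intro x s hs hx
    exact hf.measureReal_not_step_le hk hr' hβ0 hδ ha hak hθ' hkδ htail hbias
      (fun x s hs hx => hf.measureReal_lt_norm_compress_le hk hr' hβ0 hδ hη0 hbias' t ht hvar
        x s hs hx) hs hx
  have hA2 := hf.measure_not_golf_le hQm (by simp [Q]) (fun x y => by
    simp only [Q, map_add]; exact norm_add_le _ _) hη0 hstep l one_pos hstart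
  obtain ⟨f, hΨ⟩ := exists_batches μ hlk
  set A₁ : Set (Fin l → Fin k → S) := {ω | ¬ ∀ d, (∀ i j, inner ℝ (u (ω i j)) d = 0) →
    ‖HermMat.proj ρ d‖ ^ 2 ≤ 4 * B * ‖d - HermMat.proj ρ d‖ ^ 2} with hA₁
  set A₂ : Set (Fin l → Fin k → S) :=
    {ω | ¬ (‖golfRem N u (HermMat.proj ρ) l ω (support ρ)‖ ^ 2 ≤ (1 / 2 ^ l) ^ 2 * r ∧
      Q (golfCert N u (HermMat.proj ρ) l ω (support ρ)) ≤ 1 / 2)} with hA₂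
  set Ψ : (Fin m → S) → Fin l → Fin k → S := fun s i j => s (f i j) with hΨdef
  have hsub : {s : Fin m → S | solutions (fun i => w (s i)) ρ ≠ {ρ}} ⊆
      {s | ∃ i, s i ∈ E} ∪ (Ψ ⁻¹' A₁ ∪ Ψ ⁻¹' A₂) := by
    intro s hs
    by_contra hcon
    simp only [Set.mem_union, Set.mem_preimage, not_or] at hcon
    obtain ⟨h0, h1, h2⟩ := hcon
    simp only [Set.mem_ofPred_eq, not_exists] at h0
    rw [hA₁, Set.mem_ofPred_eq, not_not] at h1
    rw [hA₂, Set.mem_ofPred_eq, not_not] at h2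
    refine hs (solutions_eq_singleton hn hρ fun d hd hdt => ?_)
    have hd' : ∀ i j, inner ℝ (u (Ψ s i j)) d = 0 := by
      intro i j
      rw [hu1 (s (f i j)) (h0 (f i j)), HermMat.inner_eq, HermMat.toMat_ofMat]
      exact hd (f i j)
    refine eq_zero_of_traceNorm_add_le hρ (B := B)
      (inner_golfCert_eq_zero (N := N) (P := HermMat.proj ρ) l (Ψ s) (support ρ) hd')
      (proj_golfCert (HermMat.proj_proj ρ) l (Ψ s) (proj_support ρ))
      (proj_golfRem (HermMat.proj_proj ρ) l (Ψ s) (proj_support ρ)) h2.2 (h1 d hd') ?_ hdt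
    calc 16 * (B * ‖golfRem N u (HermMat.proj ρ) l (Ψ s) (support ρ)‖ ^ 2)
        ≤ 16 * (B * ((1 / 2 ^ l) ^ 2 * r)) := by gcongr; exact h2.1
      _ = 16 * (B * r) / 4 ^ l := by
          have : (4 : ℝ) ^ l = (2 ^ l) ^ 2 := by rw [← pow_mul, mul_comm, pow_mul]; norm_num
          rw [this]
          field_simp
      _ < 1 := (div_lt_one (by positivity)).mpr hBl
  have hB1 : (Measure.pi fun _ : Fin m => μ) {s | ∃ i, s i ∈ E} ≤ ENNReal.ofReal (1 / 16) := by
    refine (measure_exists_mem_le μ m E).trans ?_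
    rw [← ofReal_measureReal, ← ENNReal.ofReal_natCast, ← ENNReal.ofReal_mul (Nat.cast_nonneg m)]
    exact ENNReal.ofReal_le_ofReal hE
  have hB2 := (hΨ.measure_preimage_le A₁).trans hA1
  have hB3 := ((hΨ.measure_preimage_le A₂).trans hA2).trans (ENNReal.ofReal_le_ofReal hη)
  calc failureProb μ w ρ m ≤ (Measure.pi fun _ : Fin m => μ)
        ({s | ∃ i, s i ∈ E} ∪ (Ψ ⁻¹' A₁ ∪ Ψ ⁻¹' A₂)) := measure_mono hsub
    _ ≤ ENNReal.ofReal (1 / 16) + (ENNReal.ofReal (1 / 16) + ENNReal.ofReal (1 / 8)) :=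
        (measure_union_le _ _).trans (add_le_add hB1 ((measure_union_le _ _).trans
          (add_le_add hB2 hB3)))
    _ = ENNReal.ofReal (1 / 4) := by
        rw [← ENNReal.ofReal_add (by norm_num) (by norm_num),
          ← ENNReal.ofReal_add (by norm_num) (by norm_num)]
        norm_num
    _ < ENNReal.ofReal (1 / 2) := (ENNReal.ofReal_lt_ofReal_iff (by norm_num)).mpr (by norm_num)
    _ = 1 / 2 := by
        rw [ENNReal.ofReal_div_of_pos (by norm_num)]
        simp

end FailureProbability

/-! ### Numerical estimates -/

section Parameters

/-- The tail bound of a golfing step, for the mass `δ = η / (8 k n³ L)`: the exponential beats all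
polynomial factors as soon as `k / (n r)` is a large multiple of `L²`. -/
lemma exp_tail_le {L x r k η : ℝ} (hL : 1 ≤ L) (hx : 1 ≤ x) (hxL : x ≤ Real.exp L) (hr : 1 ≤ r)
    (hrx : r ≤ x) (hk : 2 * 10 ^ 10 * L ^ 4 * (x * r) ≤ k) (hη : 1 / (152 * L) ≤ η) :
    8 * Real.exp (-(1 / (64 * (x ^ 2 * (2 * L * r / x) / k)))) ≤ η / (8 * k * x ^ 3 * L) * η := by
  have hL0 : 0 < L := by linarith
  have hx0 : 0 < x := by linarith
  have hr0 : 0 < r := by linarith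
  have hk0 : 0 < k := lt_of_lt_of_le (by positivity) hk
  have hη0 : 0 < η := lt_of_lt_of_le (by positivity) hη
  set z := k / (128 * L * x * r) with hz
  have hz0 : 0 < z := by positivity
  have hkz : k = 128 * L * x * r * z := by rw [hz]; field_simp
  have hexp : 1 / (64 * (x ^ 2 * (2 * L * r / x) / k)) = z := by
    rw [hz]
    field_simp
    norm_num
  have hzL : 58 * L ≤ z := by
    rw [hz, le_div_iff₀ (by positivity)]
    refine le_trans ?_ hk
    have h1 : L ^ 2 ≤ L ^ 4 := pow_le_pow_right₀ hL (by norm_num)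
    have h2 : 0 ≤ x * r := by positivity
    have h3 : L ^ 2 * (x * r) ≤ L ^ 4 * (x * r) := by gcongr
    have h4 : 0 ≤ L ^ 4 * (x * r) := by positivity
    nlinarith
  have hLe : L ≤ Real.exp L := by linarith [Real.add_one_le_exp L]
  have he20 : (4 : ℝ) * 10 ^ 8 ≤ Real.exp (20 * L) := by
    calc (4 : ℝ) * 10 ^ 8 ≤ 2.7182818283 ^ 20 := by norm_num
      _ ≤ Real.exp 1 ^ 20 := by
          gcongr
          exact Real.exp_one_gt_d9.le
      _ = Real.exp (20 * 1) := by
          rw [← Real.exp_nat_mul]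
          norm_num
      _ ≤ _ := by gcongr
  have he29 : 4 * 10 ^ 8 * L ^ 4 * x ^ 5 ≤ Real.exp (z / 2) := by
    calc 4 * 10 ^ 8 * L ^ 4 * x ^ 5 ≤ Real.exp (20 * L) * Real.exp L ^ 4 * Real.exp L ^ 5 := by
          gcongr
      _ = Real.exp (29 * L) := by
          rw [← Real.exp_nat_mul, ← Real.exp_nat_mul, ← Real.exp_add, ← Real.exp_add]
          congr 1
          push_cast
          ring
      _ ≤ _ := by
          gcongr
          linarith
  have hez : z / 2 * (4 * 10 ^ 8 * L ^ 4 * x ^ 5) ≤ Real.exp z := by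
    have h1 : Real.exp z = Real.exp (z / 2) * Real.exp (z / 2) := by
      rw [← Real.exp_add]
      congr 1
      ring
    rw [h1]
    have h2 := Real.add_one_le_exp (z / 2)
    gcongr
    linarith
  have hη2 : 1 ≤ 23104 * L ^ 2 * η ^ 2 := by
    have h1 : 1 ≤ 152 * L * η := by
      rw [div_le_iff₀ (by positivity)] at hη
      linarith
    calc (1 : ℝ) ≤ (152 * L * η) ^ 2 := one_le_pow₀ h1
      _ = _ := by ring
  have hmain : 64 * k * x ^ 3 * L ≤ η ^ 2 * Real.exp z := by
    calc 64 * k * x ^ 3 * L = 8192 * (L ^ 2 * x ^ 4 * z) * r := by rw [hkz]; ring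
      _ ≤ 8192 * (L ^ 2 * x ^ 4 * z) * x := by gcongr
      _ = 8192 * (L ^ 2 * x ^ 5 * z) * 1 := by ring
      _ ≤ 8192 * (L ^ 2 * x ^ 5 * z) * (23104 * L ^ 2 * η ^ 2) := by gcongr
      _ = 189267968 * (η ^ 2 * (z * L ^ 4 * x ^ 5)) := by ring
      _ ≤ 200000000 * (η ^ 2 * (z * L ^ 4 * x ^ 5)) := by gcongr; norm_num
      _ = η ^ 2 * (z / 2 * (4 * 10 ^ 8 * L ^ 4 * x ^ 5)) := by ring
      _ ≤ _ := by gcongr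
  rw [hexp, Real.exp_neg, ← div_eq_mul_inv, div_mul_eq_mul_div, div_le_div_iff₀ (Real.exp_pos z)
    (by positivity)]
  linarith

/-- The matrix variance of a golfing step is a small multiple of `η ^ 2`: with `β² = L r / n²`, its
leading term is of order `L² n r / k`. -/
lemma variance_parameter_le {L x r k η c : ℝ} (hL : 1 ≤ L) (hx : 1 ≤ x) (hr : 1 ≤ r)
    (hk : 2 * 10 ^ 10 * L ^ 4 * (x * r) ≤ k) (hη : 1 / (152 * L) ≤ η) (hc0 : 0 ≤ c)
    (hc : c ≤ 24 * L) :
    4096 * (c * (4 * x * x ^ 2 * (√(L * r) / x) ^ 2 / k +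
      4 * c * ((x ^ 2) ^ 2 * (√(L * r) / x) ^ 2 * L / k ^ 2))) ≤ η ^ 2 := by
  have hL0 : 0 < L := by linarith
  have hx0 : 0 < x := by linarith
  have hr0 : 0 < r := by linarith
  have hk0 : 0 < k := lt_of_lt_of_le (by positivity) hk
  set y := x * r / k with hy
  have hy0 : 0 < y := by positivity
  have hyL : 2 * 10 ^ 10 * (L ^ 4 * y) ≤ 1 := by
    have : 2 * 10 ^ 10 * (L ^ 4 * y) = 2 * 10 ^ 10 * L ^ 4 * (x * r) / k := by rw [hy]; ring
    rw [this, div_le_one hk0]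
    exact hk
  have e1 : 4 * x * x ^ 2 * (√(L * r) / x) ^ 2 / k = 4 * L * y := by
    rw [div_pow, Real.sq_sqrt (by positivity), hy]
    field_simp
  have e2 : (x ^ 2) ^ 2 * (√(L * r) / x) ^ 2 * L / k ^ 2 ≤ L ^ 2 * y ^ 2 := by
    have : (x ^ 2) ^ 2 * (√(L * r) / x) ^ 2 * L / k ^ 2 = L ^ 2 * (x ^ 2 * r / k ^ 2) := by
      rw [div_pow, Real.sq_sqrt (by positivity)]
      field_simp
    rw [this, hy, div_pow, mul_pow]
    gcongr
    nlinarith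
  have h1 : L ^ 4 * (393216 * (L ^ 2 * y) + 9437184 * (L ^ 4 * y ^ 2)) ≤ L ^ 2 / 23104 := by
    have h3 : L ^ 4 * (L ^ 4 * y ^ 2) = (L ^ 4 * y) ^ 2 := by ring
    have h4 : 0 ≤ L ^ 4 * y := by positivity
    have h5 : 1 ≤ L ^ 2 := one_le_pow₀ hL
    have h6 : L ^ 4 * (L ^ 2 * y) = L ^ 2 * (L ^ 4 * y) := by ring
    have h7 : L ^ 2 * (L ^ 4 * y) ≤ L ^ 2 * (1 / (2 * 10 ^ 10)) := by
      gcongr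
      linarith
    have h8 : (L ^ 4 * y) ^ 2 ≤ (1 / (2 * 10 ^ 10)) ^ 2 := by
      gcongr
      linarith
    rw [mul_add, mul_left_comm, h6, mul_left_comm (L ^ 4) 9437184, h3]
    norm_num at h7 h8 ⊢
    linarith
  have hη2 : 1 / (23104 * L ^ 2) ≤ η ^ 2 := by
    calc 1 / (23104 * L ^ 2) = (1 / (152 * L)) ^ 2 := by rw [div_pow, mul_pow]; norm_num
      _ ≤ _ := by gcongr
  have h2 : 393216 * (L ^ 2 * y) + 9437184 * (L ^ 4 * y ^ 2) ≤ 1 / (23104 * L ^ 2) := by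
    have h3 : 1 / (23104 * L ^ 2) = L ^ 2 / 23104 / L ^ 4 := by field_simp
    rw [h3, le_div_iff₀ (by positivity)]
    linarith
  refine le_trans ?_ (h2.trans hη2)
  rw [e1]
  calc _ ≤ 4096 * (24 * L * (4 * L * y + 4 * (24 * L) * (L ^ 2 * y ^ 2))) := by gcongr
    _ = _ := by ring

end Parameters

/-! ### Choice of parameters -/

section Recovery

variable {n : ℕ} {S : Type*} [MeasurableSpace S] {μ : Measure S} [IsProbabilityMeasure μ]
  {w : S → Matrix (Fin n) (Fin n) ℂ} {ρ : Matrix (Fin n) (Fin n) ℂ}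

/-- A power of two of order `L` that dominates `log₂ n`. -/
lemma exists_two_pow_le {L : ℝ} (hL : 1 ≤ L) (hn : (n : ℝ) ≤ Real.exp L) :
    ∃ t : ℕ, n ≤ 2 ^ 2 ^ t ∧ (4 * 2 ^ t : ℝ) ≤ 24 * L := by
  set p := ⌈2 * L⌉₊ with hp
  have hp1 : 2 * L ≤ p := Nat.le_ceil _
  have hp2 : (p : ℝ) < 2 * L + 1 := Nat.ceil_lt_add_one (by linarith)
  have hp3 : 1 < p := by
    have : (1 : ℝ) < p := by linarith
    exact_mod_cast this
  refine ⟨Nat.clog 2 p, ?_, ?_⟩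
  · have h1 : (n : ℝ) ≤ 2 ^ p := by
      calc (n : ℝ) ≤ Real.exp L := hn
        _ ≤ Real.exp (p * (1 / 2)) := by gcongr; linarith
        _ = Real.exp (1 / 2) ^ p := by rw [Real.exp_nat_mul]
        _ ≤ 2 ^ p := by
            gcongr
            have h2 := Real.exp_one_lt_d9
            have h3 : Real.exp (1 / 2) ^ 2 = Real.exp 1 := by
              rw [← Real.exp_nat_mul]
              norm_num
            nlinarith [Real.exp_pos (1 / 2)]
    have h2 : n ≤ 2 ^ p := by exact_mod_cast h1
    exact h2.trans (Nat.pow_le_pow_right (by norm_num) (Nat.le_pow_clog (by norm_num) p))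
  · have h1 : 2 ^ (Nat.clog 2 p - 1) < p := Nat.pow_pred_clog_lt_self (by norm_num) hp3
    have h2 : 0 < Nat.clog 2 p := Nat.clog_pos (by norm_num) hp3
    have h3 : (2 : ℝ) ^ Nat.clog 2 p = 2 * 2 ^ (Nat.clog 2 p - 1) := by
      rw [← pow_succ', Nat.sub_add_cancel h2]
    have h4 : ((2 : ℝ) ^ (Nat.clog 2 p - 1)) < p := by exact_mod_cast h1
    rw [h3]
    linarith

/-- After `18 L` halvings, all factors that are polynomial in `n ≤ exp L` and `L` are absorbed. -/
lemma lt_four_pow {L x r : ℝ} (hL : 1 ≤ L) (hx : 1 ≤ x) (hxL : x ≤ Real.exp L) (hrx : r ≤ x)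
    {l : ℕ} (hl : 18 * L ≤ l) :
    16 * (256 * x ^ 2 * (x ^ 2 * L) ^ 2 * r) < 4 ^ l := by
  have hL0 : 0 < L := by linarith
  have hx0 : 0 < x := by linarith
  have hLe : L ≤ Real.exp L := by linarith [Real.add_one_le_exp L]
  have h9 : (4096 : ℝ) < Real.exp (9 * L) := by
    calc (4096 : ℝ) < 2.7182818283 ^ 9 := by norm_num
      _ ≤ Real.exp 1 ^ 9 := by
          gcongr
          exact Real.exp_one_gt_d9.le
      _ = Real.exp (9 * 1) := by
          rw [← Real.exp_nat_mul]
          norm_num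
      _ ≤ _ := by gcongr
  calc 16 * (256 * x ^ 2 * (x ^ 2 * L) ^ 2 * r)
      ≤ 16 * (256 * x ^ 2 * (x ^ 2 * L) ^ 2 * x) := by gcongr
    _ = 4096 * (x ^ 7 * L ^ 2) := by ring
    _ < Real.exp (9 * L) * (x ^ 7 * L ^ 2) := by gcongr
    _ ≤ Real.exp (9 * L) * (Real.exp L ^ 7 * Real.exp L ^ 2) := by gcongr
    _ = Real.exp (18 * L) := by
        rw [← Real.exp_nat_mul, ← Real.exp_nat_mul, ← Real.exp_add, ← Real.exp_add]
        congr 1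
        push_cast
        ring
    _ ≤ Real.exp (l * 1) := Real.exp_le_exp.mpr (by linarith)
    _ = Real.exp 1 ^ l := Real.exp_nat_mul 1 l
    _ ≤ 4 ^ l := by
        gcongr
        linarith [Real.exp_one_lt_d9]

set_option maxHeartbeats 1000000 in
/-- Recovery from `m ≥ 10¹² L⁵ n r` observables, where `L` bounds the coherence, the norms of the
observables and `log n`. -/
theorem failureProb_lt_half (hw : IsTightFrame μ w) (hρ : IsState ρ) {r m : ℕ} (hrank : ρ.rank = r)
    (hn : 0 < n) (hr : 0 < r) {L : ℝ} (hL : 1 ≤ L) (hnL : (n : ℝ) ≤ Real.exp L)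
    (hwL : ∀ᵐ α ∂μ, hsNormSq (w α) ≤ L) (hm : 10 ^ 12 * L ^ 5 * n * r ≤ m)
    (hC : μ.real (badSet w ρ r L) ≤ 1 / (16 * √(r : ℝ) * (n : ℝ) ^ 2 * m)) :
    failureProb μ w ρ m < 1 / 2 := by
  have hL0 : 0 < L := by linarith
  have hx : (1 : ℝ) ≤ n := by exact_mod_cast hn
  have hr1 : (1 : ℝ) ≤ r := by exact_mod_cast hr
  have hrn : (r : ℝ) ≤ n := by
    have := Matrix.rank_le_width ρ
    rw [hrank] at this
    exact_mod_cast this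
  have hx0 : (0 : ℝ) < n := by linarith
  have hr0 : (0 : ℝ) < r := by linarith
  have hsr : 1 ≤ √(r : ℝ) := Real.one_le_sqrt.mpr hr1
  have hnr : (1 : ℝ) ≤ n * r := one_le_mul_of_one_le_of_one_le hx hr1
  have hLp : ∀ i j : ℕ, i ≤ j → L ^ i ≤ L ^ j := fun i j hij => pow_le_pow_right₀ hL hij
  have hm' : 10 ^ 12 * L ^ 5 * (n * r) ≤ m := by rw [← mul_assoc]; exact hm
  have hmL : 10 ^ 12 * L ≤ m := by
    have h1 := hLp 1 5 (by norm_num)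
    rw [pow_one] at h1
    calc 10 ^ 12 * L ≤ 10 ^ 12 * L ^ 5 * 1 := by linarith
      _ ≤ 10 ^ 12 * L ^ 5 * (n * r) := by gcongr
      _ ≤ m := hm'
  have hm0 : (0 : ℝ) < m := by linarith
  -- the number of batches
  set l := ⌈18 * L⌉₊ with hl
  have hl1 : 18 * L ≤ l := Nat.le_ceil _
  have hl2 : (l : ℝ) ≤ 19 * L := by
    have : (l : ℝ) < 18 * L + 1 := Nat.ceil_lt_add_one (by linarith)
    linarith
  have hl0 : (0 : ℝ) < l := by linarith
  have hlN : 0 < l := by exact_mod_cast hl0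
  have hpow := lt_four_pow hL hx hnL hrn hl1
  -- the size of a batch
  set k := m / l with hk
  have hlk : l * k ≤ m := Nat.mul_div_le m l
  have hlk' : (m : ℝ) ≤ 2 * l * k := by
    have h1 : m < l * (k + 1) := Nat.lt_mul_div_succ m hlN
    have h2 : (m : ℝ) < l * (k + 1) := by exact_mod_cast h1
    have h3 : 2 * (l : ℝ) ≤ m := by linarith
    linarith
  have hkm : m ≤ 38 * L * (k : ℝ) := by
    exact hlk'.trans (mul_le_mul_of_nonneg_right (by linarith) (Nat.cast_nonneg k))
  have hkG : 2 * 10 ^ 10 * L ^ 4 * (n * r) ≤ (k : ℝ) := by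
    have h1 := hm'.trans hkm
    have h2 : 38 * L * (2 * 10 ^ 10 * L ^ 4 * (n * r)) ≤ 38 * L * (k : ℝ) := by
      refine le_trans ?_ h1
      have h3 : 0 ≤ L ^ 5 * (n * r) := by positivity
      nlinarith
    exact le_of_mul_le_mul_left h2 (by positivity)
  have hk0 : (0 : ℝ) < k := lt_of_lt_of_le (by positivity) hkG
  have hk1 : (1 : ℝ) ≤ k := by
    have : 0 < k := by exact_mod_cast hk0
    exact_mod_cast this
  set η : ℝ := 1 / (8 * l) with hη
  have hη0 : 0 < η := by positivity
  have hηL : 1 / (152 * L) ≤ η := by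
    exact one_div_le_one_div_of_le (by positivity) (by linarith)
  have hη8 : η ≤ 1 / 8 := by
    exact one_div_le_one_div_of_le (by norm_num) (by linarith)
  -- small enough for `k δ ≪ η` and for the truncation bias `n³ L δ`
  set δ : ℝ := η / (8 * k * n ^ 3 * L) with hδ
  have hδ0 : 0 < δ := by positivity
  -- `n² K μ(C)`, by the assumption on `μ(C)`
  set ε : ℝ := L / (16 * √(r : ℝ) * m) with hε
  have hε0 : 0 < ε := by positivity
  obtain ⟨t, ht1, ht2⟩ := exists_two_pow_le (n := n) hL hnL
  have hE : μ.real (IsTightFrame.exceptional w ρ r L L) ≤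
      1 / (16 * √(r : ℝ) * (n : ℝ) ^ 2 * m) := by
    have h1 : μ.real {α | L < hsNormSq (w α)} = 0 := by
      rw [measureReal_def, ENNReal.toReal_eq_zero_iff]
      left
      rw [ae_iff] at hwL
      simpa only [not_le] using hwL
    refine (measureReal_union_le _ _).trans ?_
    rw [h1, add_zero]
    exact hC
  have hnδ : (n : ℝ) ^ 3 * L * δ ≤ 1 / 64 := by
    have h1 : (n : ℝ) ^ 3 * L * δ = η / (8 * k) := by
      rw [hδ]
      field_simp
    rw [h1, div_le_iff₀ (by positivity)]
    linarith
  have hnε : (n : ℝ) * ε ≤ 1 / (10 ^ 4 * L) := by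
    have h2 : (n : ℝ) * ε ≤ n * L / m := by
      rw [hε, ← mul_div_assoc]
      gcongr
      have : (1 : ℝ) ≤ 16 * √(r : ℝ) := by linarith
      nlinarith
    refine h2.trans ?_
    rw [div_le_div_iff₀ hm0 (by positivity), one_mul]
    refine le_trans ?_ hm'
    have h3 := hLp 2 5 (by norm_num)
    have h4 : L ^ 2 * (n * 1) ≤ L ^ 5 * (n * r) := by gcongr
    have h5 : 0 ≤ L ^ 5 * (n * r) := by positivity
    linarith
  have hnε' : (n : ℝ) * ε ≤ 1 / 10 ^ 4 := by
    refine hnε.trans ?_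
    gcongr
    linarith
  clear_value ε δ η k l
  refine failureProb_lt_half_of_parameters (l := l) (k := k) (t := t) (ν := L) (K := L) (ε := ε)
    (η := η) (δ := δ) (a := (n : ℝ) ^ 2 * (2 * L * r / n) / k) hw hρ hrank hn hr hL0 hL0.le hwL
    (by exact_mod_cast hk0) hlk ?_ ?_ rfl hδ0 (by positivity) ?_ (by linarith) le_rfl ?_ ?_
    (by rw [hδ]; exact exp_tail_le hL hx hnL hr1 hrn hkG hηL) ?_ ?_ ht1
    (variance_parameter_le hL hx hr1 hkG hηL (by positivity) ht2) ?_ ?_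
  · calc (m : ℝ) * _ ≤ m * (1 / (16 * √(r : ℝ) * (n : ℝ) ^ 2 * m)) := by gcongr
      _ = 1 / (16 * (√(r : ℝ) * (n : ℝ) ^ 2)) := by field_simp
      _ ≤ 1 / 16 := by
          gcongr
          have h1 : 1 ≤ √(r : ℝ) * (n : ℝ) ^ 2 :=
            one_le_mul_of_one_le_of_one_le hsr (one_le_pow₀ hx)
          linarith
  · calc (n : ℝ) ^ 2 * L * _ ≤ (n : ℝ) ^ 2 * L * (1 / (16 * √(r : ℝ) * (n : ℝ) ^ 2 * m)) := by
          gcongr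
      _ = ε := by rw [hε]; field_simp
  · rw [hη]
    refine le_of_eq ?_
    field_simp
  · refine le_trans ?_ hηL
    have h1 : (n : ℝ) ^ 2 * (2 * L * r / n) / k ≤ 1 / (10 ^ 10 * L) := by
      have e : (n : ℝ) ^ 2 * (2 * L * r / n) / k = 2 * L * (n * r) / k := by field_simp
      rw [e, div_le_div_iff₀ hk0 (by positivity), one_mul]
      refine le_trans ?_ hkG
      have h3 := hLp 2 4 (by norm_num)
      calc 2 * L * (n * r) * (10 ^ 10 * L) = 2 * 10 ^ 10 * L ^ 2 * (n * r) := by ring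
        _ ≤ _ := by gcongr
    have h2 : 2 * (n : ℝ) ^ 2 * ε ^ 2 ≤ 2 * (1 / (10 ^ 4 * L) * (1 / 10 ^ 4)) := by
      have e : 2 * (n : ℝ) ^ 2 * ε ^ 2 = 2 * ((n * ε) * (n * ε)) := by ring
      rw [e]
      gcongr
    have e1 : ∀ c : ℝ, 1 / (c * L) = 1 / c * (1 / L) := fun c => by rw [one_div_mul_one_div]
    have h4 : 0 < 1 / L := by positivity
    rw [e1] at h1 h2 ⊢
    generalize 1 / L = y at h1 h2 h4 ⊢
    norm_num at h1 h2 ⊢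
    linarith
  · have h1 : 4 * (k * δ) = η / (2 * (n ^ 3 * L)) := by
      rw [hδ]
      field_simp
      norm_num
    rw [h1]
    refine div_le_self hη0.le ?_
    have : (1 : ℝ) ≤ n ^ 3 * L := one_le_mul_of_one_le_of_one_le (one_le_pow₀ hx) hL
    linarith
  · rw [le_div_iff₀ hx0]
    have h1 : 4 * ((ε + (n : ℝ) ^ 2 * L * δ) * √(L * r)) * n =
        4 * (n * ε + n ^ 3 * L * δ) * √(L * r) := by ring
    rw [h1]
    refine mul_le_of_le_one_left (Real.sqrt_nonneg _) ?_
    norm_num at hnε' ⊢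
    linarith
  · have h1 : ε * √(r : ℝ) ≤ 1 / 100 := by
      have e : ε * √(r : ℝ) = L / (16 * m) := by rw [hε]; field_simp
      rw [e, div_le_iff₀ (by positivity)]
      linarith
    have h2 : (n : ℝ) ^ 2 * L * δ * √(r : ℝ) ≤ 1 / 64 := by
      refine le_trans ?_ hnδ
      have h3 : √(r : ℝ) ≤ n := by
        rw [Real.sqrt_le_iff]
        exact ⟨hx0.le, hrn.trans (by nlinarith)⟩
      calc (n : ℝ) ^ 2 * L * δ * √(r : ℝ) ≤ (n : ℝ) ^ 2 * L * δ * n := by gcongr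
        _ = _ := by ring
    rw [add_mul]
    linarith
  · refine le_trans ?_ hpow.le
    have h2 : (1 : ℝ) ≤ ((n : ℝ) ^ 2 * L) ^ 2 :=
      one_le_pow₀ (one_le_mul_of_one_le_of_one_le (one_le_pow₀ hx) hL)
    have h3 : 1 ≤ ((n : ℝ) ^ 2 * L) ^ 2 * r := one_le_mul_of_one_le_of_one_le h2 hr1
    have h4 : 256 * (n : ℝ) ^ 2 * 1 ≤ 256 * (n : ℝ) ^ 2 * (((n : ℝ) ^ 2 * L) ^ 2 * r) := by
      gcongr
    have h5 : 0 ≤ 256 * (n : ℝ) ^ 2 * ((n : ℝ) ^ 2 * L) ^ 2 * r := by positivity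
    linarith
  · exact hpow

end Recovery

section Polylog

lemma IsPolylog.of_le_pow {f : ℕ → ℝ} {d e : ℕ}
    (hf : f =O[atTop] fun n : ℕ => Real.log n ^ d) (hde : d ≤ e) :
    f =O[atTop] fun n : ℕ => Real.log n ^ e := by
  refine hf.trans (IsBigO.of_bound 1 ?_)
  filter_upwards [(Real.tendsto_log_atTop.comp tendsto_natCast_atTop_atTop).eventually_ge_atTop 1]
    with n hn
  simp only [Function.comp_apply] at hn
  rw [one_mul, Real.norm_of_nonneg (by positivity), Real.norm_of_nonneg (by positivity)]
  exact pow_le_pow_right₀ hn hde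

lemma IsPolylog.add {f g : ℕ → ℝ} (hf : IsPolylog f) (hg : IsPolylog g) :
    IsPolylog fun n => f n + g n := by
  obtain ⟨d, hd⟩ := hf
  obtain ⟨e, he⟩ := hg
  exact ⟨max d e, (of_le_pow hd (le_max_left d e)).add (of_le_pow he (le_max_right d e))⟩

lemma IsPolylog.abs {f : ℕ → ℝ} (hf : IsPolylog f) : IsPolylog fun n => |f n| := by
  obtain ⟨d, hd⟩ := hf
  exact ⟨d, hd.norm_left⟩

lemma IsPolylog.pow {f : ℕ → ℝ} (hf : IsPolylog f) (p : ℕ) : IsPolylog fun n => f n ^ p := by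
  obtain ⟨d, hd⟩ := hf
  refine ⟨d * p, ?_⟩
  simpa only [pow_mul] using hd.pow p

lemma IsPolylog.const_mul {f : ℕ → ℝ} (hf : IsPolylog f) (c : ℝ) :
    IsPolylog fun n => c * f n := by
  obtain ⟨d, hd⟩ := hf
  exact ⟨d, hd.const_mul_left c⟩

lemma isPolylog_const (c : ℝ) : IsPolylog fun _ => c :=
  ⟨0, by simpa using isBigO_const_const c (one_ne_zero (α := ℝ)) atTop⟩

lemma isPolylog_log : IsPolylog fun n => Real.log n :=
  ⟨1, by simpa using isBigO_refl (fun n : ℕ => Real.log n) atTop⟩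

lemma badSet_anti {n : ℕ} {S : Type*} (w : S → Matrix (Fin n) (Fin n) ℂ)
    (ρ : Matrix (Fin n) (Fin n) ℂ) (r : ℕ) {ν ν' : ℝ} (h : ν ≤ ν') :
    badSet w ρ r ν' ⊆ badSet w ρ r ν := by
  intro α hα hα'
  refine hα ⟨hα'.1.trans ?_, hα'.2.trans ?_⟩
  · gcongr
  · gcongr

lemma rank_pos_of_isState {n : ℕ} {ρ : Matrix (Fin n) (Fin n) ℂ} (hρ : IsState ρ) :
    0 < ρ.rank := by
  rw [Nat.pos_iff_ne_zero]
  intro h0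
  have h1 : ρ = 0 := by
    have := norm_support_sq hρ.1
    rw [h0, Nat.cast_zero, sq_eq_zero_iff, norm_eq_zero] at this
    have h2 : (1 - kerProj ρ) = 0 := congrArg HermMat.toMat this
    have h3 : ρ * (1 - kerProj ρ) = ρ := by rw [mul_sub, mul_kerProj, mul_one, sub_zero]
    rw [← h3, h2, mul_zero]
  have h2 := hρ.2
  rw [h1, Matrix.trace_zero] at h2
  exact zero_ne_one h2

end Polylog

end QCS

theorem mainTheorem3 (ν K : ℕ → ℝ) (hν : QCS.IsPolylog ν) (hK : QCS.IsPolylog K) :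
    ∃ q : ℕ → ℝ, QCS.IsPolylog q ∧
      ∀ (n r m : ℕ) (S : Type u) [MeasurableSpace S] (μ : Measure S) [IsProbabilityMeasure μ]
        (w : S → Matrix (Fin n) (Fin n) ℂ) (ρ : Matrix (Fin n) (Fin n) ℂ),
        QCS.IsTightFrame μ w →
        (∀ᵐ α ∂μ, QCS.hsNormSq (w α) ≤ K n) →
        QCS.IsState ρ → ρ.rank = r →
        q n * n * r ≤ m →
        μ.real (QCS.badSet w ρ r (ν n)) ≤ 1 / (16 * √(r : ℝ) * (n : ℝ) ^ 2 * m) →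
        QCS.failureProb μ w ρ m < 1 / 2 := by
  let L : ℕ → ℝ := fun n => 1 + |ν n| + |K n| + Real.log n
  have hL : QCS.IsPolylog L :=
    (((QCS.isPolylog_const 1).add hν.abs).add hK.abs).add QCS.isPolylog_log
  refine ⟨fun n => 10 ^ 12 * L n ^ 5, (hL.pow 5).const_mul _, ?_⟩
  intro n r m S _ μ _ w ρ hw hwK hρ hrank hm hC
  have hr : 0 < r := hrank ▸ QCS.rank_pos_of_isState hρ
  have hn : 0 < n := by
    have := Matrix.rank_le_width ρ
    omega
  have h1 : 0 ≤ Real.log n := Real.log_natCast_nonneg n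
  have h2 : 1 ≤ L n := by
    have := abs_nonneg (ν n)
    have := abs_nonneg (K n)
    simp only [L]
    linarith
  have h3 : ν n ≤ L n := by
    have := le_abs_self (ν n)
    have := abs_nonneg (K n)
    simp only [L]
    linarith
  have h4 : K n ≤ L n := by
    have := le_abs_self (K n)
    have := abs_nonneg (ν n)
    simp only [L]
    linarith
  have h5 : Real.log n ≤ L n := by
    have := abs_nonneg (ν n)
    have := abs_nonneg (K n)
    simp only [L]
    linarith
  have h6 : (n : ℝ) ≤ Real.exp (L n) := by
    rw [← Real.log_le_iff_le_exp (by exact_mod_cast hn)]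
    exact h5
  refine QCS.failureProb_lt_half hw hρ hrank hn hr h2 h6 ?_ hm ?_
  · filter_upwards [hwK] with α hα
    exact hα.trans h4
  · exact (measureReal_mono (QCS.badSet_anti w ρ r h3)).trans hC
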